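/- Let $C$ be a compact connected Riemann surface of genus $g(C)=\dim H^0(C,\Omega^1_C)\ge 1$, let $p\in C$, and let $\mathcal{O}(p)$ be the holomorphic line bundle on $C$ associated with the divisor $p$. Let $$0\to\mathcal{O}\to V\to\mathcal{O}(p)\to 0$$ be an extension of holomorphic vector bundles on $C$ that is nontrivial, i.e. does not split holomorphically. Then: 1. The rank-2 bundle $V$ is stable: every holomorphic sub-bundle $L\subset V$ with $0<\operatorname{rank}L<\operatorname{rank}V$ satisfies $\mu(L)<\mu(V)$, where $\mu(E)=\deg(E)/\operatorname{rank}(E)$ and $\deg(E)=\int_C c_1(E)$ is the degree of $\det E$, that is, the degree of the divisor of any nonzero meromorphic section of $\det E$. 2. Let $\mathbb{P}(V)$ be the projectivization of $V$, the compact complex surface whose points are the lines in the fibres of $V$. Every holomorphic vector field on $\mathbb{P}(V)$ that vanishes at some point of $\mathbb{P}(V)$ vanishes identically. -/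

import Mathlib

open Bundle Set Topology
open scoped Manifold ContDiff LinearAlgebra.Projectivization

noncomputable section

namespace RuledSurface

/-! ### Curves -/

section Curve

variable (C : Type*) [TopologicalSpace C] [ChartedSpace ℂ C] [IsManifold 𝓘(ℂ) ω C]

/-- The space `H⁰(C, Ω¹)` of global holomorphic `1`-forms on a Riemann surface `C`: holomorphic
sections of the (holomorphic) cotangent bundle. -/
abbrev HolomorphicOneForm : Type _ :=
  ContMDiffSection 𝓘(ℂ) (ℂ →L[ℂ] ℂ) ω
    (fun x : C => (TangentSpace 𝓘(ℂ) x →L[ℂ] Bundle.Trivial C ℂ x))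

/-- The genus of a compact Riemann surface, `g = dim H⁰(C, Ω¹)`. -/
def genus : ℕ := Module.finrank ℂ (HolomorphicOneForm C)

end Curve

/-! ### Holomorphic bundle maps, degree, slope, stability -/

section Bundles

variable {C : Type*} [TopologicalSpace C] [ChartedSpace ℂ C]

section Hom

variable (F₁ : Type*) [NormedAddCommGroup F₁] [NormedSpace ℂ F₁]
  (V₁ : C → Type*) [∀ x, AddCommGroup (V₁ x)] [∀ x, Module ℂ (V₁ x)]
  [TopologicalSpace (TotalSpace F₁ V₁)] [∀ x, TopologicalSpace (V₁ x)] [FiberBundle F₁ V₁]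
  (F₂ : Type*) [NormedAddCommGroup F₂] [NormedSpace ℂ F₂]
  (V₂ : C → Type*) [∀ x, AddCommGroup (V₂ x)] [∀ x, Module ℂ (V₂ x)]
  [TopologicalSpace (TotalSpace F₂ V₂)] [∀ x, TopologicalSpace (V₂ x)] [FiberBundle F₂ V₂]

/-- A homomorphism of holomorphic vector bundles over `C` (covering the identity): a family of
linear maps of the fibres such that the induced map of total spaces is holomorphic. -/
structure HolHom where
  toFun : ∀ x, V₁ x →ₗ[ℂ] V₂ x
  holomorphic : ContMDiff (𝓘(ℂ).prod 𝓘(ℂ, F₁)) (𝓘(ℂ).prod 𝓘(ℂ, F₂)) ω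
    (fun v : TotalSpace F₁ V₁ => (⟨v.1, toFun v.1 v.2⟩ : TotalSpace F₂ V₂))

end Hom

section Degree

variable (F : Type*) [NormedAddCommGroup F] [NormedSpace ℂ F] [FiniteDimensional ℂ F]
  (V : C → Type*) [∀ x, AddCommGroup (V x)] [∀ x, Module ℂ (V x)]
  [TopologicalSpace (TotalSpace F V)] [∀ x, TopologicalSpace (V x)] [FiberBundle F V]
  [VectorBundle ℂ F V]

/-- The fibre at `x` of the determinant line bundle `det V = ⋀ʳ V`, `r = rank V`. -/
abbrev DetFiber (x : C) : Type _ := ⋀[ℂ]^(Module.finrank ℂ F) (V x)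

/-- The trivialization of `det V` near `x` induced by the trivialization of `V` near `x`
(and a fixed basis of the model fibre): it sends `v₁ ∧ ⋯ ∧ vᵣ` to the determinant of the
coordinate vectors of the `vⱼ`. -/
def detCoord (x y : C) : DetFiber F V y →ₗ[ℂ] ℂ :=
  exteriorPower.alternatingMapLinearEquiv
    ((Module.finBasis ℂ F).det.compLinearMap ((trivializationAt F V x).linearMapAt ℂ y))

variable {V} in
/-- The local expression of a section `σ` of `det V` near `x`, as a function of the
coordinate of `C` at `x`. -/
def localExpr (σ : ∀ y, DetFiber F V y) (x : C) : ℂ → ℂ :=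
  fun z => detCoord F V x ((chartAt ℂ x).symm z) (σ ((chartAt ℂ x).symm z))

variable {V} in
/-- The order (of vanishing; negative for a pole) at `x` of a section of `det V`;
it is `⊤` if the section vanishes identically near `x`. -/
def sectionOrder (σ : ∀ y, DetFiber F V y) (x : C) : WithTop ℤ :=
  meromorphicOrderAt (localExpr F σ x) (chartAt ℂ x x)

variable {V} in
/-- `σ` is a meromorphic section of `det V` which vanishes identically near no point. (At a pole,
the value of `σ` is irrelevant.) -/
structure IsRationalSection (σ : ∀ y, DetFiber F V y) : Prop where
  meromorphic : ∀ x, MeromorphicAt (localExpr F σ x) (chartAt ℂ x x)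
  order_ne_top : ∀ x, sectionOrder F σ x ≠ ⊤

variable {V} in
/-- The degree of the divisor of a section of `det V`: the number of zeros minus the number of
poles, with multiplicity. -/
def divisorDegree (σ : ∀ y, DetFiber F V y) : ℤ :=
  ∑ᶠ x, (sectionOrder F σ x).untop₀

open Classical in
/-- The degree `deg V = deg (det V) = ∫_C c₁(V)` of a holomorphic vector bundle on a compact
Riemann surface: the degree of the divisor of a nonzero meromorphic section of `det V`. (Such a
section always exists, and the degree of its divisor does not depend on it.) -/
def degree : ℤ :=
  if h : ∃ σ : ∀ y, DetFiber F V y, IsRationalSection F σ then divisorDegree F h.choose else 0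

/-- The slope `μ(V) = deg V / rank V`. -/
def slope : ℚ := degree F V / Module.finrank ℂ F

end Degree

section Stable

universe u v w

variable {C : Type u} [TopologicalSpace C] [ChartedSpace ℂ C]
  (F : Type v) [NormedAddCommGroup F] [NormedSpace ℂ F] [FiniteDimensional ℂ F]
  (V : C → Type w) [∀ x, AddCommGroup (V x)] [∀ x, Module ℂ (V x)]
  [TopologicalSpace (TotalSpace F V)] [∀ x, TopologicalSpace (V x)] [FiberBundle F V]
  [VectorBundle ℂ F V]

/-- A holomorphic vector bundle `V` is stable if `μ(L) < μ(V)` for every holomorphic sub-bundle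
`L ⊂ V` with `0 < rank L < rank V`. A sub-bundle is given by a holomorphic vector bundle together
with a holomorphic homomorphism to `V` that is injective on every fibre. -/
def IsStable : Prop :=
  ∀ (k : ℕ), 0 < k → k < Module.finrank ℂ F →
  ∀ (L : C → Type w) [∀ x, AddCommGroup (L x)] [∀ x, Module ℂ (L x)]
    [TopologicalSpace (TotalSpace (Fin k → ℂ) L)] [∀ x, TopologicalSpace (L x)]
    [FiberBundle (Fin k → ℂ) L] [VectorBundle ℂ (Fin k → ℂ) L]
    [ContMDiffVectorBundle ω (Fin k → ℂ) L 𝓘(ℂ)]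
    (j : HolHom (Fin k → ℂ) L F V), (∀ x, Function.Injective (j.toFun x)) →
    slope (Fin k → ℂ) L < slope F V

end Stable

end Bundles

/-! ### The line bundle `𝒪(p)` -/

section PointBundle

variable {C : Type*} [TopologicalSpace C] [ChartedSpace ℂ C]

/-- The local equation of the divisor `p` on the two open sets `C ∖ {p}` (index `false`) and the
coordinate neighbourhood of `p` (index `true`): the function `1`, resp. a coordinate centred
at `p`. -/
def localEq (p : C) (i : Bool) (x : C) : ℂ :=
  if i then chartAt ℂ p x - chartAt ℂ p p else 1

/-- The open cover of `C` by `C ∖ {p}` and the coordinate neighbourhood of `p`. -/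
def pointCover (p : C) (i : Bool) : Set C :=
  if i then (chartAt ℂ p).source else {p}ᶜ

/-- The transition functions of `𝒪(p)`: the quotients of the local equations of the divisor `p`. -/
def pointTransition (p : C) (i j : Bool) (x : C) : ℂ :=
  if i = j then 1 else localEq p j x / localEq p i x

theorem isOpen_pointCover [T1Space C] (p : C) (i : Bool) : IsOpen (pointCover p i) := by
  cases i
  · simp [pointCover]
  · simpa [pointCover] using (chartAt ℂ p).open_source

theorem localEq_ne_zero (p : C) {i : Bool} {x : C} (hx : x ∈ pointCover p i) (hp : x ≠ p) :
    localEq p i x ≠ 0 := by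
  cases i
  · simp [localEq]
  · simp only [localEq, pointCover, if_true] at hx ⊢
    exact fun h => hp ((chartAt ℂ p).injOn hx (mem_chart_source ℂ p) (sub_eq_zero.mp h))

theorem ne_of_mem_pointCover (p : C) {i j : Bool} {x : C} (hij : i ≠ j)
    (hx : x ∈ pointCover p i ∩ pointCover p j) : x ≠ p := by
  rintro rfl
  cases i <;> cases j <;> simp_all [pointCover]

theorem contMDiffOn_localEq [IsManifold 𝓘(ℂ) ω C] (p : C) (i : Bool) :
    ContMDiffOn 𝓘(ℂ) 𝓘(ℂ) ω (localEq p i) (pointCover p i) := by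
  cases i
  · exact (contMDiffOn_const (c := (1 : ℂ))).congr fun x _ => rfl
  · exact ((contMDiffOn_chart (x := p)).sub (contMDiffOn_const (c := chartAt ℂ p p))).congr
      fun x _ => rfl

theorem contMDiffOn_pointTransition [IsManifold 𝓘(ℂ) ω C] (p : C) (i j : Bool) :
    ContMDiffOn 𝓘(ℂ) 𝓘(ℂ) ω (pointTransition p i j) (pointCover p i ∩ pointCover p j) := by
  by_cases hij : i = j
  · exact (contMDiffOn_const (c := (1 : ℂ))).congr fun x _ => if_pos hij
  · exact (((contMDiffOn_localEq p j).mono inter_subset_right).div₀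
      ((contMDiffOn_localEq p i).mono inter_subset_left)
      (fun x hx => localEq_ne_zero p hx.1 (ne_of_mem_pointCover p hij hx))).congr
      fun x _ => if_neg hij

theorem contMDiffOn_pointTransition_smul [IsManifold 𝓘(ℂ) ω C] (p : C) (i j : Bool) :
    ContMDiffOn 𝓘(ℂ) 𝓘(ℂ, ℂ →L[ℂ] ℂ) ω
      (fun x => pointTransition p i j x • ContinuousLinearMap.id ℂ ℂ)
      (pointCover p i ∩ pointCover p j) :=
  (contMDiffOn_pointTransition p i j).smul contMDiffOn_const

variable [T1Space C] [IsManifold 𝓘(ℂ) ω C]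

open Classical in
/-- The cocycle defining the line bundle `𝒪(p)`. A local holomorphic section of `𝒪(p)` is a local
meromorphic function `f` with at most a simple pole at `p`, represented by `f` on `C ∖ {p}` and by
`z f` near `p`, where `z` is a coordinate centred at `p`. -/
def pointBundleCore (p : C) : VectorBundleCore ℂ C ℂ Bool where
  baseSet := pointCover p
  isOpen_baseSet := isOpen_pointCover p
  indexAt x := decide (x = p)
  mem_baseSet_at x := by
    by_cases h : x = p
    · subst h; simp [pointCover]
    · simp [h, pointCover]
  coordChange i j x := pointTransition p i j x • ContinuousLinearMap.id ℂ ℂ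
  coordChange_self i x _ v := by simp [pointTransition]
  continuousOn_coordChange i j := (contMDiffOn_pointTransition_smul p i j).continuousOn
  coordChange_comp i j k x hx v := by
    by_cases hij : i = j
    · subst hij; simp [pointTransition]
    by_cases hjk : j = k
    · subst hjk; simp [pointTransition]
    have hp : x ≠ p := ne_of_mem_pointCover p hij hx.1
    have h1 := localEq_ne_zero p hx.1.1 hp
    have h2 := localEq_ne_zero p hx.1.2 hp
    have hik : i = k := by cases i <;> cases j <;> cases k <;> simp_all
    subst hik
    simp only [pointTransition, hij, hjk, if_false, if_true, smul_apply,
      ContinuousLinearMap.id_apply, smul_eq_mul]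
    field_simp

instance (p : C) : (pointBundleCore p).IsContMDiff 𝓘(ℂ) ω where
  contMDiffOn_coordChange := contMDiffOn_pointTransition_smul p

/-- The fibres of the holomorphic line bundle `𝒪(p)`. -/
abbrev PointBundle (p : C) : C → Type := (pointBundleCore p).Fiber

end PointBundle

/-! ### The ruled surface `ℙ(V)` -/

section Projectivization

universe u w

variable {C : Type u} [TopologicalSpace C]
  (V : C → Type w) [∀ x, AddCommGroup (V x)] [∀ x, Module ℂ (V x)]
  [TopologicalSpace (TotalSpace (Fin 2 → ℂ) V)] [∀ x, TopologicalSpace (V x)]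
  [FiberBundle (Fin 2 → ℂ) V] [VectorBundle ℂ (Fin 2 → ℂ) V]

/-- The projectivization `ℙ(V)` of a rank two bundle: its points are the lines in the fibres. -/
@[ext] structure ProjBundle where
  base : C
  line : ℙ ℂ (V base)

variable {V}

open Classical in
/-- The linear isomorphism of the fibre at `y` with `ℂ²` given by a trivialization `e` (for `y` in
the domain of `e`; elsewhere some isomorphism, which is never used). -/
def frame (e : Trivialization (Fin 2 → ℂ) (π (Fin 2 → ℂ) V)) [MemTrivializationAtlas e] (y : C) :
    V y ≃ₗ[ℂ] (Fin 2 → ℂ) :=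
  if hy : y ∈ e.baseSet then e.linearEquivAt ℂ y hy
  else (trivializationAt (Fin 2 → ℂ) V y).linearEquivAt ℂ y
    (FiberBundle.mem_baseSet_trivializationAt' y)

/-- The vector with `i`-th coordinate `1` and other coordinate `t`. -/
def affVec (i : Fin 2) (t : ℂ) : Fin 2 → ℂ := Function.update (fun _ => t) i 1

/-- The affine coordinate of the line spanned by `w`, on the open set `w i ≠ 0` of `ℙ¹`. -/
def affCoord (i : Fin 2) (w : Fin 2 → ℂ) : ℂ := w (1 - i) / w i

theorem affVec_self (i : Fin 2) (t : ℂ) : affVec i t i = 1 := by simp [affVec]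

theorem affVec_other (i : Fin 2) (t : ℂ) : affVec i t (1 - i) = t := by
  fin_cases i <;> simp [affVec]

theorem affVec_ne_zero (i : Fin 2) (t : ℂ) : affVec i t ≠ 0 := fun h => by
  simpa [affVec_self] using congrFun h i

theorem affVec_affCoord (i : Fin 2) (w : Fin 2 → ℂ) (h : w i ≠ 0) :
    affVec i (affCoord i w) = (w i)⁻¹ • w := by
  ext k
  fin_cases i <;> fin_cases k <;> simp_all [affVec, affCoord, div_eq_inv_mul]

theorem affCoord_smul (i : Fin 2) (c : ℂ) (hc : c ≠ 0) (w : Fin 2 → ℂ) :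
    affCoord i (c • w) = affCoord i w := by
  simp [affCoord, mul_div_mul_left _ _ hc]

/-- The line in `V y` spanned by the vector whose coordinates in the trivialization `e` are `w`. -/
def frameLine (e : Trivialization (Fin 2 → ℂ) (π (Fin 2 → ℂ) V)) [MemTrivializationAtlas e]
    (y : C) (w : Fin 2 → ℂ) (hw : w ≠ 0) : ℙ ℂ (V y) :=
  Projectivization.mk ℂ ((frame e y).symm w) (by simpa using hw)

/-- Homogeneous coordinates of a point of `ℙ(V)` in the trivialization `e`. -/
def homCoord (e : Trivialization (Fin 2 → ℂ) (π (Fin 2 → ℂ) V)) [MemTrivializationAtlas e]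
    (q : ProjBundle V) : Fin 2 → ℂ := frame e q.base q.line.rep

theorem homCoord_ne_zero (e : Trivialization (Fin 2 → ℂ) (π (Fin 2 → ℂ) V))
    [MemTrivializationAtlas e] (q : ProjBundle V) : homCoord e q ≠ 0 := by
  simpa [homCoord] using q.line.rep_nonzero

theorem exists_homCoord_frameLine (e e' : Trivialization (Fin 2 → ℂ) (π (Fin 2 → ℂ) V))
    [MemTrivializationAtlas e] [MemTrivializationAtlas e'] (y : C) (w : Fin 2 → ℂ) (hw : w ≠ 0) :
    ∃ c : ℂ, c ≠ 0 ∧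
      homCoord e' ⟨y, frameLine e y w hw⟩ = c • frame e' y ((frame e y).symm w) := by
  obtain ⟨a, ha⟩ := Projectivization.exists_smul_eq_mk_rep ℂ ((frame e y).symm w)
    (by simpa using hw)
  exact ⟨a, a.ne_zero, by simp only [homCoord, frameLine, ← ha, Units.smul_def, map_smul]⟩

theorem frame_frame_symm (e e' : Trivialization (Fin 2 → ℂ) (π (Fin 2 → ℂ) V))
    [MemTrivializationAtlas e] [MemTrivializationAtlas e'] {y : C}
    (hy : y ∈ e.baseSet ∩ e'.baseSet) (w : Fin 2 → ℂ) :
    frame e' y ((frame e y).symm w) = e.coordChangeL ℂ e' y w := by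
  rw [Trivialization.coordChangeL_apply e e' hy, frame, frame, dif_pos hy.1, dif_pos hy.2]
  rfl

theorem frameLine_homCoord (e : Trivialization (Fin 2 → ℂ) (π (Fin 2 → ℂ) V))
    [MemTrivializationAtlas e] (q : ProjBundle V) (c : ℂ)
    (h : c • homCoord e q ≠ 0) : frameLine e q.base (c • homCoord e q) h = q.line := by
  conv_rhs => rw [← q.line.mk_rep]
  rw [frameLine, Projectivization.mk_eq_mk_iff']
  exact ⟨c, by simp [homCoord]⟩

/-- The chart of `ℙ(V)` given by a trivialization `e` of `V`, a chart `φ` of `C` and an index `i`: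
the line spanned by a vector of `V y` with coordinates `w` in `e`, `w i ≠ 0`, is sent to
`(φ y, w (1 - i) / w i)`. -/
def projChart (e : Trivialization (Fin 2 → ℂ) (π (Fin 2 → ℂ) V)) [MemTrivializationAtlas e]
    (φ : OpenPartialHomeomorph C ℂ) (i : Fin 2) : PartialEquiv (ProjBundle V) (ℂ × ℂ) where
  toFun q := (φ q.base, affCoord i (homCoord e q))
  invFun a := ⟨φ.symm a.1, frameLine e (φ.symm a.1) (affVec i a.2) (affVec_ne_zero i a.2)⟩
  source := {q | q.base ∈ φ.source ∧ q.base ∈ e.baseSet ∧ homCoord e q i ≠ 0}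
  target := {a | a.1 ∈ φ.target ∧ φ.symm a.1 ∈ e.baseSet}
  map_source' q hq := ⟨φ.map_source hq.1, by simpa [φ.left_inv hq.1] using hq.2.1⟩
  map_target' a ha := by
    refine ⟨φ.map_target ha.1, ha.2, ?_⟩
    obtain ⟨c, hc, h⟩ := exists_homCoord_frameLine e e (φ.symm a.1) (affVec i a.2)
      (affVec_ne_zero i a.2)
    rw [h]
    simpa [affVec_self] using hc
  left_inv' q hq := by
    obtain ⟨h1, h2, h3⟩ := hq
    have key : ∀ (y : C), y = q.base →
        (⟨y, frameLine e y (affVec i (affCoord i (homCoord e q))) (affVec_ne_zero i _)⟩ :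
          ProjBundle V) = q := by
      rintro y rfl
      have h4 : (homCoord e q i)⁻¹ • homCoord e q ≠ 0 :=
        smul_ne_zero (inv_ne_zero h3) (homCoord_ne_zero e q)
      have := frameLine_homCoord e q _ h4
      simp only [affVec_affCoord i _ h3, this]
    exact key _ (φ.left_inv h1)
  right_inv' a ha := by
    obtain ⟨c, hc, h⟩ := exists_homCoord_frameLine e e (φ.symm a.1) (affVec i a.2)
      (affVec_ne_zero i a.2)
    simp only [h, affCoord_smul i c hc, LinearEquiv.apply_symm_apply, φ.right_inv ha.1]
    simp [affCoord, affVec_self, affVec_other]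

/-- The transition map between two charts of `ℙ(V)`, as a formula. -/
def projTrans (e e' : Trivialization (Fin 2 → ℂ) (π (Fin 2 → ℂ) V))
    [MemTrivializationAtlas e] [MemTrivializationAtlas e'] (φ φ' : OpenPartialHomeomorph C ℂ)
    (i i' : Fin 2) (a : ℂ × ℂ) : ℂ × ℂ :=
  (φ' (φ.symm a.1), affCoord i'
    ((e.coordChangeL ℂ e' (φ.symm a.1) : (Fin 2 → ℂ) →L[ℂ] (Fin 2 → ℂ)) (affVec i a.2)))

theorem projChart_trans_source (e e' : Trivialization (Fin 2 → ℂ) (π (Fin 2 → ℂ) V))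
    [MemTrivializationAtlas e] [MemTrivializationAtlas e'] (φ φ' : OpenPartialHomeomorph C ℂ)
    (i i' : Fin 2) :
    ((projChart e φ i).symm.trans (projChart e' φ' i')).source =
      {a | a.1 ∈ φ.target ∩ φ.symm ⁻¹' (e.baseSet ∩ e'.baseSet ∩ φ'.source) ∧
        (e.coordChangeL ℂ e' (φ.symm a.1) : (Fin 2 → ℂ) →L[ℂ] (Fin 2 → ℂ)) (affVec i a.2) i'
          ≠ 0} := by
  ext a
  obtain ⟨c, hc, h⟩ := exists_homCoord_frameLine e e' (φ.symm a.1) (affVec i a.2)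
      (affVec_ne_zero i a.2)
  simp only [PartialEquiv.trans_source, PartialEquiv.symm_source, projChart, mem_inter_iff,
    mem_preimage, mem_ofPred_eq, PartialEquiv.coe_symm_mk, h]
  constructor
  · rintro ⟨⟨h1, h2⟩, h3, h4, h5⟩
    rw [frame_frame_symm e e' ⟨h2, h4⟩] at h5
    exact ⟨⟨h1, ⟨h2, h4⟩, h3⟩, right_ne_zero_of_mul h5⟩
  · rintro ⟨⟨h1, ⟨h2, h4⟩, h3⟩, h5⟩
    refine ⟨⟨h1, h2⟩, h3, h4, ?_⟩
    rw [frame_frame_symm e e' ⟨h2, h4⟩]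
    exact mul_ne_zero hc h5

theorem projChart_trans_eqOn (e e' : Trivialization (Fin 2 → ℂ) (π (Fin 2 → ℂ) V))
    [MemTrivializationAtlas e] [MemTrivializationAtlas e'] (φ φ' : OpenPartialHomeomorph C ℂ)
    (i i' : Fin 2) :
    EqOn ((projChart e φ i).symm.trans (projChart e' φ' i')) (projTrans e e' φ φ' i i')
      ((projChart e φ i).symm.trans (projChart e' φ' i')).source := by
  intro a ha
  rw [projChart_trans_source] at ha
  obtain ⟨c, hc, h⟩ := exists_homCoord_frameLine e e' (φ.symm a.1) (affVec i a.2)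
      (affVec_ne_zero i a.2)
  simp only [PartialEquiv.coe_trans, Function.comp_apply, projChart, PartialEquiv.coe_symm_mk, h,
    affCoord_smul i' c hc, frame_frame_symm e e' ha.1.2.1]
  rfl

theorem contDiff_affVec (i : Fin 2) : ContDiff ℂ ω (affVec i) := by
  refine contDiff_pi.mpr fun k => ?_
  fin_cases i <;> fin_cases k <;> simp [affVec, contDiff_const, contDiff_fun_id]

variable [ChartedSpace ℂ C] [IsManifold 𝓘(ℂ) ω C] [ContMDiffVectorBundle ω (Fin 2 → ℂ) V 𝓘(ℂ)]

theorem contDiffOn_coordChange_affVec (e e' : Trivialization (Fin 2 → ℂ) (π (Fin 2 → ℂ) V))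
    [MemTrivializationAtlas e] [MemTrivializationAtlas e'] {φ : OpenPartialHomeomorph C ℂ}
    (hφ : φ ∈ atlas ℂ C) (i : Fin 2) :
    ContDiffOn ℂ ω (fun a : ℂ × ℂ =>
      (e.coordChangeL ℂ e' (φ.symm a.1) : (Fin 2 → ℂ) →L[ℂ] (Fin 2 → ℂ)) (affVec i a.2))
      {a | a.1 ∈ φ.target ∩ φ.symm ⁻¹' (e.baseSet ∩ e'.baseSet)} := by
  have h1 : ContMDiffOn 𝓘(ℂ) 𝓘(ℂ, (Fin 2 → ℂ) →L[ℂ] (Fin 2 → ℂ)) ω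
      (fun z => (e.coordChangeL ℂ e' (φ.symm z) : (Fin 2 → ℂ) →L[ℂ] (Fin 2 → ℂ)))
      (φ.target ∩ φ.symm ⁻¹' (e.baseSet ∩ e'.baseSet)) :=
    (contMDiffOn_coordChangeL (n := ω) (IB := 𝓘(ℂ)) e e').comp
      ((contMDiffOn_symm_of_mem_maximalAtlas
        (IsManifold.subset_maximalAtlas (n := ω) (I := 𝓘(ℂ)) hφ)).mono inter_subset_left)
      (fun z hz => hz.2)
  exact (h1.contDiffOn.comp contDiffOn_fst (fun a ha => ha)).clm_apply
    ((contDiff_affVec i).comp_contDiffOn contDiffOn_snd)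

theorem isOpen_projChart_trans_source (e e' : Trivialization (Fin 2 → ℂ) (π (Fin 2 → ℂ) V))
    [MemTrivializationAtlas e] [MemTrivializationAtlas e'] {φ φ' : OpenPartialHomeomorph C ℂ}
    (hφ : φ ∈ atlas ℂ C) (i i' : Fin 2) :
    IsOpen ((projChart e φ i).symm.trans (projChart e' φ' i')).source := by
  rw [projChart_trans_source]
  have hU : IsOpen (φ.target ∩ φ.symm ⁻¹' (e.baseSet ∩ e'.baseSet)) :=
    φ.symm.isOpen_inter_preimage (e.open_baseSet.inter e'.open_baseSet)
  have hU' : IsOpen (φ.target ∩ φ.symm ⁻¹' φ'.source) :=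
    φ.symm.isOpen_inter_preimage φ'.open_source
  have h := (contDiffOn_coordChange_affVec e e' hφ i).continuousOn
  have h2 := ((continuous_apply i').comp_continuousOn h).isOpen_inter_preimage
    (hU.preimage continuous_fst) (isOpen_ne (x := (0 : ℂ)))
  refine (congrArg IsOpen (Set.ext fun a => ?_)).mpr
    (IsOpen.inter h2 (hU'.preimage continuous_fst))
  simp only [mem_inter_iff, mem_preimage, mem_ofPred_eq, Function.comp_apply]
  tauto

theorem contDiffOn_projTrans (e e' : Trivialization (Fin 2 → ℂ) (π (Fin 2 → ℂ) V))
    [MemTrivializationAtlas e] [MemTrivializationAtlas e'] {φ φ' : OpenPartialHomeomorph C ℂ}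
    (hφ : φ ∈ atlas ℂ C) (hφ' : φ' ∈ atlas ℂ C) (i i' : Fin 2) :
    ContDiffOn ℂ ω ((projChart e φ i).symm.trans (projChart e' φ' i'))
      ((projChart e φ i).symm.trans (projChart e' φ' i')).source := by
  refine ContDiffOn.congr ?_ (projChart_trans_eqOn e e' φ φ' i i')
  rw [projChart_trans_source]
  have h := contDiffOn_coordChange_affVec e e' hφ i
  have hk : ∀ k : Fin 2, ContDiffOn ℂ ω (fun a : ℂ × ℂ =>
      (e.coordChangeL ℂ e' (φ.symm a.1) : (Fin 2 → ℂ) →L[ℂ] (Fin 2 → ℂ)) (affVec i a.2) k)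
      {a | a.1 ∈ φ.target ∩ φ.symm ⁻¹' (e.baseSet ∩ e'.baseSet ∩ φ'.source) ∧
        (e.coordChangeL ℂ e' (φ.symm a.1) : (Fin 2 → ℂ) →L[ℂ] (Fin 2 → ℂ)) (affVec i a.2) i'
          ≠ 0} :=
    fun k => (contDiffOn_pi.mp h k).mono fun a ha => ⟨ha.1.1, ha.1.2.1⟩
  have h1 : ContMDiffOn 𝓘(ℂ) 𝓘(ℂ) ω (fun z => φ' (φ.symm z)) (φ.target ∩ φ.symm ⁻¹' φ'.source) :=
    (contMDiffOn_of_mem_maximalAtlas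
        (IsManifold.subset_maximalAtlas (n := ω) (I := 𝓘(ℂ)) hφ')).comp
      ((contMDiffOn_symm_of_mem_maximalAtlas
        (IsManifold.subset_maximalAtlas (n := ω) (I := 𝓘(ℂ)) hφ)).mono inter_subset_left)
      (fun z hz => hz.2)
  exact (h1.contDiffOn.comp contDiffOn_fst (fun a ha => ⟨ha.1.1, ha.1.2.2⟩)).prodMk
    ((hk (1 - i')).div (hk i') fun a ha => ha.2)

variable (V) in
open Classical in
/-- The atlas of `ℙ(V)` consisting of all charts `projChart e φ i`. -/
def projCore : ChartedSpaceCore (ℂ × ℂ) (ProjBundle V) where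
  atlas := {ψ | ∃ (e : Trivialization (Fin 2 → ℂ) (π (Fin 2 → ℂ) V))
    (_ : MemTrivializationAtlas e) (φ : OpenPartialHomeomorph C ℂ) (_ : φ ∈ atlas ℂ C)
    (i : Fin 2), ψ = projChart e φ i}
  chartAt q := projChart (trivializationAt (Fin 2 → ℂ) V q.base) (chartAt ℂ q.base)
    (if homCoord (trivializationAt (Fin 2 → ℂ) V q.base) q 0 ≠ 0 then 0 else 1)
  mem_chart_source q := by
    refine ⟨mem_chart_source ℂ q.base, FiberBundle.mem_baseSet_trivializationAt' q.base, ?_⟩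
    split_ifs with h
    · exact h
    · intro h1
      refine homCoord_ne_zero (trivializationAt (Fin 2 → ℂ) V q.base) q ?_
      ext k
      fin_cases k
      · simpa using h
      · exact h1
  chart_mem_atlas q := ⟨_, inferInstance, _, chart_mem_atlas ℂ q.base, _, rfl⟩
  open_source := by
    rintro _ _ ⟨e, _, φ, hφ, i, rfl⟩ ⟨e', _, φ', hφ', i', rfl⟩
    exact isOpen_projChart_trans_source e e' hφ i i'
  continuousOn_toFun := by
    rintro _ _ ⟨e, _, φ, hφ, i, rfl⟩ ⟨e', _, φ', hφ', i', rfl⟩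
    exact (contDiffOn_projTrans e e' hφ hφ' i i').continuousOn

instance : TopologicalSpace (ProjBundle V) := (projCore V).toTopologicalSpace

instance : ChartedSpace (ℂ × ℂ) (ProjBundle V) := (projCore V).toChartedSpace

/-- `ℙ(V)` is a complex surface. -/
instance : IsManifold 𝓘(ℂ, ℂ × ℂ) ω (ProjBundle V) := by
  refine isManifold_of_contDiffOn _ _ _ fun ψ ψ' hψ hψ' => ?_
  change ψ ∈ ⋃ (e : PartialEquiv (ProjBundle V) (ℂ × ℂ)) (he : e ∈ (projCore V).atlas),
    {(projCore V).openPartialHomeomorph e he} at hψ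
  change ψ' ∈ ⋃ (e : PartialEquiv (ProjBundle V) (ℂ × ℂ)) (he : e ∈ (projCore V).atlas),
    {(projCore V).openPartialHomeomorph e he} at hψ'
  simp only [mem_iUnion, mem_singleton_iff] at hψ hψ'
  obtain ⟨_, ⟨e, _, φ, hφ, i, rfl⟩, rfl⟩ := hψ
  obtain ⟨_, ⟨e', _, φ', hφ', i', rfl⟩, rfl⟩ := hψ'
  have h := contDiffOn_projTrans e e' hφ hφ' i i'
  refine h.mono fun a ha => ?_
  exact ha.1

variable (V) in
/-- Holomorphic vector fields on `ℙ(V)`: holomorphic sections of its holomorphic tangent bundle. -/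
abbrev HolomorphicVectorField : Type _ :=
  ContMDiffSection 𝓘(ℂ, ℂ × ℂ) (ℂ × ℂ) ω
    (fun s : ProjBundle V => TangentSpace 𝓘(ℂ, ℂ × ℂ) s)

end Projectivization

end RuledSurface

end

open Bundle Set Topology
open scoped Manifold ContDiff LinearAlgebra.Projectivization

noncomputable section

namespace RuledSurface

open Filter

set_option linter.unusedSectionVars false

/-! ### Local multiplicities of a meromorphic function on `ℂ` -/

/-! Stability. Write `e` for the image in `V` of the section `1` of `𝒪`. Let `L` be a line
sub-bundle and consider the composite `L → V → 𝒪(p)`. If it is zero, then `L` lies in `𝒪`, is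
isomorphic to it and has degree 0. Otherwise the zeros of the composite number `1 - deg L`, so `deg
L ≥ 1` would leave no zeros; the composite would be an isomorphism and its inverse would split the
extension. Hence `deg L ≤ 0 < 1/2 = μ(V)` (`divisorDegree_le_zero`, `degree_extension`). The degree
is meaningful because a nonzero meromorphic function on `C` has as many zeros as poles
(`finsum_ordAt_eq_zero`): the number of points where a value is taken is locally constant in the
value.

Simplicity. In genus at least 1, `H⁰(𝒪(p))` is spanned by the canonical section
(`exists_eq_smul_canSec`). Indeed, a function `f` whose only pole is a simple one at `p` takes each
value once, so `df` has no zeros; for a holomorphic form `η` the quotient `η / df` is then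
holomorphic and zero at `p`, hence zero everywhere. Given an endomorphism `φ` of `V`, the section
`q(φ e)` of `𝒪(p)` therefore vanishes at `p`, and subtracting a scalar makes `φ e` vanish at `p`. If
`q(φ e)` were nonzero, `φ e` would, up to a constant, extend to a splitting `𝒪(p) → V`. So `φ` kills
`𝒪` and acts on `𝒪(p)` by a constant, which must be 0 since otherwise `φ` again gives a splitting.
What remains is a homomorphism `𝒪(p) → 𝒪`, and that is zero. Thus every endomorphism of `V` is
scalar (`exists_eq_smul_id`).

Vector fields. The component of a field along the base is constant on each fibre `ℙ¹` by Liouville,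
so it is a vector field on `C`. Paired with a nonzero holomorphic 1-form it gives a constant, which
is 0 if the field has a zero; so the field is vertical (`baseCompAt_eq_zero`). On a fibre a vertical
field is quadratic in the affine coordinate, that is, an element of `sl₂`; these glue to a traceless
holomorphic endomorphism of `V` (`vertEnd_coordChange`, `holSecAt_bundleEnd`). It is scalar by
simplicity, and a traceless scalar is zero. -/

/-- The multiplicity with which `f` takes the value `c` at `z`. -/
def localMult (f : ℂ → ℂ) (c z : ℂ) : ℕ :=
  (meromorphicOrderAt (fun w => f w - c) z).untop₀.toNat

theorem localMult_congr {f g : ℂ → ℂ} {c z : ℂ} (h : f =ᶠ[𝓝[≠] z] g) :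
    localMult f c z = localMult g c z := by
  unfold localMult
  rw [meromorphicOrderAt_congr (f₂ := fun w => g w - c) (h.mono fun w hw => by simp [hw])]

theorem localMult_eq_of_analyticOrderAt {f : ℂ → ℂ} {c z : ℂ} (hf : AnalyticAt ℂ f z) {m : ℕ}
    (h : analyticOrderAt (fun w => f w - c) z = m) : localMult f c z = m := by
  have : AnalyticAt ℂ (fun w => f w - c) z := hf.fun_sub analyticAt_const
  simp [localMult, this.meromorphicOrderAt_eq, h]

theorem localMult_eq_zero_of_ne {f : ℂ → ℂ} {c z : ℂ} (hf : AnalyticAt ℂ f z) (h : f z ≠ c) :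
    localMult f c z = 0 := by
  refine localMult_eq_of_analyticOrderAt hf ?_
  have : AnalyticAt ℂ (fun w => f w - c) z := hf.fun_sub analyticAt_const
  simpa [this.analyticOrderAt_eq_zero, sub_eq_zero] using h

theorem localMult_eq_one {f : ℂ → ℂ} {z : ℂ} (hf : AnalyticAt ℂ f z) (h : deriv f z ≠ 0) :
    localMult f (f z) z = 1 :=
  localMult_eq_of_analyticOrderAt hf (hf.analyticOrderAt_sub_eq_one_of_deriv_ne_zero h)

/-- Write `f = (z - z₀)^m g` with `g z₀ ≠ 0` and extract an `m`-th root of `g`. Normalizing by `g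
z₀` keeps the argument of the logarithm near 1, where it is analytic; `a` is a root of `g z₀`. -/
theorem exists_analyticAt_pow_eq {f : ℂ → ℂ} {z₀ : ℂ} (hf : AnalyticAt ℂ f z₀) {m : ℕ}
    (hm : m ≠ 0) (h : analyticOrderAt f z₀ = m) :
    ∃ r : ℂ → ℂ, AnalyticAt ℂ r z₀ ∧ r z₀ = 0 ∧ deriv r z₀ ≠ 0 ∧ ∀ᶠ z in 𝓝 z₀, f z = r z ^ m := by
  obtain ⟨g, hg, hg0, hfg⟩ := hf.analyticOrderAt_eq_natCast.mp h
  obtain ⟨a, ha⟩ := IsAlgClosed.exists_pow_nat_eq (g z₀) (Nat.pos_of_ne_zero hm)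
  have ha0 : a ≠ 0 := by rintro rfl; simp [hm] at ha; exact hg0 ha.symm
  set u : ℂ → ℂ := fun z => a * Complex.exp (Complex.log (g z / g z₀) / m) with hu
  have hdiv : AnalyticAt ℂ (fun z => g z / g z₀) z₀ := hg.fun_div analyticAt_const hg0
  have hua : AnalyticAt ℂ u z₀ := by
    have := hdiv.clog (by simp [hg0])
    fun_prop
  have hu0 : u z₀ = a := by simp [hu, hg0]
  have hd : HasDerivAt (fun z => (z - z₀) * u z) (1 * u z₀ + (z₀ - z₀) * deriv u z₀) z₀ :=
    ((hasDerivAt_id z₀).sub_const z₀).mul hua.differentiableAt.hasDerivAt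
  refine ⟨fun z => (z - z₀) * u z, by fun_prop, by simp, ?_, ?_⟩
  · rw [hd.deriv]; simpa [hu0] using ha0
  · have hne : ∀ᶠ z in 𝓝 z₀, g z ≠ 0 := hg.continuousAt.eventually_ne hg0
    filter_upwards [hfg, hne] with z hz hz0
    rw [hz, mul_pow, smul_eq_mul]
    congr 1
    rw [hu]
    simp only [mul_pow]
    rw [← Complex.exp_nat_mul, mul_div_cancel₀ _ (by exact_mod_cast hm),
      Complex.exp_log (div_ne_zero hz0 hg0), ha]
    field_simp

theorem ncard_pow_eq {m : ℕ} (hm : m ≠ 0) {a : ℂ} (ha : a ≠ 0) :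
    {z : ℂ | z ^ m = a}.ncard = m := by
  classical
  have hp := Complex.isPrimitiveRoot_exp m hm
  have h1 := hp.card_nthRoots a
  rw [if_pos (IsAlgClosed.exists_pow_nat_eq a (Nat.pos_of_ne_zero hm))] at h1
  have h2 : {z : ℂ | z ^ m = a} = ((Polynomial.nthRoots m a).toFinset : Set ℂ) := by
    ext z
    simp [Polynomial.mem_nthRoots (Nat.pos_of_ne_zero hm)]
  rw [h2, Set.ncard_coe_finset, Multiset.toFinset_card_of_nodup (hp.nthRoots_nodup ha), h1]

/-- `W` is a neighbourhood of `z₀` in which the values near `c₀` are taken as often as the value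
`c₀` is taken at `z₀`. -/
structure CountsNear (f : ℂ → ℂ) (c₀ z₀ : ℂ) (W : Set ℂ) (c : ℂ) : Prop where
  finite : (W ∩ {w | localMult f c w ≠ 0}).Finite
  sum_eq : ∑ᶠ w ∈ W, localMult f c w = localMult f c₀ z₀

theorem countsNear_of_eq_zero {f : ℂ → ℂ} {c₀ z₀ c : ℂ} {W : Set ℂ}
    (h : ∀ w ∈ W, localMult f c w = 0) (h0 : localMult f c₀ z₀ = 0) :
    CountsNear f c₀ z₀ W c where
  finite := by
    convert Set.finite_empty (α := ℂ)
    ext w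
    simpa using fun hw => h w hw
  sum_eq := by
    rw [h0]
    exact finsum_mem_of_eqOn_zero h

/-- In a coordinate `r` with `f - f z₀ = r ^ m`, a value `c ≠ f z₀` is taken at the `m` points where
`r` is an `m`-th root of `c - f z₀`. Each is a simple point because `r ≠ 0` there, so the count is
`m` for `c` as for `f z₀`. -/
theorem exists_countsNear_of_analyticAt {f : ℂ → ℂ} {z₀ : ℂ} (hf : AnalyticAt ℂ f z₀)
    (hne : analyticOrderAt (fun w => f w - f z₀) z₀ ≠ ⊤) {U : Set ℂ} (hU : U ∈ 𝓝 z₀) :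
    ∃ W ⊆ U, IsOpen W ∧ z₀ ∈ W ∧ (W ∩ {w | localMult f (f z₀) w ≠ 0} ⊆ {z₀}) ∧
      ∀ᶠ c in 𝓝 (f z₀), CountsNear f (f z₀) z₀ W c := by
  obtain ⟨m, hm⟩ := ENat.ne_top_iff_exists.mp hne
  have hfa : AnalyticAt ℂ (fun w => f w - f z₀) z₀ := hf.fun_sub analyticAt_const
  have hm0 : m ≠ 0 := by
    rintro rfl
    have := (hfa.analyticOrderAt_eq_zero.mp hm.symm)
    simp at this
  obtain ⟨r, hr, hr0, hr', hfr⟩ := exists_analyticAt_pow_eq hfa hm0 hm.symm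
  have hmult0 : localMult f (f z₀) z₀ = m := localMult_eq_of_analyticOrderAt hf hm.symm
  set Φ := (hr.hasStrictDerivAt.hasStrictFDerivAt_equiv hr').toOpenPartialHomeomorph r
  have hΦ : (Φ : ℂ → ℂ) = r := rfl
  have hΦ0 : z₀ ∈ Φ.source :=
    (hr.hasStrictDerivAt.hasStrictFDerivAt_equiv hr').mem_toOpenPartialHomeomorph_source
  have hgood : ∀ᶠ z in 𝓝 z₀, z ∈ U ∧ AnalyticAt ℂ f z ∧ AnalyticAt ℂ r z ∧ deriv r z ≠ 0 ∧
      f z - f z₀ = r z ^ m := by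
    filter_upwards [hU, hf.eventually_analyticAt, hr.eventually_analyticAt,
      hr.deriv.continuousAt.eventually_ne hr', hfr] with z h1 h2 h3 h4 h5
    exact ⟨h1, h2, h3, h4, h5⟩
  obtain ⟨T, hT, hTo, hzT⟩ := eventually_nhds_iff.mp hgood
  set Ψ := Φ.restrOpen T hTo
  have hΨ : (Ψ : ℂ → ℂ) = r := rfl
  have hsrc : Ψ.source = Φ.source ∩ T := Φ.restrOpen_source T hTo
  have hΨ0 : z₀ ∈ Ψ.source := by rw [hsrc]; exact ⟨hΦ0, hzT⟩
  have htgt : (0 : ℂ) ∈ Ψ.target := by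
    have := Ψ.map_source hΨ0
    rwa [hΨ, hr0] at this
  obtain ⟨ε, hε, hball⟩ := Metric.isOpen_iff.mp Ψ.open_target 0 htgt
  set W := Ψ.source ∩ Ψ ⁻¹' Metric.ball 0 ε
  have hWo : IsOpen W := Ψ.isOpen_inter_preimage Metric.isOpen_ball
  have hWT : ∀ w ∈ W, w ∈ U ∧ AnalyticAt ℂ f w ∧ AnalyticAt ℂ r w ∧ deriv r w ≠ 0 ∧
      f w - f z₀ = r w ^ m := fun w hw => hT w (hsrc ▸ hw.1).2
  have hz₀W : z₀ ∈ W := ⟨hΨ0, by simp [hΨ, hr0, hε]⟩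
  have hW0 : W ∩ {w | localMult f (f z₀) w ≠ 0} ⊆ {z₀} := by
    rintro w ⟨hw, hw0⟩
    by_contra hne
    obtain ⟨-, hfw, -, -, heq⟩ := hWT w hw
    refine hw0 (localMult_eq_zero_of_ne hfw fun h => ?_)
    rw [h, sub_self, eq_comm, pow_eq_zero_iff hm0] at heq
    exact hne (Ψ.injOn hw.1 hΨ0 (by rw [hΨ, heq, hr0]))
  refine ⟨W, fun w hw => (hWT w hw).1, hWo, hz₀W, hW0, ?_⟩
  -- The radius `ε ^ m` ensures that all `m`-th roots of `c - f z₀` lie in the ball of radius `ε`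
  -- covered by the coordinate.
  filter_upwards [Metric.ball_mem_nhds (f z₀) (pow_pos hε m)] with c hc
  by_cases hcc : c = f z₀
  · subst hcc
    refine ⟨(Set.finite_singleton z₀).subset hW0, ?_⟩
    rw [← finsum_mem_inter_support]
    have : W ∩ Function.support (fun w => localMult f (f z₀) w) = {z₀} := by
      refine Subset.antisymm hW0 ?_
      rintro _ rfl
      exact ⟨hz₀W, by simp [hmult0, hm0]⟩
    rw [this, finsum_mem_singleton]
  have hcsub : c - f z₀ ≠ 0 := sub_ne_zero.mpr hcc
  set S := Ψ.symm '' {ζ : ℂ | ζ ^ m = c - f z₀}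
  have hroot : ∀ ζ : ℂ, ζ ^ m = c - f z₀ → ζ ∈ Metric.ball (0 : ℂ) ε := by
    intro ζ hζ
    rw [mem_ball_zero_iff]
    refine lt_of_pow_lt_pow_left₀ m hε.le ?_
    rw [← norm_pow, hζ, ← dist_eq_norm]
    exact hc
  have hone : ∀ w ∈ W, f w = c → localMult f c w = 1 := by
    rintro w hw rfl
    obtain ⟨-, hfw, hrw, hdr, heq⟩ := hWT w hw
    refine localMult_eq_one hfw ?_
    have hev : f =ᶠ[𝓝 w] fun z => r z ^ m + f z₀ := by
      filter_upwards [hWo.mem_nhds hw] with z hz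
      rw [← (hWT z hz).2.2.2.2]; ring
    have hrw0 : r w ≠ 0 := fun h => hcsub (by rw [heq, h, zero_pow hm0])
    have hd : HasDerivAt (fun z => r z ^ m + f z₀) (m * r w ^ (m - 1) * deriv r w) w :=
      (hrw.differentiableAt.hasDerivAt.pow m).add_const _
    rw [hev.deriv_eq, hd.deriv]
    exact mul_ne_zero (mul_ne_zero (by exact_mod_cast hm0) (pow_ne_zero _ hrw0)) hdr
  have hS : W ∩ {w | localMult f c w ≠ 0} = S := by
    ext w
    constructor
    · rintro ⟨hw, hw0⟩
      obtain ⟨-, hfw, -, -, heq⟩ := hWT w hw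
      have hfc : f w = c := by
        by_contra h
        exact hw0 (localMult_eq_zero_of_ne hfw h)
      refine ⟨r w, ?_, Ψ.left_inv hw.1⟩
      rw [mem_ofPred_eq, ← heq, hfc]
    · rintro ⟨ζ, hζ, rfl⟩
      have hb := hroot ζ hζ
      have hW : Ψ.symm ζ ∈ W := ⟨Ψ.map_target (hball hb), by
        rw [mem_preimage, Ψ.right_inv (hball hb)]; exact hb⟩
      refine ⟨hW, ?_⟩
      have heq := (hWT _ hW).2.2.2.2
      have h1 : r (Ψ.symm ζ) = ζ := Ψ.right_inv (hball hb)
      rw [h1, show ζ ^ m = _ from hζ, sub_left_inj] at heq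
      simp [hone _ hW heq]
  have hfin : {ζ : ℂ | ζ ^ m = c - f z₀}.Finite := by
    refine Set.finite_of_ncard_ne_zero ?_
    rwa [ncard_pow_eq hm0 hcsub]
  refine ⟨by rw [hS]; exact hfin.image _, ?_⟩
  have h1 : ∑ᶠ w ∈ W, localMult f c w = ∑ᶠ w ∈ S, 1 := by
    rw [← finsum_mem_inter_support]
    change ∑ᶠ w ∈ W ∩ {w | localMult f c w ≠ 0}, localMult f c w = _
    refine finsum_mem_congr hS fun w hw => ?_
    rw [← hS] at hw
    refine hone w hw.1 ?_
    by_contra h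
    exact hw.2 (localMult_eq_zero_of_ne (hWT w hw.1).2.1 h)
  rw [h1, hmult0, finsum_mem_eq_finite_toFinset_sum _ (hfin.image _), Finset.sum_const,
    smul_eq_mul, mul_one,
    ← Set.ncard_eq_toFinset_card _ (hfin.image _), Set.InjOn.ncard_image, ncard_pow_eq hm0 hcsub]
  exact Ψ.symm.injOn.mono fun ζ hζ => hball (hroot ζ hζ)

/-- At a pole `|f|` is large nearby, so no value near `c₀` is taken and all counts are 0. Elsewhere
`f` may be replaced by its analytic extension, since multiplicities depend only on punctured germs.
-/
theorem exists_countsNear {f : ℂ → ℂ} {z₀ : ℂ} (c₀ : ℂ) (hf : MeromorphicAt f z₀)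
    (hne : meromorphicOrderAt (fun w => f w - c₀) z₀ ≠ ⊤) {U : Set ℂ} (hU : U ∈ 𝓝 z₀) :
    ∃ W ⊆ U, IsOpen W ∧ z₀ ∈ W ∧ (W ∩ {w | localMult f c₀ w ≠ 0} ⊆ {z₀}) ∧
      ∀ᶠ c in 𝓝 c₀, CountsNear f c₀ z₀ W c := by
  rcases lt_or_ge (meromorphicOrderAt f z₀) 0 with hneg | hpos
  · have ht := tendsto_cobounded_of_meromorphicOrderAt_neg hneg
    have hev : ∀ᶠ w in 𝓝[≠] z₀, w ∈ U ∧ AnalyticAt ℂ f w ∧ ‖c₀‖ + 1 < ‖f w‖ := by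
      filter_upwards [nhdsWithin_le_nhds hU, hf.eventually_analyticAt,
        (tendsto_norm_atTop_iff_cobounded.mpr ht).eventually_gt_atTop (‖c₀‖ + 1)] with w h1 h2 h3
      exact ⟨h1, h2, h3⟩
    rw [eventually_nhdsWithin_iff] at hev
    obtain ⟨W, hW, hWo, hzW⟩ := eventually_nhds_iff.mp (hev.and hU)
    -- A pole of `f` is a pole of `f - c`; its negative order is truncated to 0 by `toNat`.
    have h0 : ∀ c, localMult f c z₀ = 0 := by
      intro c
      have : meromorphicOrderAt (fun w => f w - c) z₀ < 0 := by
        have h := meromorphicOrderAt_add_eq_left_of_lt (f₁ := f) (f₂ := fun _ => -c)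
          (by fun_prop) (hneg.trans_le analyticAt_const.meromorphicOrderAt_nonneg)
        have h' : (f + fun _ => -c) = fun w => f w - c := by ext; simp [sub_eq_add_neg]
        rwa [← h', h]
      unfold localMult
      rw [Int.toNat_eq_zero]
      lift meromorphicOrderAt (fun w => f w - c) z₀ to ℤ using this.ne_top with n hn
      simpa using (by exact_mod_cast this : n < 0).le
    have hev : ∀ᶠ c in 𝓝 c₀, ∀ w ∈ W, localMult f c w = 0 := by
      filter_upwards [Metric.ball_mem_nhds c₀ one_pos] with c hc w hw
      by_cases hwz : w = z₀
      · rw [hwz, h0]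
      · obtain ⟨-, h2, h3⟩ := (hW w hw).1 hwz
        refine localMult_eq_zero_of_ne h2 ?_
        rintro rfl
        rw [mem_ball_iff_norm] at hc
        linarith [norm_le_norm_add_norm_sub' (f w) c₀]
    refine ⟨W, fun w hw => (hW w hw).2, hWo, hzW, ?_, ?_⟩
    · rintro w ⟨hw, hw0⟩
      exact absurd (hev.self_of_nhds w hw) hw0
    · filter_upwards [hev] with c hc
      exact countsNear_of_eq_zero hc (h0 c₀)
  · obtain ⟨g, hg, hfg⟩ : ∃ g : ℂ → ℂ, AnalyticAt ℂ g z₀ ∧ f =ᶠ[𝓝[≠] z₀] g :=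
      (hf.meromorphicOrderAt_nonneg_iff).mp hpos
    have hne' : analyticOrderAt (fun w => g w - c₀) z₀ ≠ ⊤ := by
      have h1 : AnalyticAt ℂ (fun w => g w - c₀) z₀ := hg.fun_sub analyticAt_const
      have h2 : meromorphicOrderAt (fun w => g w - c₀) z₀ ≠ ⊤ := by
        rwa [← meromorphicOrderAt_congr (f₁ := fun w => f w - c₀) (hfg.mono fun w hw => by simp [hw])]
      rw [h1.meromorphicOrderAt_eq] at h2
      intro h
      simp [h] at h2
    obtain ⟨T, hT, hTo, hzT⟩ := eventually_nhds_iff.mp (eventually_nhdsWithin_iff.mp hfg)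
    have hcongr : ∀ c, ∀ w ∈ T, localMult f c w = localMult g c w := by
      intro c w hw
      refine localMult_congr ?_
      by_cases hwz : w = z₀
      · rw [hwz]; exact hfg
      · refine Filter.EventuallyEq.filter_mono ?_ nhdsWithin_le_nhds
        filter_upwards [hTo.mem_nhds hw, isOpen_ne.mem_nhds hwz] with z h1 h2
        exact hT z h1 h2
    suffices h : ∃ W ⊆ U ∩ T, IsOpen W ∧ z₀ ∈ W ∧ (W ∩ {w | localMult g c₀ w ≠ 0} ⊆ {z₀}) ∧
      ∀ᶠ c in 𝓝 c₀, CountsNear g c₀ z₀ W c by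
      obtain ⟨W, hWU, hWo, hzW, h1, h2⟩ := h
      have hset : ∀ c, W ∩ {w | localMult f c w ≠ 0} = W ∩ {w | localMult g c w ≠ 0} := by
        intro c
        ext w
        simp only [mem_inter_iff, mem_ofPred_eq]
        exact and_congr_right fun hw => by rw [hcongr c w (hWU hw).2]
      refine ⟨W, fun w hw => (hWU hw).1, hWo, hzW, by rwa [hset], ?_⟩
      filter_upwards [h2] with c hc
      refine ⟨by rw [hset]; exact hc.finite, ?_⟩
      rw [hcongr c₀ z₀ hzT, ← hc.sum_eq]
      exact finsum_mem_congr rfl fun w hw => hcongr c w (hWU hw).2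
    have hUT : U ∩ T ∈ 𝓝 z₀ := inter_mem hU (hTo.mem_nhds hzT)
    by_cases hgc : g z₀ = c₀
    · subst hgc
      exact exists_countsNear_of_analyticAt hg hne' hUT
    · have h1 : ∀ᶠ p in 𝓝 z₀ ×ˢ 𝓝 c₀, g p.1 ≠ p.2 := by
        have ht : Tendsto (fun p : ℂ × ℂ => g p.1 - p.2) (𝓝 z₀ ×ˢ 𝓝 c₀) (𝓝 (g z₀ - c₀)) :=
          (hg.continuousAt.tendsto.comp tendsto_fst).sub tendsto_snd
        filter_upwards [ht.eventually_ne (sub_ne_zero.mpr hgc)] with p hp h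
        exact hp (sub_eq_zero.mpr h)
      obtain ⟨pa, hpa, pb, hpb, hab⟩ := eventually_prod_iff.mp h1
      obtain ⟨W, hW, hWo, hzW⟩ := eventually_nhds_iff.mp
        ((hpa.and hg.eventually_analyticAt).and hUT)
      have h3 : ∀ᶠ c in 𝓝 c₀, ∀ w ∈ W, localMult g c w = 0 := by
        filter_upwards [hpb] with c hc w hw
        exact localMult_eq_zero_of_ne (hW w hw).1.2 (hab (hW w hw).1.1 hc)
      refine ⟨W, fun w hw => (hW w hw).2, hWo, hzW, ?_, ?_⟩
      · rintro w ⟨hw, hw0⟩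
        exact absurd (h3.self_of_nhds w hw) hw0
      · filter_upwards [h3] with c hc
        exact countsNear_of_eq_zero hc (h3.self_of_nhds z₀ hzW)

/-! ### Meromorphic functions on a Riemann surface -/

section Meromorphic

variable {C : Type*} [TopologicalSpace C] [ChartedSpace ℂ C]

/-- The order at `x` of a function on a Riemann surface. -/
def ordAt (f : C → ℂ) (x : C) : WithTop ℤ :=
  meromorphicOrderAt (f ∘ (chartAt ℂ x).symm) (chartAt ℂ x x)

/-- `f` is meromorphic at the point `x` of a Riemann surface. -/
def MerAt (f : C → ℂ) (x : C) : Prop :=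
  MeromorphicAt (f ∘ (chartAt ℂ x).symm) (chartAt ℂ x x)

theorem nhdsNE_eq_map_chart {φ : OpenPartialHomeomorph C ℂ} {x : C} (hx : x ∈ φ.source) :
    𝓝[≠] x = map φ.symm (𝓝[≠] (φ x)) := by
  have h := φ.symm.map_nhdsWithin_eq (φ.map_source hx) {φ x}ᶜ
  rw [φ.left_inv hx] at h
  rw [h, ← φ.nhdsWithin_source_inter hx]
  congr 1
  ext y
  simp only [OpenPartialHomeomorph.symm_source, mem_inter_iff, mem_compl_iff, mem_singleton_iff,
    mem_image]
  constructor
  · rintro ⟨h1, h2⟩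
    exact ⟨φ y, ⟨φ.map_source h1, fun h => h2 (φ.injOn h1 hx h)⟩, φ.left_inv h1⟩
  · rintro ⟨z, ⟨h1, h2⟩, rfl⟩
    exact ⟨φ.map_target h1, fun h => h2 (by rw [← h, φ.right_inv h1])⟩

instance nhdsNE_neBot (x : C) : (𝓝[≠] x).NeBot := by
  rw [nhdsNE_eq_map_chart (mem_chart_source ℂ x)]
  infer_instance

theorem comp_symm_congr {f g : C → ℂ} {x : C} (h : f =ᶠ[𝓝[≠] x] g) :
    f ∘ (chartAt ℂ x).symm =ᶠ[𝓝[≠] (chartAt ℂ x x)] g ∘ (chartAt ℂ x).symm := by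
  rw [nhdsNE_eq_map_chart (mem_chart_source ℂ x)] at h
  exact h

theorem ordAt_congr {f g : C → ℂ} {x : C} (h : f =ᶠ[𝓝[≠] x] g) : ordAt f x = ordAt g x :=
  meromorphicOrderAt_congr (comp_symm_congr h)

theorem MerAt.congr {f g : C → ℂ} {x : C} (hf : MerAt f x) (h : f =ᶠ[𝓝[≠] x] g) : MerAt g x :=
  MeromorphicAt.congr hf (comp_symm_congr h)

theorem MerAt.mul {f g : C → ℂ} {x : C} (hf : MerAt f x) (hg : MerAt g x) :
    MerAt (fun y => f y * g y) x :=
  MeromorphicAt.fun_mul hf hg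

theorem MerAt.div {f g : C → ℂ} {x : C} (hf : MerAt f x) (hg : MerAt g x) :
    MerAt (fun y => f y / g y) x :=
  MeromorphicAt.fun_div hf hg

theorem MerAt.inv {f : C → ℂ} {x : C} (hf : MerAt f x) : MerAt (fun y => (f y)⁻¹) x :=
  MeromorphicAt.fun_inv hf

theorem merAt_const (c : ℂ) (x : C) : MerAt (fun _ => c) x :=
  MeromorphicAt.const c _

theorem MerAt.sub_const {f : C → ℂ} {x : C} (hf : MerAt f x) (c : ℂ) :
    MerAt (fun y => f y - c) x :=
  MeromorphicAt.fun_sub hf (MeromorphicAt.const c _)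

theorem ordAt_mul {f g : C → ℂ} {x : C} (hf : MerAt f x) (hg : MerAt g x) :
    ordAt (fun y => f y * g y) x = ordAt f x + ordAt g x :=
  meromorphicOrderAt_mul hf hg

theorem ordAt_inv (f : C → ℂ) (x : C) : ordAt (fun y => (f y)⁻¹) x = -ordAt f x :=
  meromorphicOrderAt_inv

theorem ordAt_eq_top_iff {f : C → ℂ} {x : C} : ordAt f x = ⊤ ↔ ∀ᶠ y in 𝓝[≠] x, f y = 0 := by
  rw [nhdsNE_eq_map_chart (mem_chart_source ℂ x)]
  exact meromorphicOrderAt_eq_top_iff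

theorem ordAt_ne_top_iff {f : C → ℂ} {x : C} (hf : MerAt f x) :
    ordAt f x ≠ ⊤ ↔ ∀ᶠ y in 𝓝[≠] x, f y ≠ 0 := by
  rw [nhdsNE_eq_map_chart (mem_chart_source ℂ x)]
  exact meromorphicOrderAt_ne_top_iff_eventually_ne_zero hf

theorem ordAt_div {f g : C → ℂ} {x : C} (hf : MerAt f x) (hg : MerAt g x) (hg0 : ordAt g x ≠ ⊤) :
    (ordAt (fun y => f y / g y) x) + ordAt g x = ordAt f x := by
  rw [← ordAt_mul (hf.div hg) hg]
  refine ordAt_congr ?_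
  filter_upwards [(ordAt_ne_top_iff hg).mp hg0] with y hy
  field_simp

/-- Identity theorem. A meromorphic germ is either zero or nonzero on a whole punctured
neighbourhood, and either property passes to nearby points; so the points of order `⊤` form a clopen
set. -/
theorem ordAt_ne_top_of_exists [PreconnectedSpace C] {f : C → ℂ} (hf : ∀ x, MerAt f x) {x₀ : C}
    (h : ordAt f x₀ ≠ ⊤) (x : C) : ordAt f x ≠ ⊤ := by
  have hopen : IsOpen {x | ordAt f x = ⊤} := by
    refine isOpen_iff_eventually.mpr fun x hx => ?_
    rw [mem_ofPred_eq, ordAt_eq_top_iff, eventually_nhdsWithin_iff] at hx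
    obtain ⟨O, hO, hOo, hxO⟩ := eventually_nhds_iff.mp hx
    have := ChartedSpace.t1Space ℂ C
    filter_upwards [hOo.mem_nhds hxO] with y hy
    by_cases hyx : y = x
    · rw [hyx, ordAt_eq_top_iff, eventually_nhdsWithin_iff]; exact hx
    · rw [ordAt_eq_top_iff]
      refine Filter.Eventually.filter_mono nhdsWithin_le_nhds ?_
      filter_upwards [hOo.mem_nhds hy, isOpen_ne.mem_nhds hyx] with z h1 h2
      exact hO z h1 h2
  have hclosed : IsOpen {x | ordAt f x = ⊤}ᶜ := by
    refine isOpen_iff_eventually.mpr fun x hx => ?_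
    rw [mem_compl_iff, mem_ofPred_eq, ← ne_eq, ordAt_ne_top_iff (hf x),
      eventually_nhdsWithin_iff] at hx
    obtain ⟨O, hO, hOo, hxO⟩ := eventually_nhds_iff.mp hx
    have := ChartedSpace.t1Space ℂ C
    filter_upwards [hOo.mem_nhds hxO] with y hy
    rw [mem_compl_iff, mem_ofPred_eq, ← ne_eq, ordAt_ne_top_iff (hf y)]
    by_cases hyx : y = x
    · rw [hyx, eventually_nhdsWithin_iff]; exact hx
    · refine Filter.Eventually.filter_mono nhdsWithin_le_nhds ?_
      filter_upwards [hOo.mem_nhds hy, isOpen_ne.mem_nhds hyx] with z h1 h2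
      exact hO z h1 h2
  have hcl : IsClopen {x | ordAt f x = ⊤} := ⟨⟨hclosed⟩, hopen⟩
  rcases isClopen_iff.mp hcl with h1 | h1
  · intro hx
    exact (h1 ▸ hx : x ∈ (∅ : Set C)).elim
  · exact (h (h1 ▸ mem_univ x₀ : x₀ ∈ {x | ordAt f x = ⊤})).elim

/-- The multiplicity with which a function on a Riemann surface takes the value `c` at `x`. -/
def mult (f : C → ℂ) (c : ℂ) (x : C) : ℕ := (ordAt (fun y => f y - c) x).untop₀.toNat

variable [IsManifold 𝓘(ℂ) ω C]

theorem transition_analyticAt {φ φ' : OpenPartialHomeomorph C ℂ} (hφ : φ ∈ atlas ℂ C)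
    (hφ' : φ' ∈ atlas ℂ C) {z : ℂ} (hz : z ∈ φ.target) (hz' : φ.symm z ∈ φ'.source) :
    AnalyticAt ℂ (φ' ∘ φ.symm) z := by
  have h1 : ContMDiffAt 𝓘(ℂ) 𝓘(ℂ) ω φ.symm z :=
    (contMDiffOn_symm_of_mem_maximalAtlas
      (IsManifold.subset_maximalAtlas (n := ω) (I := 𝓘(ℂ)) hφ)).contMDiffAt
      (φ.open_target.mem_nhds hz)
  have h2 : ContMDiffAt 𝓘(ℂ) 𝓘(ℂ) ω φ' (φ.symm z) :=
    (contMDiffOn_of_mem_maximalAtlas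
      (IsManifold.subset_maximalAtlas (n := ω) (I := 𝓘(ℂ)) hφ')).contMDiffAt
      (φ'.open_source.mem_nhds hz')
  exact (h2.comp z h1).contDiffAt.analyticAt

theorem deriv_transition_mul {φ φ' : OpenPartialHomeomorph C ℂ} (hφ : φ ∈ atlas ℂ C)
    (hφ' : φ' ∈ atlas ℂ C) {z : ℂ} (hz : z ∈ φ.target) (hz' : φ.symm z ∈ φ'.source) :
    deriv (φ ∘ φ'.symm) (φ' (φ.symm z)) * deriv (φ' ∘ φ.symm) z = 1 := by
  have h1 := (transition_analyticAt hφ hφ' hz hz').differentiableAt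
  have h2 : DifferentiableAt ℂ (φ ∘ φ'.symm) ((φ' ∘ φ.symm) z) :=
    (transition_analyticAt hφ' hφ (φ'.map_source hz') (by
      rw [φ'.left_inv hz']; exact φ.map_target hz)).differentiableAt
  have h3 := deriv_comp z h2 h1
  rw [Function.comp_apply] at h3
  rw [← h3]
  have h4 : (φ ∘ φ'.symm) ∘ (φ' ∘ φ.symm) =ᶠ[𝓝 z] id := by
    have hn : φ.target ∩ φ.symm ⁻¹' φ'.source ∈ 𝓝 z :=
      (φ.symm.isOpen_inter_preimage φ'.open_source).mem_nhds ⟨hz, hz'⟩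
    filter_upwards [hn] with w hw
    simp [φ'.left_inv hw.2, φ.right_inv hw.1]
  rw [h4.deriv_eq, deriv_id]

theorem deriv_transition_ne_zero {φ φ' : OpenPartialHomeomorph C ℂ} (hφ : φ ∈ atlas ℂ C)
    (hφ' : φ' ∈ atlas ℂ C) {z : ℂ} (hz : z ∈ φ.target) (hz' : φ.symm z ∈ φ'.source) :
    deriv (φ' ∘ φ.symm) z ≠ 0 :=
  right_ne_zero_of_mul_eq_one (deriv_transition_mul hφ hφ' hz hz')

theorem comp_symm_eventuallyEq (f : C → ℂ) {φ : OpenPartialHomeomorph C ℂ} {x : C}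
    (hx : x ∈ φ.source) :
    f ∘ φ.symm =ᶠ[𝓝 (φ x)] (f ∘ (chartAt ℂ x).symm) ∘ (chartAt ℂ x ∘ φ.symm) := by
  have hn : φ.target ∩ φ.symm ⁻¹' (chartAt ℂ x).source ∈ 𝓝 (φ x) :=
    (φ.symm.isOpen_inter_preimage (chartAt ℂ x).open_source).mem_nhds
      ⟨φ.map_source hx, by rw [mem_preimage, φ.left_inv hx]; exact mem_chart_source ℂ x⟩
  filter_upwards [hn] with w hw
  simp [(chartAt ℂ x).left_inv hw.2]

/-- Transition maps have nonzero derivative, so the order may be computed in any chart of the atlas.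
-/
theorem ordAt_eq (f : C → ℂ) {φ : OpenPartialHomeomorph C ℂ} (hφ : φ ∈ atlas ℂ C) {x : C}
    (hx : x ∈ φ.source) : ordAt f x = meromorphicOrderAt (f ∘ φ.symm) (φ x) := by
  have hx' : φ.symm (φ x) ∈ (chartAt ℂ x).source := by
    rw [φ.left_inv hx]; exact mem_chart_source ℂ x
  rw [meromorphicOrderAt_congr ((comp_symm_eventuallyEq f hx).filter_mono nhdsWithin_le_nhds),
    meromorphicOrderAt_comp_of_deriv_ne_zero
      (transition_analyticAt hφ (chart_mem_atlas ℂ x) (φ.map_source hx) hx')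
      (deriv_transition_ne_zero hφ (chart_mem_atlas ℂ x) (φ.map_source hx) hx'),
    Function.comp_apply, φ.left_inv hx, ordAt]

theorem analyticAt_comp_symm {f : C → ℂ} {φ : OpenPartialHomeomorph C ℂ} (hφ : φ ∈ atlas ℂ C)
    {z : ℂ} (hz : z ∈ φ.target)
    (hf : ContMDiffAt 𝓘(ℂ) 𝓘(ℂ) ω f (φ.symm z)) : AnalyticAt ℂ (f ∘ φ.symm) z :=
  (hf.comp z ((contMDiffOn_symm_of_mem_maximalAtlas
      (IsManifold.subset_maximalAtlas (n := ω) (I := 𝓘(ℂ)) hφ)).contMDiffAt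
      (φ.open_target.mem_nhds hz))).contDiffAt.analyticAt

theorem contMDiffAt_of_analyticAt {f : C → ℂ} {φ : OpenPartialHomeomorph C ℂ}
    (hφ : φ ∈ atlas ℂ C) {x : C} (hx : x ∈ φ.source)
    (hf : AnalyticAt ℂ (f ∘ φ.symm) (φ x)) : ContMDiffAt 𝓘(ℂ) 𝓘(ℂ) ω f x := by
  have h1 : ContMDiffAt 𝓘(ℂ) 𝓘(ℂ) ω φ x :=
    (contMDiffOn_of_mem_maximalAtlas
      (IsManifold.subset_maximalAtlas (n := ω) (I := 𝓘(ℂ)) hφ)).contMDiffAt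
      (φ.open_source.mem_nhds hx)
  have h2 : ContMDiffAt 𝓘(ℂ) 𝓘(ℂ) ω (f ∘ φ.symm) (φ x) := hf.contDiffAt.contMDiffAt
  refine (h2.comp x h1).congr_of_eventuallyEq ?_
  filter_upwards [φ.open_source.mem_nhds hx] with y hy
  simp [φ.left_inv hy]

theorem analyticAt_chart {f : C → ℂ} {x : C} (hf : ContMDiffAt 𝓘(ℂ) 𝓘(ℂ) ω f x) :
    AnalyticAt ℂ (f ∘ (chartAt ℂ x).symm) (chartAt ℂ x x) :=
  analyticAt_comp_symm (chart_mem_atlas ℂ x) (mem_chart_target ℂ x)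
    (by rwa [(chartAt ℂ x).left_inv (mem_chart_source ℂ x)])

theorem _root_.ContMDiffAt.merAt {f : C → ℂ} {x : C} (hf : ContMDiffAt 𝓘(ℂ) 𝓘(ℂ) ω f x) :
    MerAt f x :=
  (analyticAt_chart hf).meromorphicAt

theorem _root_.ContMDiffAt.ordAt_nonneg {f : C → ℂ} {x : C}
    (hf : ContMDiffAt 𝓘(ℂ) 𝓘(ℂ) ω f x) : 0 ≤ ordAt f x :=
  (analyticAt_chart hf).meromorphicOrderAt_nonneg

theorem _root_.ContMDiffAt.ordAt_eq_zero_iff {f : C → ℂ} {x : C}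
    (hf : ContMDiffAt 𝓘(ℂ) 𝓘(ℂ) ω f x) : ordAt f x = 0 ↔ f x ≠ 0 := by
  have h := analyticAt_chart hf
  rw [ordAt, h.meromorphicOrderAt_eq]
  have h2 : f x = (f ∘ (chartAt ℂ x).symm) (chartAt ℂ x x) := by
    simp [(chartAt ℂ x).left_inv (mem_chart_source ℂ x)]
  rw [h2, ← h.analyticOrderAt_eq_zero]
  cases h3 : analyticOrderAt (f ∘ (chartAt ℂ x).symm) (chartAt ℂ x x) with
  | top => simp
  | coe n => simp

theorem mult_eq (f : C → ℂ) (c : ℂ) {φ : OpenPartialHomeomorph C ℂ} (hφ : φ ∈ atlas ℂ C) {x : C}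
    (hx : x ∈ φ.source) : mult f c x = localMult (f ∘ φ.symm) c (φ x) := by
  rw [mult, ordAt_eq _ hφ hx]
  rfl

theorem exists_mult_countsNear {f : C → ℂ} {x : C} (c₀ : ℂ) (hf : MerAt f x)
    (hne : ordAt (fun y => f y - c₀) x ≠ ⊤) {U : Set C} (hU : U ∈ 𝓝 x) :
    ∃ W ⊆ U, IsOpen W ∧ x ∈ W ∧ (W ∩ {w | mult f c₀ w ≠ 0} ⊆ {x}) ∧
      ∀ᶠ c in 𝓝 c₀, (W ∩ {w | mult f c w ≠ 0}).Finite ∧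
        ∑ᶠ w ∈ W, mult f c w = mult f c₀ x := by
  set φ := chartAt ℂ x
  have hxs : x ∈ φ.source := mem_chart_source ℂ x
  have hU' : φ.target ∩ φ.symm ⁻¹' U ∈ 𝓝 (φ x) := by
    refine inter_mem (φ.open_target.mem_nhds (φ.map_source hxs)) ?_
    refine (φ.symm.continuousAt (φ.map_source hxs)).preimage_mem_nhds ?_
    rwa [φ.left_inv hxs]
  obtain ⟨W, hWU, hWo, hxW, hW0, hWc⟩ := exists_countsNear c₀ hf hne hU'
  have hmem : ∀ {w}, w ∈ W → φ.symm w ∈ φ.source := fun hw => φ.map_target (hWU hw).1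
  have hm : ∀ c, ∀ w ∈ W, mult f c (φ.symm w) = localMult (f ∘ φ.symm) c w := by
    intro c w hw
    rw [mult_eq f c (chart_mem_atlas ℂ x) (hmem hw), φ.right_inv (hWU hw).1]
  have hset : ∀ c, φ.symm '' W ∩ {w | mult f c w ≠ 0} =
      φ.symm '' (W ∩ {w | localMult (f ∘ φ.symm) c w ≠ 0}) := by
    intro c
    ext y
    constructor
    · rintro ⟨⟨w, hw, rfl⟩, h⟩
      exact ⟨w, ⟨hw, by rw [mem_ofPred_eq, ← hm c w hw]; exact h⟩, rfl⟩
    · rintro ⟨w, ⟨hw, h⟩, rfl⟩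
      exact ⟨⟨w, hw, rfl⟩, by rw [mem_ofPred_eq, hm c w hw]; exact h⟩
  refine ⟨φ.symm '' W, ?_, φ.symm.isOpen_image_of_subset_source hWo fun w hw => (hWU hw).1,
    ⟨φ x, hxW, φ.left_inv hxs⟩, ?_, ?_⟩
  · rintro _ ⟨w, hw, rfl⟩
    exact (hWU hw).2
  · rw [hset]
    rintro _ ⟨w, hw, rfl⟩
    rw [mem_singleton_iff, show w = φ x from hW0 hw, φ.left_inv hxs]
  · filter_upwards [hWc] with c hc
    refine ⟨by rw [hset]; exact hc.finite.image _, ?_⟩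
    rw [finsum_mem_image (φ.symm.injOn.mono fun w hw => (hWU hw).1),
      finsum_mem_congr rfl (hm c), hc.sum_eq, mult_eq f c₀ (chart_mem_atlas ℂ x) hxs]

theorem ordAt_const {c : ℂ} (hc : c ≠ 0) (x : C) : ordAt (fun _ : C => c) x = 0 :=
  (contMDiffAt_const (c := c)).ordAt_eq_zero_iff.mpr hc

theorem ordAt_sub_const_of_neg {f : C → ℂ} {c : ℂ} {x : C} (h : ordAt f x < 0) :
    ordAt (fun y => f y - c) x = ordAt f x := by
  have h2 := meromorphicOrderAt_add_eq_left_of_lt (f₁ := f ∘ (chartAt ℂ x).symm)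
    (f₂ := fun _ => -c) (x := chartAt ℂ x x) (by fun_prop)
    (h.trans_le analyticAt_const.meromorphicOrderAt_nonneg)
  rw [ordAt, ordAt, ← h2]
  congr 1

theorem ordAt_sub_const_of_pos {f : C → ℂ} {c : ℂ} (hc : c ≠ 0) {x : C} (hf : MerAt f x)
    (h : 0 < ordAt f x) : ordAt (fun y => f y - c) x = 0 := by
  have h0 : meromorphicOrderAt (fun _ : ℂ => -c) (chartAt ℂ x x) = 0 :=
    ordAt_const (neg_ne_zero.mpr hc) x
  have h2 := meromorphicOrderAt_add_eq_right_of_lt (f₁ := f ∘ (chartAt ℂ x).symm)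
    (f₂ := fun _ => -c) (x := chartAt ℂ x x) hf (by rw [h0]; exact h)
  rw [h0] at h2
  rw [ordAt, ← h2]
  congr 1

/-- From `f⁻¹ - c⁻¹ = -c⁻¹ (f - c) f⁻¹` the two orders differ by the order of `f`. That matters only
at zeros and poles of `f`, where both orders are at most 0 and both multiplicities truncate to 0. -/
theorem mult_eq_mult_inv {f : C → ℂ} {c : ℂ} (hc : c ≠ 0) {x : C}
    (hf : MerAt f x) (h0 : ordAt f x ≠ ⊤) :
    mult f c x = mult (fun y => (f y)⁻¹) c⁻¹ x := by
  have h1 : (fun y => (f y)⁻¹ - c⁻¹) =ᶠ[𝓝[≠] x] fun y => (-c⁻¹ * (f y - c)) * (f y)⁻¹ := by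
    filter_upwards [(ordAt_ne_top_iff hf).mp h0] with y hy
    field_simp
    ring
  have h2 : ordAt (fun y => (f y)⁻¹ - c⁻¹) x = ordAt (fun y => f y - c) x + -ordAt f x := by
    rw [ordAt_congr h1, ordAt_mul ((merAt_const _ _).mul (hf.sub_const c)) hf.inv,
      ordAt_mul (merAt_const _ _) (hf.sub_const c), ordAt_inv,
      ordAt_const (neg_ne_zero.mpr (inv_ne_zero hc)), zero_add]
  rw [mult, mult, h2]
  rcases lt_trichotomy (ordAt f x) 0 with h | h | h
  · rw [ordAt_sub_const_of_neg h]
    lift ordAt f x to ℤ using h0 with n hn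
    have : n < 0 := by exact_mod_cast h
    norm_cast
    simp [this.le]
  · simp [h]
  · rw [ordAt_sub_const_of_pos hc hf h]
    lift ordAt f x to ℤ using h0 with n hn
    have : 0 < n := by exact_mod_cast h
    rw [zero_add]
    norm_cast
    simp only [WithTop.untop₀_zero, WithTop.untop₀_coe]
    omega

/-- An integer is its positive part minus its negative part, and the negative part of the order of
`f` is the multiplicity of the zero of `f⁻¹`. -/
theorem mult_sub_mult_inv {f : C → ℂ} (x : C) :
    ((mult f 0 x : ℕ) : ℤ) - (mult (fun y => (f y)⁻¹) 0 x : ℕ) = (ordAt f x).untop₀ := by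
  simp only [mult, sub_zero, ordAt_inv]
  cases h : ordAt f x with
  | top => simp
  | coe n =>
    rw [← WithTop.LinearOrderedAddCommGroup.coe_neg, WithTop.untop₀_coe, WithTop.untop₀_coe]
    omega

/-! ### Counting the values of a meromorphic function on a compact surface -/

variable [CompactSpace C]

theorem finite_mult_ne_zero {f : C → ℂ} (hf : ∀ x, MerAt f x) (c₀ : ℂ)
    (hne : ∀ x, ordAt (fun y => f y - c₀) x ≠ ⊤) : {x | mult f c₀ x ≠ 0}.Finite := by
  choose W hWU hWo hxW hW0 hWc using fun x => exists_mult_countsNear c₀ (hf x) (hne x) univ_mem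
  obtain ⟨t, ht⟩ := isCompact_univ.elim_finite_subcover W hWo
    (fun x _ => mem_iUnion.mpr ⟨x, hxW x⟩)
  refine t.finite_toSet.subset fun x hx => ?_
  obtain ⟨y, hy, hxy⟩ := mem_iUnion₂.mp (ht (mem_univ x))
  rw [show x = y from hW0 y ⟨hxy, hx⟩]
  exact hy

variable [T2Space C]

/-- The number of points at which a meromorphic function takes the value `c` is a locally constant
function of `c`. -/
theorem eventually_finsum_mult_eq {f : C → ℂ} (hf : ∀ x, MerAt f x) (c₀ : ℂ)
    (hne : ∀ x, ordAt (fun y => f y - c₀) x ≠ ⊤) :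
    ∀ᶠ c in 𝓝 c₀, ∑ᶠ x, mult f c x = ∑ᶠ x, mult f c₀ x := by
  classical
  set Z := {x | mult f c₀ x ≠ 0} with hZdef
  have hZ : Z.Finite := finite_mult_ne_zero hf c₀ hne
  obtain ⟨U, hU, hUd⟩ := hZ.t2_separation
  choose W hWU hWo hxW hW0 hWc using
    fun x => exists_mult_countsNear c₀ (hf x) (hne x) ((hU x).2.mem_nhds (hU x).1)
  obtain ⟨t, ht⟩ := isCompact_univ.elim_finite_subcover W hWo
    (fun x _ => mem_iUnion.mpr ⟨x, hxW x⟩)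
  have hZt : Z ⊆ t := by
    intro x hx
    obtain ⟨y, hy, hxy⟩ := mem_iUnion₂.mp (ht (mem_univ x))
    rw [show x = y from hW0 y ⟨hxy, hx⟩]
    exact hy
  have hev : ∀ᶠ c in 𝓝 c₀, ∀ y ∈ t, (W y ∩ {w | mult f c w ≠ 0}).Finite ∧
        ∑ᶠ w ∈ W y, mult f c w = mult f c₀ y :=
    (Filter.eventually_all_finset t).mpr fun y _ => hWc y
  filter_upwards [hev] with c hc
  -- No solution appears away from `Z`: a point where `c` is taken lies in some `W y` of the finite
  -- subcover, and for `y ∉ Z` the total count over `W y` is 0.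
  have hcover : {w | mult f c w ≠ 0} = ⋃ z ∈ Z, W z ∩ {w | mult f c w ≠ 0} := by
    ext w
    simp only [mem_iUnion, exists_prop]
    refine ⟨fun hw => ?_, fun ⟨z, _, h⟩ => h.2⟩
    obtain ⟨y, hy, hwy⟩ := mem_iUnion₂.mp (ht (mem_univ w))
    refine ⟨y, ?_, hwy, hw⟩
    intro hy0
    obtain ⟨h1, h2⟩ := hc y hy
    rw [hy0, ← finsum_mem_inter_support] at h2
    change ∑ᶠ w ∈ W y ∩ {w | mult f c w ≠ 0}, mult f c w = 0 at h2
    rw [finsum_mem_eq_finite_toFinset_sum _ h1, Finset.sum_eq_zero_iff] at h2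
    exact hw (h2 w (by simpa using ⟨hwy, hw⟩))
  have hdisj : Z.PairwiseDisjoint fun z => W z ∩ {w | mult f c w ≠ 0} :=
    fun a ha b hb hab => (hUd ha hb hab).mono (inter_subset_left.trans (hWU a))
      (inter_subset_left.trans (hWU b))
  calc ∑ᶠ x, mult f c x = ∑ᶠ x ∈ {w | mult f c w ≠ 0}, mult f c x := by
        rw [← finsum_mem_univ, ← finsum_mem_inter_support]
        exact finsum_mem_congr (by rw [univ_inter]; rfl) fun _ _ => rfl
    _ = ∑ᶠ z ∈ Z, ∑ᶠ w ∈ W z ∩ {w | mult f c w ≠ 0}, mult f c w := by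
        rw [← finsum_mem_biUnion hdisj hZ fun z hz => (hc z (hZt hz)).1, ← hcover]
    _ = ∑ᶠ z ∈ Z, mult f c₀ z := by
        refine finsum_mem_congr rfl fun z hz => ?_
        rw [← (hc z (hZt hz)).2]
        exact finsum_mem_inter_support _ _
    _ = ∑ᶠ x, mult f c₀ x := by
        rw [← finsum_mem_univ (fun x => mult f c₀ x), ← finsum_mem_inter_support _ univ]
        exact finsum_mem_congr (by rw [univ_inter]; rfl) fun _ _ => rfl

theorem finsum_mult_eq {f : C → ℂ} (hf : ∀ x, MerAt f x)
    (hne : ∀ c x, ordAt (fun y => f y - c) x ≠ ⊤) (c c' : ℂ) :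
    ∑ᶠ x, mult f c x = ∑ᶠ x, mult f c' x :=
  IsLocallyConstant.apply_eq_of_preconnectedSpace
    ((IsLocallyConstant.iff_eventually_eq _).mpr fun c₀ =>
      eventually_finsum_mult_eq hf c₀ (hne c₀)) c c'

/-- A nonzero meromorphic function on a compact connected Riemann surface has as many zeros as
poles. -/
theorem finsum_ordAt_eq_zero [PreconnectedSpace C] {f : C → ℂ} (hf : ∀ x, MerAt f x)
    (h0 : ∀ x, ordAt f x ≠ ⊤) : ∑ᶠ x, (ordAt f x).untop₀ = 0 := by
  -- A constant function must be treated apart: the count of a value is locally constant only when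
  -- `f` minus that value is nowhere identically zero.
  by_cases hc : ∃ c x, ordAt (fun y => f y - c) x = ⊤
  · obtain ⟨c, x, hcx⟩ := hc
    have hall : ∀ x, ordAt (fun y => f y - c) x = ⊤ := fun x' => by
      by_contra h
      exact ordAt_ne_top_of_exists (fun x => (hf x).sub_const c) h x hcx
    refine finsum_eq_zero_of_forall_eq_zero fun x => ?_
    have h1 : f =ᶠ[𝓝[≠] x] fun _ => c := by
      filter_upwards [ordAt_eq_top_iff.mp (hall x)] with y hy
      exact sub_eq_zero.mp hy
    have hc0 : c ≠ 0 := by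
      rintro rfl
      exact h0 x (ordAt_eq_top_iff.mpr h1)
    rw [ordAt_congr h1, ordAt_const hc0, WithTop.untop₀_zero]
  · push Not at hc
    have hi : ∀ x, MerAt (fun y => (f y)⁻¹) x := fun x => (hf x).inv
    have hi0 : ∀ x, ordAt (fun y => (f y)⁻¹) x ≠ ⊤ := fun x h => h0 x (by
      rw [ordAt_inv] at h
      cases h' : ordAt f x with
      | top => rfl
      | coe n => rw [h'] at h; exact absurd h (by norm_cast))
    have hci : ∀ c x, ordAt (fun y => (f y)⁻¹ - c) x ≠ ⊤ := by
      intro c x h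
      have h1 := ordAt_eq_top_iff.mp h
      refine hc c⁻¹ x (ordAt_eq_top_iff.mpr (h1.mono fun y hy => ?_))
      rw [← sub_eq_zero.mp hy, inv_inv, sub_self]
    -- The value 1 joins zeros to poles: it is taken by `f` as often as 0 is, it is taken by `f` and
    -- `f⁻¹` at the same points, and `f⁻¹` takes it as often as 0.
    have e : ∑ᶠ x, mult f 0 x = ∑ᶠ x, mult (fun y => (f y)⁻¹) 0 x := by
      rw [finsum_mult_eq hf hc 0 1, finsum_mult_eq hi hci 0 1]
      refine finsum_congr fun x => ?_
      rw [mult_eq_mult_inv one_ne_zero (hf x) (h0 x), inv_one]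
    have f1 := finite_mult_ne_zero hf 0 (hc 0)
    have f2 := finite_mult_ne_zero hi 0 (hci 0)
    have f1' : (Function.support fun x => ((mult f 0 x : ℕ) : ℤ)).Finite :=
      f1.subset fun x hx => by simpa using hx
    have f2' : (Function.support fun x => ((mult (fun y => (f y)⁻¹) 0 x : ℕ) : ℤ)).Finite :=
      f2.subset fun x hx => by simpa using hx
    have e' : ∑ᶠ x, ((mult f 0 x : ℕ) : ℤ) = ∑ᶠ x, ((mult (fun y => (f y)⁻¹) 0 x : ℕ) : ℤ) := by
      have g1 := (Nat.castAddMonoidHom ℤ).map_finsum (f := fun x => mult f 0 x) f1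
      have g2 := (Nat.castAddMonoidHom ℤ).map_finsum (f := fun x => mult (fun y => (f y)⁻¹) 0 x) f2
      simp only [Nat.coe_castAddMonoidHom] at g1 g2
      rw [← g1, ← g2, e]
    rw [← finsum_congr mult_sub_mult_inv, finsum_sub_distrib f1' f2', e', sub_self]

theorem finite_ordAt_ne_zero {f : C → ℂ} (hf : ∀ x, MerAt f x)
    (h0 : ∀ x, ordAt f x ≠ ⊤) : (Function.support fun x => (ordAt f x).untop₀).Finite := by
  have h0' : ∀ x, ordAt (fun y => f y - 0) x ≠ ⊤ := by simpa using h0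
  have hi0' : ∀ x, ordAt (fun y => (f y)⁻¹ - 0) x ≠ ⊤ := fun x h => h0 x (by
      rw [ordAt_eq_top_iff] at h ⊢
      simpa using h)
  refine ((finite_mult_ne_zero hf 0 h0').union
    (finite_mult_ne_zero (fun x => (hf x).inv) 0 hi0')).subset fun x hx => ?_
  by_contra h
  simp only [mem_union, mem_ofPred_eq, not_or, not_not] at h
  refine hx ?_
  change (ordAt f x).untop₀ = 0
  rw [← mult_sub_mult_inv, h.1, h.2]
  simp

end Meromorphic

/-! ### Holomorphic 1-forms in charts -/

/-- The clopen argument of the identity theorem in purely topological form, for objects such as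
1-forms whose zero set is only described by a coefficient in each chart. -/
theorem eventually_notMem_of_locally_dichotomy {X : Type*} [TopologicalSpace X] [T1Space X]
    [PreconnectedSpace X] [∀ x : X, (𝓝[≠] x).NeBot] {Z : Set X}
    (h : ∀ x, (∀ᶠ y in 𝓝[≠] x, y ∈ Z) ∨ ∀ᶠ y in 𝓝[≠] x, y ∉ Z) {x₀ : X}
    (h0 : ¬ ∀ᶠ y in 𝓝[≠] x₀, y ∈ Z) (x : X) : ∀ᶠ y in 𝓝[≠] x, y ∉ Z := by
  have key : ∀ (S : Set X) (x : X), (∀ᶠ y in 𝓝[≠] x, y ∈ S) →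
      ∀ᶠ x' in 𝓝 x, ∀ᶠ y in 𝓝[≠] x', y ∈ S := by
    intro S x hx
    rw [eventually_nhdsWithin_iff] at hx
    obtain ⟨O, hO, hOo, hxO⟩ := eventually_nhds_iff.mp hx
    filter_upwards [hOo.mem_nhds hxO] with y hy
    by_cases hyx : y = x
    · rw [hyx, eventually_nhdsWithin_iff]; exact hx
    · refine Filter.Eventually.filter_mono nhdsWithin_le_nhds ?_
      filter_upwards [hOo.mem_nhds hy, isOpen_ne.mem_nhds hyx] with z h1 h2
      exact hO z h1 h2
  have hopen : IsOpen {x | ∀ᶠ y in 𝓝[≠] x, y ∈ Z} :=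
    isOpen_iff_eventually.mpr fun x hx => key Z x hx
  have hcompl : {x | ∀ᶠ y in 𝓝[≠] x, y ∈ Z}ᶜ = {x | ∀ᶠ y in 𝓝[≠] x, y ∈ Zᶜ} := by
    ext x
    constructor
    · exact fun hx => (h x).resolve_left hx
    · intro hx hx'
      obtain ⟨y, h1, h2⟩ := ((show ∀ᶠ y in 𝓝[≠] x, y ∈ Zᶜ from hx).and
        (show ∀ᶠ y in 𝓝[≠] x, y ∈ Z from hx')).exists
      exact h1 h2
  have hclosed : IsOpen {x | ∀ᶠ y in 𝓝[≠] x, y ∈ Z}ᶜ := by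
    rw [hcompl]
    exact isOpen_iff_eventually.mpr fun x hx => key Zᶜ x hx
  rcases isClopen_iff.mp (⟨⟨hclosed⟩, hopen⟩ : IsClopen {x | ∀ᶠ y in 𝓝[≠] x, y ∈ Z}) with h1 | h1
  · exact (h x).resolve_left fun hx => (h1 ▸ hx : x ∈ (∅ : Set X)).elim
  · exact (h0 (h1 ▸ mem_univ x₀ : x₀ ∈ {x | ∀ᶠ y in 𝓝[≠] x, y ∈ Z})).elim

section Forms

variable {C : Type*} [TopologicalSpace C] [ChartedSpace ℂ C]

/-- The derivative of a map between Riemann surfaces as a linear map `ℂ → ℂ`. -/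
def mfderivCoord {C' : Type*} [TopologicalSpace C'] [ChartedSpace ℂ C'] (f : C → C') (x : C) :
    ℂ →L[ℂ] ℂ :=
  mfderiv 𝓘(ℂ) 𝓘(ℂ) f x

theorem mfderivCoord_comp {C₁ C₂ : Type*} [TopologicalSpace C₁] [ChartedSpace ℂ C₁]
    [TopologicalSpace C₂] [ChartedSpace ℂ C₂] {g : C₁ → C₂} {f : C → C₁} (x : C)
    (hg : MDifferentiableAt 𝓘(ℂ) 𝓘(ℂ) g (f x)) (hf : MDifferentiableAt 𝓘(ℂ) 𝓘(ℂ) f x) :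
    mfderivCoord (g ∘ f) x = (mfderivCoord g (f x)).comp (mfderivCoord f x) :=
  mfderiv_comp x hg hf

theorem mfderivCoord_congr {C' : Type*} [TopologicalSpace C'] [ChartedSpace ℂ C'] {f g : C → C'}
    {x : C} (h : f =ᶠ[𝓝 x] g) : mfderivCoord f x = mfderivCoord g x :=
  h.mfderiv_eq

theorem mfderivCoord_eq_fderiv (f : ℂ → ℂ) (z : ℂ) : mfderivCoord f z = fderiv ℂ f z :=
  mfderiv_eq_fderiv

/-- The coordinate vector field of a chart. -/
def chartVector (φ : OpenPartialHomeomorph C ℂ) (y : C) : ℂ := mfderivCoord φ.symm (φ y) 1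

variable [IsManifold 𝓘(ℂ) ω C]

/-- The value of a `1`-form at a point as a linear map `ℂ → ℂ`. -/
def formMap (η : HolomorphicOneForm C) (y : C) : ℂ →L[ℂ] ℂ := η y

theorem formMap_eq_zero_iff {η : HolomorphicOneForm C} {y : C} : formMap η y = 0 ↔ η y = 0 :=
  Iff.rfl

/-- The coefficient of a holomorphic `1`-form with respect to a chart. -/
def formCoef (η : HolomorphicOneForm C) (φ : OpenPartialHomeomorph C ℂ) (y : C) : ℂ :=
  formMap η y (chartVector φ y)

theorem contMDiffAt_symm {φ : OpenPartialHomeomorph C ℂ} (hφ : φ ∈ atlas ℂ C) {z : ℂ}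
    (hz : z ∈ φ.target) : ContMDiffAt 𝓘(ℂ) 𝓘(ℂ) ω φ.symm z :=
  (contMDiffOn_symm_of_mem_maximalAtlas
      (IsManifold.subset_maximalAtlas (n := ω) (I := 𝓘(ℂ)) hφ)).contMDiffAt
      (φ.open_target.mem_nhds hz)

theorem contMDiffAt_chart {φ : OpenPartialHomeomorph C ℂ} (hφ : φ ∈ atlas ℂ C) {x : C}
    (hx : x ∈ φ.source) : ContMDiffAt 𝓘(ℂ) 𝓘(ℂ) ω φ x :=
  (contMDiffOn_of_mem_maximalAtlas
      (IsManifold.subset_maximalAtlas (n := ω) (I := 𝓘(ℂ)) hφ)).contMDiffAt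
      (φ.open_source.mem_nhds hx)

theorem chartVector_eq {φ φ' : OpenPartialHomeomorph C ℂ} (hφ : φ ∈ atlas ℂ C)
    (hφ' : φ' ∈ atlas ℂ C) {y : C} (hy : y ∈ φ.source) (hy' : y ∈ φ'.source) :
    chartVector φ y = deriv (φ' ∘ φ.symm) (φ y) * chartVector φ' y := by
  have hz := φ.map_source hy
  have hz' : φ.symm (φ y) ∈ φ'.source := by rwa [φ.left_inv hy]
  have h1 := transition_analyticAt hφ hφ' hz hz'
  have hτ : (φ' ∘ φ.symm) (φ y) = φ' y := by simp [φ.left_inv hy]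
  have h2 : φ.symm =ᶠ[𝓝 (φ y)] φ'.symm ∘ (φ' ∘ φ.symm) := by
    have hn : φ.target ∩ φ.symm ⁻¹' φ'.source ∈ 𝓝 (φ y) :=
      (φ.symm.isOpen_inter_preimage φ'.open_source).mem_nhds ⟨hz, hz'⟩
    filter_upwards [hn] with w hw
    simp [φ'.left_inv hw.2]
  have h3 : MDifferentiableAt 𝓘(ℂ) 𝓘(ℂ) φ'.symm ((φ' ∘ φ.symm) (φ y)) := by
    rw [hτ]
    exact (contMDiffAt_symm hφ' (φ'.map_source hy')).mdifferentiableAt (by simp)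
  have h4 := mfderivCoord_comp (φ y) h3 h1.differentiableAt.mdifferentiableAt
  rw [chartVector, mfderivCoord_congr h2, h4, ContinuousLinearMap.comp_apply,
    mfderivCoord_eq_fderiv, fderiv_apply_one_eq_deriv, hτ, ← mul_one (deriv _ _), ← smul_eq_mul,
    map_smul, smul_eq_mul, smul_eq_mul, mul_one, chartVector]

theorem chartVector_ne_zero {φ : OpenPartialHomeomorph C ℂ} (hφ : φ ∈ atlas ℂ C) {y : C}
    (hy : y ∈ φ.source) : chartVector φ y ≠ 0 := by
  have hz := φ.map_source hy
  have h1 : MDifferentiableAt 𝓘(ℂ) 𝓘(ℂ) φ.symm (φ y) :=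
    (contMDiffAt_symm hφ hz).mdifferentiableAt (by simp)
  have h2 : MDifferentiableAt 𝓘(ℂ) 𝓘(ℂ) φ (φ.symm (φ y)) :=
    (contMDiffAt_chart hφ (φ.map_target hz)).mdifferentiableAt (by simp)
  have h3 := mfderivCoord_comp (φ y) h2 h1
  have h4 : φ ∘ φ.symm =ᶠ[𝓝 (φ y)] id := by
    filter_upwards [φ.open_target.mem_nhds hz] with w hw
    simp [φ.right_inv hw]
  rw [mfderivCoord_congr h4, mfderivCoord_eq_fderiv, fderiv_id] at h3
  intro h0
  have h5 := congrArg (fun L : ℂ →L[ℂ] ℂ => L 1) h3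
  simp only [ContinuousLinearMap.comp_apply] at h5
  rw [show mfderivCoord φ.symm (φ y) 1 = 0 from h0, map_zero] at h5
  exact one_ne_zero h5

theorem formCoef_eq (η : HolomorphicOneForm C) {φ φ' : OpenPartialHomeomorph C ℂ}
    (hφ : φ ∈ atlas ℂ C) (hφ' : φ' ∈ atlas ℂ C) {y : C} (hy : y ∈ φ.source) (hy' : y ∈ φ'.source) :
    formCoef η φ y = deriv (φ' ∘ φ.symm) (φ y) * formCoef η φ' y := by
  rw [formCoef, chartVector_eq hφ hφ' hy hy', ← smul_eq_mul, map_smul, formCoef,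
    smul_eq_mul]

theorem eq_zero_of_formCoef_eq_zero (η : HolomorphicOneForm C) {φ : OpenPartialHomeomorph C ℂ}
    (hφ : φ ∈ atlas ℂ C) {y : C} (hy : y ∈ φ.source) (h : formCoef η φ y = 0) : η y = 0 := by
  have hv := chartVector_ne_zero hφ hy
  refine formMap_eq_zero_iff.mp (ContinuousLinearMap.ext fun v => ?_)
  have : v = (v / chartVector φ y) • chartVector φ y := by
    rw [smul_eq_mul, div_mul_cancel₀ _ hv]
  rw [this, map_smul, ← formCoef, h, smul_zero]
  rfl

theorem formCoef_eq_zero {η : HolomorphicOneForm C} {y : C} (h : η y = 0)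
    (φ : OpenPartialHomeomorph C ℂ) : formCoef η φ y = 0 := by
  rw [formCoef, formMap_eq_zero_iff.mpr h]
  rfl

/-- The coordinate vector field on `ℂ`. -/
def oneField (z : ℂ) : TangentSpace 𝓘(ℂ) z := (1 : ℂ)

theorem contMDiff_oneField : ContMDiff 𝓘(ℂ) (𝓘(ℂ).prod 𝓘(ℂ)) ω
    (fun z : ℂ => (⟨z, oneField z⟩ : TangentBundle 𝓘(ℂ) ℂ)) := by
  intro z
  rw [Bundle.contMDiffAt_section]
  simpa [oneField] using contMDiffAt_const

theorem contMDiffOn_chartVector {φ : OpenPartialHomeomorph C ℂ} (hφ : φ ∈ atlas ℂ C) :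
    ContMDiffOn 𝓘(ℂ) (𝓘(ℂ).prod 𝓘(ℂ)) ω
      (fun z => (⟨φ.symm z, mfderiv 𝓘(ℂ) 𝓘(ℂ) φ.symm z (oneField z)⟩ : TangentBundle 𝓘(ℂ) C))
      φ.target := by
  have h1 : ContMDiffOn 𝓘(ℂ) 𝓘(ℂ) ω φ.symm φ.target :=
    contMDiffOn_symm_of_mem_maximalAtlas
      (IsManifold.subset_maximalAtlas (n := ω) (I := 𝓘(ℂ)) hφ)
  have h2 := h1.contMDiffOn_tangentMapWithin (m := ω) (by simp) φ.open_target.uniqueMDiffOn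
  refine (h2.comp contMDiff_oneField.contMDiffOn (fun z hz => hz)).congr fun z hz => ?_
  simp only [Function.comp_apply, tangentMapWithin]
  rw [mfderivWithin_of_isOpen φ.open_target hz]

/-- The coefficient is the pairing of two holomorphic sections, the form and the coordinate vector
field, pulled back to the chart. -/
theorem analyticAt_formCoef (η : HolomorphicOneForm C) {φ : OpenPartialHomeomorph C ℂ}
    (hφ : φ ∈ atlas ℂ C) {z : ℂ} (hz : z ∈ φ.target) :
    AnalyticAt ℂ (formCoef η φ ∘ φ.symm) z := by
  have h1 := (contMDiffOn_chartVector hφ).contMDiffAt (φ.open_target.mem_nhds hz)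
  have h2 : ContMDiffAt 𝓘(ℂ) (𝓘(ℂ).prod 𝓘(ℂ, ℂ →L[ℂ] ℂ)) ω
      (fun z => (⟨φ.symm z, η (φ.symm z)⟩ : TotalSpace (ℂ →L[ℂ] ℂ)
        (fun x : C => (TangentSpace 𝓘(ℂ) x →L[ℂ] Bundle.Trivial C ℂ x)))) z :=
    (η.contMDiff (φ.symm z)).comp z (contMDiffAt_symm hφ hz)
  have h3 := ContMDiffAt.clm_bundle_apply (F₁ := ℂ) (F₂ := ℂ)
    (E₁ := fun x : C => TangentSpace 𝓘(ℂ) x) (E₂ := Bundle.Trivial C ℂ) h2 h1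
  rw [Bundle.contMDiffAt_totalSpace] at h3
  refine (h3.2.contDiffAt.analyticAt).congr ?_
  filter_upwards [φ.open_target.mem_nhds hz] with w hw
  simp only [Function.comp_apply, formCoef, chartVector, φ.right_inv hw]
  rfl

theorem eventually_ne_zero_of_form_ne_zero [PreconnectedSpace C] {η : HolomorphicOneForm C}
    (hη : η ≠ 0) (x : C) : ∀ᶠ y in 𝓝[≠] x, η y ≠ 0 := by
  have := ChartedSpace.t1Space ℂ C
  have hloc : ∀ x : C, (∀ᶠ y in 𝓝[≠] x, y ∈ {y | η y = 0}) ∨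
      ∀ᶠ y in 𝓝[≠] x, y ∉ {y | η y = 0} := by
    intro x
    have hx := mem_chart_source ℂ x
    rw [nhdsNE_eq_map_chart hx, eventually_map, eventually_map]
    have hn : ∀ᶠ z in 𝓝[≠] (chartAt ℂ x x), z ∈ (chartAt ℂ x).target :=
      nhdsWithin_le_nhds ((chartAt ℂ x).open_target.mem_nhds (mem_chart_target ℂ x))
    rcases (analyticAt_formCoef η (chart_mem_atlas ℂ x)
      (mem_chart_target ℂ x)).eventually_eq_zero_or_eventually_ne_zero with h | h
    · refine Or.inl ?_
      filter_upwards [h.filter_mono nhdsWithin_le_nhds, hn] with z h1 h2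
      exact eq_zero_of_formCoef_eq_zero η (chart_mem_atlas ℂ x) ((chartAt ℂ x).map_target h2) h1
    · refine Or.inr ?_
      filter_upwards [h] with z h1 h2
      refine h1 ?_
      exact formCoef_eq_zero h2 _
  obtain ⟨x₀, hx₀⟩ : ∃ x₀, η x₀ ≠ 0 := by
    by_contra h
    push Not at h
    exact hη (ContMDiffSection.ext fun x => h x)
  refine eventually_notMem_of_locally_dichotomy hloc (x₀ := x₀) (fun h => hx₀ ?_) x
  have hx := mem_chart_source ℂ x₀
  rw [nhdsNE_eq_map_chart hx, eventually_map] at h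
  refine eq_zero_of_formCoef_eq_zero η (chart_mem_atlas ℂ x₀) hx ?_
  have ha := analyticAt_formCoef η (chart_mem_atlas ℂ x₀) (mem_chart_target ℂ x₀)
  have h1 : ∀ᶠ z in 𝓝[≠] (chartAt ℂ x₀ x₀),
      (formCoef η (chartAt ℂ x₀) ∘ (chartAt ℂ x₀).symm) z = 0 := by
    filter_upwards [h] with z hz
    exact formCoef_eq_zero hz _
  have h2 := (ha.frequently_zero_iff_eventually_zero.mp h1.frequently).self_of_nhds
  simpa [(chartAt ℂ x₀).left_inv hx] using h2

end Forms

/-! ### Functions with a single simple pole -/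

section SimplePole

variable {C : Type*} [TopologicalSpace C] [ChartedSpace ℂ C]

theorem localEq_true (p y : C) : localEq p true y = chartAt ℂ p y - chartAt ℂ p p := rfl

theorem localEq_self (p : C) : localEq p true p = 0 := by simp [localEq_true]

variable [IsManifold 𝓘(ℂ) ω C]

theorem contMDiffAt_localEq {p x : C} (hx : x ∈ (chartAt ℂ p).source) :
    ContMDiffAt 𝓘(ℂ) 𝓘(ℂ) ω (localEq p true) x :=
  (contMDiffAt_chart (chart_mem_atlas ℂ p) hx).sub contMDiffAt_const

theorem eventually_localEq_ne_zero (p : C) : ∀ᶠ y in 𝓝[≠] p, localEq p true y ≠ 0 := by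
  filter_upwards [nhdsWithin_le_nhds ((chartAt ℂ p).open_source.mem_nhds (mem_chart_source ℂ p)),
    self_mem_nhdsWithin] with y h1 h2
  exact localEq_ne_zero p (i := true) (by simpa [pointCover] using h1) h2

theorem ordAt_localEq (p : C) : ordAt (localEq p true) p = 1 := by
  rw [ordAt, ← meromorphicOrderAt_id_sub_const (x := chartAt ℂ p p) (𝕜 := ℂ)]
  refine meromorphicOrderAt_congr ?_
  filter_upwards [nhdsWithin_le_nhds ((chartAt ℂ p).open_target.mem_nhds (mem_chart_target ℂ p))]
    with z hz
  simp [localEq_true, (chartAt ℂ p).right_inv hz]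

theorem eventually_contMDiffAt {g : C → ℂ} {p : C} (hg : ContMDiffAt 𝓘(ℂ) 𝓘(ℂ) ω g p) :
    ∀ᶠ y in 𝓝 p, ContMDiffAt 𝓘(ℂ) 𝓘(ℂ) ω g y := by
  have hs := mem_chart_source ℂ p
  filter_upwards [((chartAt ℂ p).continuousAt hs).eventually
    (analyticAt_chart hg).eventually_analyticAt, (chartAt ℂ p).open_source.mem_nhds hs] with y h1 h2
  exact contMDiffAt_of_analyticAt (chart_mem_atlas ℂ p) h2 h1

theorem exists_eq_localEq_mul {g : C → ℂ} {p : C} (hg : ContMDiffAt 𝓘(ℂ) 𝓘(ℂ) ω g p)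
    (h0 : g p = 0) : ∃ k : C → ℂ, ContMDiffAt 𝓘(ℂ) 𝓘(ℂ) ω k p ∧
      ∀ᶠ y in 𝓝 p, g y = localEq p true y * k y := by
  have ha := analyticAt_chart hg
  have h1 : ((1 : ℕ) : ℕ∞) ≤ analyticOrderAt (g ∘ (chartAt ℂ p).symm) (chartAt ℂ p p) := by
    rw [Nat.cast_one, Order.one_le_iff_ne_zero, ne_eq, ha.analyticOrderAt_eq_zero]
    simp [h0]
  obtain ⟨k, hk, hgk⟩ := (natCast_le_analyticOrderAt ha).mp h1
  have hs := mem_chart_source ℂ p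
  refine ⟨k ∘ chartAt ℂ p, ?_, ?_⟩
  · exact hk.contDiffAt.contMDiffAt.comp p (contMDiffAt_chart (chart_mem_atlas ℂ p) hs)
  · filter_upwards [((chartAt ℂ p).continuousAt hs).eventually hgk,
      (chartAt ℂ p).open_source.mem_nhds hs] with y h2 h3
    simpa [(chartAt ℂ p).left_inv h3, localEq_true] using h2

theorem deriv_comp_symm_eq {f : C → ℂ} {φ φ' : OpenPartialHomeomorph C ℂ}
    (hφ : φ ∈ atlas ℂ C) (hφ' : φ' ∈ atlas ℂ C) {y : C} (hy : y ∈ φ.source) (hy' : y ∈ φ'.source)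
    (hf : ContMDiffAt 𝓘(ℂ) 𝓘(ℂ) ω f y) :
    deriv (f ∘ φ.symm) (φ y) = deriv (φ' ∘ φ.symm) (φ y) * deriv (f ∘ φ'.symm) (φ' y) := by
  have hz := φ.map_source hy
  have hz' : φ.symm (φ y) ∈ φ'.source := by rwa [φ.left_inv hy]
  have hτ : (φ' ∘ φ.symm) (φ y) = φ' y := by simp [φ.left_inv hy]
  have h1 := (transition_analyticAt hφ hφ' hz hz').differentiableAt
  have h2 : DifferentiableAt ℂ (f ∘ φ'.symm) ((φ' ∘ φ.symm) (φ y)) := by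
    rw [hτ]
    exact (analyticAt_comp_symm hφ' (φ'.map_source hy')
      (by rwa [φ'.left_inv hy'])).differentiableAt
  have h3 : f ∘ φ.symm =ᶠ[𝓝 (φ y)] (f ∘ φ'.symm) ∘ (φ' ∘ φ.symm) := by
    have hn : φ.target ∩ φ.symm ⁻¹' φ'.source ∈ 𝓝 (φ y) :=
      (φ.symm.isOpen_inter_preimage φ'.open_source).mem_nhds ⟨hz, hz'⟩
    filter_upwards [hn] with w hw
    simp [φ'.left_inv hw.2]
  rw [h3.deriv_eq, deriv_comp _ h2 h1, hτ, mul_comm]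

/-- The quotient `η / df` of a holomorphic `1`-form by the differential of a function. -/
def formQuot (η : HolomorphicOneForm C) (f : C → ℂ) (y : C) : ℂ :=
  formCoef η (chartAt ℂ y) y / deriv (f ∘ (chartAt ℂ y).symm) (chartAt ℂ y y)

theorem formQuot_eq (η : HolomorphicOneForm C) {f : C → ℂ} {φ : OpenPartialHomeomorph C ℂ}
    (hφ : φ ∈ atlas ℂ C) {y : C} (hy : y ∈ φ.source) (hf : ContMDiffAt 𝓘(ℂ) 𝓘(ℂ) ω f y) :
    formQuot η f y = formCoef η φ y / deriv (f ∘ φ.symm) (φ y) := by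
  have hy' := mem_chart_source ℂ y
  have hne := deriv_transition_ne_zero hφ (chart_mem_atlas ℂ y) (φ.map_source hy)
    (by rwa [φ.left_inv hy])
  rw [formCoef_eq η hφ (chart_mem_atlas ℂ y) hy hy',
    deriv_comp_symm_eq hφ (chart_mem_atlas ℂ y) hy hy' hf, mul_div_mul_left _ _ hne, formQuot]

theorem deriv_ne_zero_of_ordAt_eq_one {f : C → ℂ} {x : C} (hf : ContMDiffAt 𝓘(ℂ) 𝓘(ℂ) ω f x)
    (h : ordAt (fun y => f y - f x) x = 1) :
    deriv (f ∘ (chartAt ℂ x).symm) (chartAt ℂ x x) ≠ 0 := by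
  have ha := analyticAt_chart hf
  have ha' := analyticAt_chart (hf.sub (contMDiffAt_const (c := f x)))
  have h1 : analyticOrderAt ((fun y => f y - f x) ∘ (chartAt ℂ x).symm) (chartAt ℂ x x)
      = ((1 : ℕ) : ℕ∞) := by
    rw [ordAt, ha'.meromorphicOrderAt_eq] at h
    cases h3 : analyticOrderAt ((fun y => f y - f x) ∘ (chartAt ℂ x).symm) (chartAt ℂ x x) with
    | top => rw [h3] at h; simp at h
    | coe n =>
      rw [h3] at h
      have : n = 1 := by simpa using h
      rw [this]
  obtain ⟨g, hg, hg0, hfg⟩ := ha'.analyticOrderAt_eq_natCast.mp h1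
  have h2 : f ∘ (chartAt ℂ x).symm =ᶠ[𝓝 (chartAt ℂ x x)]
      fun z => (z - chartAt ℂ x x) * g z + f x := by
    filter_upwards [hfg] with z hz
    rw [pow_one, smul_eq_mul] at hz
    rw [← hz]
    simp
  have hd : HasDerivAt (fun z => (z - chartAt ℂ x x) * g z + f x)
      (1 * g (chartAt ℂ x x) + (chartAt ℂ x x - chartAt ℂ x x) * deriv g (chartAt ℂ x x))
      (chartAt ℂ x x) :=
    (((hasDerivAt_id _).sub_const _).mul hg.differentiableAt.hasDerivAt).add_const _
  rw [h2.deriv_eq, hd.deriv]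
  simpa using hg0

variable [T2Space C] [CompactSpace C] [ConnectedSpace C]

theorem exists_eq_const {f : C → ℂ} (hf : ∀ x, ContMDiffAt 𝓘(ℂ) 𝓘(ℂ) ω f x) :
    ∃ c, ∀ x, f x = c := by
  have : MDifferentiable 𝓘(ℂ) 𝓘(ℂ) f := fun x => (hf x).mdifferentiableAt (by simp)
  obtain ⟨c, hc⟩ := this.exists_eq_const_of_compactSpace
  exact ⟨c, fun x => congrFun hc x⟩

/-- Overwriting the value at `p` by `k p` gives a function holomorphic on all of compact `C`. The
original value `f p` plays no role. -/
theorem exists_eq_const_of_removable {f : C → ℂ} {p : C}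
    (hf : ∀ x, x ≠ p → ContMDiffAt 𝓘(ℂ) 𝓘(ℂ) ω f x) {k : C → ℂ}
    (hk : ContMDiffAt 𝓘(ℂ) 𝓘(ℂ) ω k p) (hfk : f =ᶠ[𝓝[≠] p] k) :
    ∃ c, (∀ x, x ≠ p → f x = c) ∧ k p = c := by
  classical
  obtain ⟨c, hc⟩ := exists_eq_const (f := Function.update f p (k p)) fun x => by
    by_cases hx : x = p
    · subst hx
      refine hk.congr_of_eventuallyEq ?_
      filter_upwards [eventually_nhdsWithin_iff.mp hfk] with y hy
      by_cases hyx : y = x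
      · subst hyx; simp
      · rw [Function.update_of_ne hyx, hy hyx]
    · refine (hf x hx).congr_of_eventuallyEq ?_
      filter_upwards [isOpen_ne.mem_nhds hx] with y hy
      rw [Function.update_of_ne hy]
  refine ⟨c, fun x hx => ?_, ?_⟩
  · rw [← hc x, Function.update_of_ne hx]
  · simpa using hc p

/-- On a compact Riemann surface of positive genus, a function which is holomorphic up to one
simple pole is constant. -/
theorem exists_eq_const_of_simple_pole (hg : 1 ≤ genus C) {f g : C → ℂ} {p : C}
    (hf : ∀ x, x ≠ p → ContMDiffAt 𝓘(ℂ) 𝓘(ℂ) ω f x)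
    (hgp : ContMDiffAt 𝓘(ℂ) 𝓘(ℂ) ω g p)
    (hfg : ∀ᶠ y in 𝓝[≠] p, g y = localEq p true y * f y) : ∃ c, ∀ x, x ≠ p → f x = c := by
  -- If `g p = 0` the apparent pole is removable.
  by_cases h0 : g p = 0
  · obtain ⟨k, hk, hgk⟩ := exists_eq_localEq_mul hgp h0
    obtain ⟨c, hc, -⟩ := exists_eq_const_of_removable hf hk (by
      filter_upwards [hfg, nhdsWithin_le_nhds hgk, eventually_localEq_ne_zero p] with y h1 h2 h3
      exact mul_left_cancel₀ h3 (h1.symm.trans h2))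
    exact ⟨c, hc⟩
  exfalso
  obtain ⟨η, hη⟩ : ∃ η : HolomorphicOneForm C, η ≠ 0 := by
    have : Module.finrank ℂ (HolomorphicOneForm C) ≠ 0 := by
      unfold genus at hg; omega
    have := Module.nontrivial_of_finrank_pos (Nat.pos_of_ne_zero this)
    exact exists_ne 0
  have hfp : f =ᶠ[𝓝[≠] p] fun y => g y * (localEq p true y)⁻¹ := by
    filter_upwards [hfg, eventually_localEq_ne_zero p] with y h1 h3
    rw [h1]; field_simp
  have hζ := contMDiffAt_localEq (mem_chart_source ℂ p)
  have hmer : ∀ x, MerAt f x := fun x => by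
    by_cases hx : x = p
    · subst hx
      exact (hgp.merAt.mul hζ.merAt.inv).congr hfp.symm
    · exact (hf x hx).merAt
  have hordp : ordAt f p = ((-1 : ℤ) : WithTop ℤ) := by
    rw [ordAt_congr hfp, ordAt_mul hgp.merAt hζ.merAt.inv, ordAt_inv, ordAt_localEq,
      hgp.ordAt_eq_zero_iff.mpr h0, zero_add]
    rfl
  -- `f - f x` has a single pole, simple and at `p`, and vanishes at `x`. Its orders sum to zero, so
  -- the zero at `x` is simple; hence `df ≠ 0` off `p`.
  have hone : ∀ x, x ≠ p → ordAt (fun y => f y - f x) x = 1 := by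
    intro x hx
    have hm : ∀ y, MerAt (fun y => f y - f x) y := fun y => (hmer y).sub_const _
    have hp' : ordAt (fun y => f y - f x) p = ((-1 : ℤ) : WithTop ℤ) := by
      rw [ordAt_sub_const_of_neg (by rw [hordp]; exact_mod_cast (by norm_num : (-1 : ℤ) < 0)),
        hordp]
    have hnt : ∀ y, ordAt (fun y => f y - f x) y ≠ ⊤ :=
      ordAt_ne_top_of_exists hm (x₀ := p) (by rw [hp']; exact WithTop.coe_ne_top)
    have hsum := finsum_ordAt_eq_zero hm hnt
    have hfin := finite_ordAt_ne_zero hm hnt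
    classical
    set S := insert x (insert p hfin.toFinset)
    rw [finsum_eq_sum_of_support_subset (s := S) _ (fun y hy => by simp [S]; right; right; simpa using hy),
      ← Finset.add_sum_erase S _ (a := p) (by simp [S]), hp'] at hsum
    have hnn : ∀ y ∈ S.erase p, 0 ≤ (ordAt (fun y => f y - f x) y).untop₀ := by
      intro y hy
      have h1 := ((hf y (Finset.ne_of_mem_erase hy)).sub
        (contMDiffAt_const (c := f x))).ordAt_nonneg
      exact WithTop.untop₀_nonneg.mpr h1
    have hle := Finset.single_le_sum hnn (a := x) (by simp [S, hx])
    have hx0 : ordAt (fun y => f y - f x) x ≠ 0 := fun h =>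
      ((hf x hx).sub (contMDiffAt_const (c := f x))).ordAt_eq_zero_iff.mp h (by simp)
    have hxn := ((hf x hx).sub (contMDiffAt_const (c := f x))).ordAt_nonneg
    change 0 ≤ ordAt (fun y => f y - f x) x at hxn
    have hxt := hnt x
    lift ordAt (fun y => f y - f x) x to ℤ using hxt with n hn
    rw [WithTop.untop₀_coe] at hle hsum
    norm_cast at hx0 hxn
    have : n = 1 := by omega
    rw [this]
    rfl
  -- With `ζ` the centred coordinate, `f = g / ζ` gives `f' = (g' ζ - g) / ζ²`, so `η / df` extends
  -- over `p` as below. The denominator is `-g p ≠ 0` at `p` and the numerator vanishes there.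
  obtain ⟨c, hc, hc'⟩ := exists_eq_const_of_removable (f := formQuot η f) (p := p)
    (k := fun y => (formCoef η (chartAt ℂ p) y * localEq p true y ^ 2) /
      (deriv (g ∘ (chartAt ℂ p).symm) (chartAt ℂ p y) * localEq p true y - g y)) (by
        intro x hx
        have hs := mem_chart_source ℂ x
        have ha := analyticAt_chart (hf x hx)
        refine contMDiffAt_of_analyticAt (chart_mem_atlas ℂ x) hs (AnalyticAt.congr
          ((analyticAt_formCoef η (chart_mem_atlas ℂ x) (mem_chart_target ℂ x)).fun_div ha.deriv
            (deriv_ne_zero_of_ordAt_eq_one (hf x hx) (hone x hx))) ?_)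
        have hn : {y | y ≠ p} ∈ 𝓝 ((chartAt ℂ x).symm (chartAt ℂ x x)) := by
          rw [(chartAt ℂ x).left_inv hs]
          exact isOpen_ne.mem_nhds hx
        filter_upwards [(chartAt ℂ x).open_target.mem_nhds (mem_chart_target ℂ x),
          ((chartAt ℂ x).symm.continuousAt (mem_chart_target ℂ x)).preimage_mem_nhds hn]
          with z h1 h2
        rw [Function.comp_apply, Function.comp_apply,
          formQuot_eq η (chart_mem_atlas ℂ x) ((chartAt ℂ x).map_target h1) (hf _ h2),
          (chartAt ℂ x).right_inv h1])
    (by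
      have hs := mem_chart_source ℂ p
      have hco : ContMDiffAt 𝓘(ℂ) 𝓘(ℂ) ω (formCoef η (chartAt ℂ p)) p :=
        contMDiffAt_of_analyticAt (chart_mem_atlas ℂ p) hs
          (analyticAt_formCoef η (chart_mem_atlas ℂ p) (mem_chart_target ℂ p))
      have hd : ContMDiffAt 𝓘(ℂ) 𝓘(ℂ) ω
          (fun y => deriv (g ∘ (chartAt ℂ p).symm) (chartAt ℂ p y)) p :=
        (analyticAt_chart hgp).deriv.contDiffAt.contMDiffAt.comp p
          (contMDiffAt_chart (chart_mem_atlas ℂ p) hs)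
      exact (hco.mul (hζ.pow 2)).div₀ ((hd.mul hζ).sub hgp) (by simpa [localEq_self] using h0))
    (by
      have hs := mem_chart_source ℂ p
      have hev : ∀ᶠ y in 𝓝 p, ContMDiffAt 𝓘(ℂ) 𝓘(ℂ) ω g y := eventually_contMDiffAt hgp
      filter_upwards [self_mem_nhdsWithin, eventually_eventually_nhdsWithin.mpr hfg,
        nhdsWithin_le_nhds ((chartAt ℂ p).open_source.mem_nhds hs),
        nhdsWithin_le_nhds hev, eventually_localEq_ne_zero p] with y hyp h1 h2 h3 h4
      rw [formQuot_eq η (chart_mem_atlas ℂ p) h2 (hf y hyp)]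
      have hgz : AnalyticAt ℂ (g ∘ (chartAt ℂ p).symm) (chartAt ℂ p y) :=
        analyticAt_comp_symm (chart_mem_atlas ℂ p) ((chartAt ℂ p).map_source h2)
          (by rwa [(chartAt ℂ p).left_inv h2])
      have h5 : ∀ᶠ w in 𝓝 y, f w = g w / localEq p true w := by
        have h6 : ∀ᶠ w in 𝓝 y, w ≠ p := isOpen_ne.mem_nhds hyp
        have h7 : ∀ᶠ w in 𝓝 y, w ∈ (chartAt ℂ p).source := (chartAt ℂ p).open_source.mem_nhds h2
        have h8 : ∀ᶠ w in 𝓝 y, g w = localEq p true w * f w := by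
          have := ((isOpen_ne (x := p)).nhdsWithin_eq hyp)
          rw [← this]
          exact h1
        filter_upwards [h6, h7, h8] with w g1 g2 g3
        have := localEq_ne_zero p (i := true) (by simpa [pointCover] using g2) g1
        rw [g3]; field_simp
      have h9 : f ∘ (chartAt ℂ p).symm =ᶠ[𝓝 (chartAt ℂ p y)]
          fun z => (g ∘ (chartAt ℂ p).symm) z / (z - chartAt ℂ p p) := by
        have ht := (chartAt ℂ p).map_source h2
        have hcont := (chartAt ℂ p).symm.continuousAt ht
        rw [ContinuousAt, (chartAt ℂ p).left_inv h2] at hcont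
        filter_upwards [hcont.eventually h5, (chartAt ℂ p).open_target.mem_nhds ht] with z g1 g2
        rw [Function.comp_apply, g1, localEq_true, (chartAt ℂ p).right_inv g2]
        rfl
      rw [localEq_true] at h4
      have hdv : HasDerivAt (fun z => (g ∘ (chartAt ℂ p).symm) z / (z - chartAt ℂ p p))
          ((deriv (g ∘ (chartAt ℂ p).symm) (chartAt ℂ p y) * (chartAt ℂ p y - chartAt ℂ p p) -
            (g ∘ (chartAt ℂ p).symm) (chartAt ℂ p y) * 1) /
              (chartAt ℂ p y - chartAt ℂ p p) ^ 2) (chartAt ℂ p y) :=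
        hgz.differentiableAt.hasDerivAt.div ((hasDerivAt_id _).sub_const _) h4
      rw [h9.deriv_eq, hdv.deriv, localEq_true]
      simp only [Function.comp_apply, (chartAt ℂ p).left_inv h2, mul_one]
      rw [div_div_eq_mul_div])
  -- The constant is the value 0 at `p`. So `η` would vanish wherever `df` does not, that is,
  -- everywhere off `p`.
  have hc0 : c = 0 := by rw [← hc']; simp [localEq_self]
  obtain ⟨y, hy1, hy2⟩ := ((eventually_ne_zero_of_form_ne_zero hη p).and
    (self_mem_nhdsWithin : ∀ᶠ y in 𝓝[≠] p, y ≠ p)).exists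
  have hq := hc y hy2
  rw [hc0, formQuot, div_eq_zero_iff] at hq
  rcases hq with hq | hq
  · exact hy1 (eq_zero_of_formCoef_eq_zero η (chart_mem_atlas ℂ y) (mem_chart_source ℂ y) hq)
  · exact deriv_ne_zero_of_ordAt_eq_one (hf y hy2) (hone y hy2) hq

end SimplePole

/-! ### Local holomorphic sections -/

section Sections

variable {C : Type*} [TopologicalSpace C] [ChartedSpace ℂ C]
  (F : Type*) [NormedAddCommGroup F] [NormedSpace ℂ F]
  {V : C → Type*} [∀ x, AddCommGroup (V x)] [∀ x, Module ℂ (V x)]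
  [TopologicalSpace (TotalSpace F V)] [∀ x, TopologicalSpace (V x)] [FiberBundle F V]

/-- The section `u` is holomorphic at `x`. -/
def HolSecAt (u : ∀ y, V y) (x : C) : Prop :=
  ContMDiffAt 𝓘(ℂ) (𝓘(ℂ).prod 𝓘(ℂ, F)) ω (fun y => (⟨y, u y⟩ : TotalSpace F V)) x

variable {F}

theorem HolSecAt.congr {u u' : ∀ y, V y} {x : C} (hu : HolSecAt F u x)
    (h : ∀ᶠ y in 𝓝 x, u' y = u y) : HolSecAt F u' x :=
  ContMDiffAt.congr_of_eventuallyEq hu (h.mono fun y hy => by simp [hy])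

theorem eventually_mem_baseSet (x : C) : ∀ᶠ y in 𝓝 x, y ∈ (trivializationAt F V x).baseSet :=
  (trivializationAt F V x).open_baseSet.mem_nhds (FiberBundle.mem_baseSet_trivializationAt' x)

section

variable {F₂ : Type*} [NormedAddCommGroup F₂] [NormedSpace ℂ F₂]
  {V₂ : C → Type*} [∀ x, AddCommGroup (V₂ x)] [∀ x, Module ℂ (V₂ x)]
  [TopologicalSpace (TotalSpace F₂ V₂)] [∀ x, TopologicalSpace (V₂ x)] [FiberBundle F₂ V₂]

theorem HolSecAt.map {u : ∀ y, V y} {x : C} (hu : HolSecAt F u x) (T : HolHom F V F₂ V₂) :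
    HolSecAt F₂ (fun y => T.toFun y (u y)) x :=
  ContMDiffAt.comp (g := fun v : TotalSpace F V => (⟨v.1, T.toFun v.1 v.2⟩ : TotalSpace F₂ V₂)) x
    (T.holomorphic.contMDiffAt (x := ⟨x, u x⟩)) hu

end

theorem holSecAt_trivial {f : C → ℂ} {x : C} :
    HolSecAt (V := Bundle.Trivial C ℂ) ℂ f x ↔ ContMDiffAt 𝓘(ℂ) 𝓘(ℂ) ω f x := by
  rw [HolSecAt, Bundle.contMDiffAt_section]
  rfl

variable [VectorBundle ℂ F V]

variable (F V) in
/-- Coordinates of vectors in the trivialization at `x`. -/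
def coordMap (x y : C) : V y →ₗ[ℂ] F := (trivializationAt F V x).linearMapAt ℂ y

variable (F V) in
/-- The vector field with constant coordinates `v` in the trivialization at `x`. -/
def constSec (x : C) (v : F) (y : C) : V y := (trivializationAt F V x).symmₗ ℂ y v

theorem coordMap_constSec {x y : C} (hy : y ∈ (trivializationAt F V x).baseSet) (v : F) :
    coordMap F V x y (constSec F V x v y) = v :=
  Trivialization.linearMapAt_symmₗ _ hy v

theorem constSec_coordMap {x y : C} (hy : y ∈ (trivializationAt F V x).baseSet) (v : V y) :
    constSec F V x (coordMap F V x y v) y = v :=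
  Trivialization.symmₗ_linearMapAt _ hy v

theorem coordMap_injective {x y : C} (hy : y ∈ (trivializationAt F V x).baseSet) :
    Function.Injective (coordMap F V x y) :=
  Function.LeftInverse.injective (constSec_coordMap hy)

theorem coordMap_self_injective (x : C) : Function.Injective (coordMap F V x x) :=
  coordMap_injective (FiberBundle.mem_baseSet_trivializationAt' x)

theorem holSecAt_iff {u : ∀ y, V y} {x : C} :
    HolSecAt F u x ↔ ContMDiffAt 𝓘(ℂ) 𝓘(ℂ, F) ω (fun y => coordMap F V x y (u y)) x := by
  rw [HolSecAt, Bundle.contMDiffAt_section]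
  refine Filter.EventuallyEq.contMDiffAt_iff ?_
  filter_upwards [eventually_mem_baseSet (F := F) (V := V) x] with y hy
  rw [coordMap, Trivialization.coe_linearMapAt_of_mem _ hy]

theorem holSecAt_constSec (x : C) (v : F) : HolSecAt F (constSec F V x v) x := by
  rw [holSecAt_iff]
  refine (contMDiffAt_const (c := v)).congr_of_eventuallyEq ?_
  filter_upwards [eventually_mem_baseSet (F := F) (V := V) x] with y hy
  exact coordMap_constSec hy v

theorem HolSecAt.sub {u u' : ∀ y, V y} {x : C} (hu : HolSecAt F u x) (hu' : HolSecAt F u' x) :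
    HolSecAt F (fun y => u y - u' y) x :=
  ContMDiffAt.sub_section hu hu'

theorem HolSecAt.smul {a : C → ℂ} {u : ∀ y, V y} {x : C} (ha : ContMDiffAt 𝓘(ℂ) 𝓘(ℂ) ω a x)
    (hu : HolSecAt F u x) : HolSecAt F (fun y => a y • u y) x :=
  ContMDiffAt.smul_section ha hu

theorem HolSecAt.const_smul {u : ∀ y, V y} {x : C} (c : ℂ)
    (hu : HolSecAt F u x) : HolSecAt F (fun y => c • u y) x :=
  HolSecAt.smul contMDiffAt_const hu

/-- A coefficient of a holomorphic section with respect to a nonvanishing one is holomorphic. -/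
theorem contMDiffAt_of_smul {u w : ∀ y, V y} {a : C → ℂ} {x : C} (hu : HolSecAt F u x)
    (hw : HolSecAt F w x) (hw0 : w x ≠ 0) (h : ∀ᶠ y in 𝓝 x, u y = a y • w y) :
    ContMDiffAt 𝓘(ℂ) 𝓘(ℂ) ω a x := by
  have hw1 : coordMap F V x x (w x) ≠ 0 := fun h0 =>
    hw0 (coordMap_self_injective (F := F) x (by rw [h0, map_zero]))
  obtain ⟨ℓ, hℓ⟩ := SeparatingDual.exists_ne_zero (R := ℂ) hw1
  have h1 : ContMDiffAt 𝓘(ℂ) 𝓘(ℂ) ω (fun y => ℓ (coordMap F V x y (u y))) x :=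
    ℓ.contMDiff.contMDiffAt.comp x (holSecAt_iff.mp hu)
  have h2 : ContMDiffAt 𝓘(ℂ) 𝓘(ℂ) ω (fun y => ℓ (coordMap F V x y (w y))) x :=
    ℓ.contMDiff.contMDiffAt.comp x (holSecAt_iff.mp hw)
  refine (h1.div₀ h2 hℓ).congr_of_eventuallyEq ?_
  filter_upwards [h, h2.continuousAt.eventually_ne hℓ] with y hy hy0
  rw [Pi.div_apply, hy, map_smul, map_smul, smul_eq_mul, mul_div_cancel_right₀ _ hy0]

theorem HolSecAt.eventually_ne_zero {u : ∀ y, V y} {x : C} (hu : HolSecAt F u x) (h0 : u x ≠ 0) :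
    ∀ᶠ y in 𝓝 x, u y ≠ 0 := by
  have h1 : coordMap F V x x (u x) ≠ 0 := fun h =>
    h0 (coordMap_self_injective (F := F) x (by rw [h, map_zero]))
  filter_upwards [(holSecAt_iff.mp hu).continuousAt.eventually_ne h1] with y hy h
  exact hy (by rw [h, map_zero])

theorem HolSecAt.eq_zero_of_eventually [IsManifold 𝓘(ℂ) ω C] {u : ∀ y, V y} {x : C}
    (hu : HolSecAt F u x) (h : ∀ᶠ y in 𝓝[≠] x, u y = 0) : u x = 0 := by
  by_contra h0
  obtain ⟨y, h1, h2⟩ := (h.and (nhdsWithin_le_nhds (hu.eventually_ne_zero h0))).exists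
  exact h2 h1

/-- Every section of a line bundle is, locally, a multiple of a given nonvanishing section. -/
theorem exists_smul_eq_of_line {L : C → Type*} [∀ x, AddCommGroup (L x)] [∀ x, Module ℂ (L x)]
    [TopologicalSpace (TotalSpace ℂ L)] [∀ x, TopologicalSpace (L x)] [FiberBundle ℂ L]
    [VectorBundle ℂ ℂ L] {u w : ∀ y, L y} {x : C} (hu : HolSecAt ℂ u x) (hw : HolSecAt ℂ w x)
    (hw0 : w x ≠ 0) : ∃ a : C → ℂ, ContMDiffAt 𝓘(ℂ) 𝓘(ℂ) ω a x ∧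
      ∀ᶠ y in 𝓝 x, u y = a y • w y := by
  have h : ∀ᶠ y in 𝓝 x, u y = (coordMap ℂ L x y (u y) / coordMap ℂ L x y (w y)) • w y := by
    filter_upwards [hw.eventually_ne_zero hw0, eventually_mem_baseSet (F := ℂ) (V := L) x]
      with y h1 h2
    have h3 : coordMap ℂ L x y (w y) ≠ 0 := fun h =>
      h1 (coordMap_injective h2 (by rw [h, map_zero]))
    refine coordMap_injective h2 ?_
    rw [map_smul, smul_eq_mul, div_mul_cancel₀ _ h3]
  exact ⟨_, contMDiffAt_of_smul hu hw hw0 h, h⟩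

/-- A fibrewise linear map from a line bundle is holomorphic if it maps local holomorphic frames
to holomorphic sections. -/
def HolHom.ofLine {L : C → Type*} [∀ x, AddCommGroup (L x)] [∀ x, Module ℂ (L x)]
    [TopologicalSpace (TotalSpace ℂ L)] [∀ x, TopologicalSpace (L x)] [FiberBundle ℂ L]
    [VectorBundle ℂ ℂ L] (T : ∀ y, L y →ₗ[ℂ] V y)
    (h : ∀ x, ∃ g : ∀ y, L y, HolSecAt ℂ g x ∧ g x ≠ 0 ∧ HolSecAt F (fun y => T y (g y)) x) :
    HolHom ℂ L F V where
  toFun := T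
  holomorphic := by
    intro v₀
    obtain ⟨g, hg, hg0, hTg⟩ := h v₀.1
    rw [Bundle.contMDiffAt_totalSpace]
    have hproj : ContMDiffAt (𝓘(ℂ).prod 𝓘(ℂ)) 𝓘(ℂ) ω
        (TotalSpace.proj : TotalSpace ℂ L → C) v₀ := (Bundle.contMDiff_proj L).contMDiffAt
    refine ⟨hproj, ?_⟩
    have ha : ContMDiffAt (𝓘(ℂ).prod 𝓘(ℂ)) 𝓘(ℂ) ω
        (fun v : TotalSpace ℂ L => (trivializationAt ℂ L v₀.1 v).2) v₀ :=
      (Bundle.contMDiffAt_totalSpace.mp (contMDiffAt_id (x := v₀))).2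
    have hb := (holSecAt_iff.mp hg).comp v₀ hproj
    have hc := (holSecAt_iff.mp hTg).comp v₀ hproj
    have hb0 : coordMap ℂ L v₀.1 v₀.1 (g v₀.1) ≠ 0 := fun h =>
      hg0 (coordMap_self_injective (F := ℂ) v₀.1 (by rw [h, map_zero]))
    refine ((ha.div₀ hb hb0).smul hc).congr_of_eventuallyEq ?_
    filter_upwards [hproj.continuousAt.eventually (eventually_mem_baseSet (F := ℂ) (V := L) v₀.1),
      hproj.continuousAt.eventually (eventually_mem_baseSet (F := F) (V := V) v₀.1),
      hb.continuousAt.eventually_ne hb0] with v h1 h2 h3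
    have e1 : (trivializationAt ℂ L v₀.1 v).2 = coordMap ℂ L v₀.1 v.1 v.2 := by
      rw [coordMap, Trivialization.coe_linearMapAt_of_mem _ h1]
    have e2 : (trivializationAt F V v₀.1 ⟨v.1, T v.1 v.2⟩).2 =
        coordMap F V v₀.1 v.1 (T v.1 v.2) := by
      rw [coordMap, Trivialization.coe_linearMapAt_of_mem _ h2]
    simp only [Function.comp_apply] at h3 ⊢
    -- A vector `v` is a multiple of the frame `g`, the factor being a quotient of coordinates and
    -- so holomorphic in `v`; by linearity `T v` is the same multiple of `T g`.
    have e3 : v.2 = (coordMap ℂ L v₀.1 v.1 v.2 / coordMap ℂ L v₀.1 v.1 (g v.1)) • g v.1 := by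
      refine coordMap_injective h1 ?_
      rw [map_smul, smul_eq_mul, div_mul_cancel₀ _ h3]
    rw [Pi.smul_apply', Pi.div_apply, e1, e2]
    conv_lhs => rw [e3, map_smul, map_smul]
    rfl

/-- Lifting local holomorphic sections of a line bundle along a surjective homomorphism. -/
theorem HolHom.exists_lift {L : C → Type*} [∀ x, AddCommGroup (L x)] [∀ x, Module ℂ (L x)]
    [TopologicalSpace (TotalSpace ℂ L)] [∀ x, TopologicalSpace (L x)] [FiberBundle ℂ L]
    [VectorBundle ℂ ℂ L] (q : HolHom F V ℂ L) {x : C} (hq : q.toFun x ≠ 0)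
    {g : ∀ y, L y} (hg : HolSecAt ℂ g x) :
    ∃ u : ∀ y, V y, HolSecAt F u x ∧ ∀ᶠ y in 𝓝 x, q.toFun y (u y) = g y := by
  obtain ⟨v, hv⟩ : ∃ v, q.toFun x v ≠ 0 := by
    by_contra h
    push Not at h
    exact hq (LinearMap.ext h)
  -- A local section through a vector not killed by `q` maps to a frame of `L` near `x`; rescaling
  -- it lifts any section.
  have hu := holSecAt_constSec (V := V) x (coordMap F V x x v)
  have hqu := hu.map q
  have hu0 : q.toFun x (constSec F V x (coordMap F V x x v) x) ≠ 0 := by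
    rwa [constSec_coordMap (FiberBundle.mem_baseSet_trivializationAt' x)]
  obtain ⟨a, ha, h⟩ := exists_smul_eq_of_line hg hqu hu0
  refine ⟨fun y => a y • constSec F V x (coordMap F V x x v) y, HolSecAt.smul ha hu, ?_⟩
  filter_upwards [h] with y hy
  rw [map_smul, hy]

end Sections

/-! ### Sections of `𝒪(p)` -/

section PointSections

variable {C : Type*} [TopologicalSpace C] [ChartedSpace ℂ C] [T1Space C] [IsManifold 𝓘(ℂ) ω C]

/-- The section of `𝒪(p)` given by a meromorphic function `f`, with value `c` at `p`. -/
def pointSec (p : C) (f : C → ℂ) (c : ℂ) (y : C) : PointBundle p y :=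
  open Classical in if y = p then c else f y

theorem pointSec_self (p : C) (f : C → ℂ) (c : ℂ) : pointSec p f c p = c := if_pos rfl

theorem pointSec_of_ne {p : C} (f : C → ℂ) (c : ℂ) {y : C} (hy : y ≠ p) :
    pointSec p f c y = f y := if_neg hy

/-- The value of an element of a fibre of `𝒪(p)` as a complex number. -/
def fibVal {p y : C} : PointBundle p y →ₗ[ℂ] ℂ := LinearMap.id

open Classical in
-- `fibVal` reads a fibre element in the trivialization attached to its own base point. A section
-- given by a meromorphic function `f` thus has value `f` off `p`, but the value of `z f` at `p`;
-- this jump is the reason for the separate cases at `p`.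
theorem coordMap_pointBundle_of_ne {p x y : C} (hx : x ≠ p) (hy : y ≠ p) (v : PointBundle p y) :
    coordMap ℂ (PointBundle p) x y v = fibVal v := by
  have hb : y ∈ (trivializationAt ℂ (PointBundle p) x).baseSet := by
    change y ∈ pointCover p (decide (x = p))
    simp [hx, pointCover, hy]
  rw [coordMap, Trivialization.coe_linearMapAt_of_mem _ hb]
  change pointTransition p (decide (y = p)) (decide (x = p)) y • fibVal v = fibVal v
  simp [hx, hy, pointTransition]

open Classical in
theorem coordMap_pointBundle_self_of_ne {p y : C} (hy : y ≠ p) (hs : y ∈ (chartAt ℂ p).source)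
    (v : PointBundle p y) : coordMap ℂ (PointBundle p) p y v = localEq p true y * fibVal v := by
  have hb : y ∈ (trivializationAt ℂ (PointBundle p) p).baseSet := by
    change y ∈ pointCover p (decide (p = p))
    simpa [pointCover] using hs
  rw [coordMap, Trivialization.coe_linearMapAt_of_mem _ hb]
  change pointTransition p (decide (y = p)) (decide (p = p)) y • fibVal v = _
  simp [hy, pointTransition, localEq]

open Classical in
theorem coordMap_pointBundle_self (p : C) (v : PointBundle p p) :
    coordMap ℂ (PointBundle p) p p v = fibVal v := by
  have hb : p ∈ (trivializationAt ℂ (PointBundle p) p).baseSet :=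
    FiberBundle.mem_baseSet_trivializationAt' p
  rw [coordMap, Trivialization.coe_linearMapAt_of_mem _ hb]
  change pointTransition p (decide (p = p)) (decide (p = p)) p • fibVal v = _
  simp [pointTransition]

theorem holSecAt_pointBundle_of_ne {p x : C} (hx : x ≠ p) {u : ∀ y, PointBundle p y} :
    HolSecAt ℂ u x ↔ ContMDiffAt 𝓘(ℂ) 𝓘(ℂ) ω (fun y => fibVal (u y)) x := by
  rw [holSecAt_iff]
  refine Filter.EventuallyEq.contMDiffAt_iff ?_
  filter_upwards [isOpen_ne.mem_nhds hx] with y hy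
  exact coordMap_pointBundle_of_ne hx hy _

theorem holSecAt_pointSec_self {p : C} {f : C → ℂ} {g : C → ℂ} :
    (∀ᶠ y in 𝓝[≠] p, g y = localEq p true y * f y) → (HolSecAt ℂ (pointSec p f (g p)) p ↔
      ContMDiffAt 𝓘(ℂ) 𝓘(ℂ) ω g p) := by
  intro h
  rw [holSecAt_iff]
  refine Filter.EventuallyEq.contMDiffAt_iff ?_
  filter_upwards [eventually_nhdsWithin_iff.mp h,
    (chartAt ℂ p).open_source.mem_nhds (mem_chart_source ℂ p)] with y h1 h2
  by_cases hy : y = p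
  · subst hy
    rw [pointSec_self]
    exact coordMap_pointBundle_self _ _
  · rw [h1 hy, pointSec_of_ne _ _ hy]
    exact coordMap_pointBundle_self_of_ne hy h2 _

/-- The canonical section of `𝒪(p)`, vanishing exactly at `p`. -/
def canSec (p : C) : ∀ y, PointBundle p y := pointSec p (fun _ => 1) 0

theorem canSec_self (p : C) : canSec p p = 0 := pointSec_self _ _ _

theorem canSec_ne_zero {p y : C} (hy : y ≠ p) : canSec p y ≠ 0 := by
  rw [canSec, pointSec_of_ne _ _ hy]
  exact one_ne_zero (α := ℂ)

theorem smul_canSec {p y : C} (hy : y ≠ p) (v : PointBundle p y) :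
    fibVal v • canSec p y = v := by
  rw [canSec, pointSec_of_ne _ _ hy]
  exact mul_one (fibVal v)

theorem holSecAt_canSec (p x : C) : HolSecAt ℂ (canSec p) x := by
  by_cases hx : x = p
  · subst hx
    have h := holSecAt_pointSec_self (p := x) (f := fun _ => 1) (g := localEq x true)
      (Eventually.of_forall fun y => (mul_one _).symm)
    rw [localEq_self] at h
    exact h.mpr (contMDiffAt_localEq (mem_chart_source ℂ x))
  · rw [holSecAt_pointBundle_of_ne hx]
    refine (contMDiffAt_const (c := (1 : ℂ))).congr_of_eventuallyEq ?_
    filter_upwards [isOpen_ne.mem_nhds hx] with y hy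
    rw [canSec, pointSec_of_ne _ _ hy]
    rfl

/-- A frame of `𝒪(p)` near `p`. -/
def genSec (p : C) : ∀ y, PointBundle p y := pointSec p (fun y => (localEq p true y)⁻¹) 1

theorem genSec_self_ne_zero (p : C) : genSec p p ≠ 0 := by
  rw [genSec, pointSec_self]
  exact one_ne_zero (α := ℂ)

theorem holSecAt_genSec (p : C) : HolSecAt ℂ (genSec p) p :=
  (holSecAt_pointSec_self (p := p) (g := fun _ => 1) (by
    filter_upwards [eventually_localEq_ne_zero p] with y hy
    field_simp)).mpr contMDiffAt_const

theorem canSec_eq_smul_genSec (p : C) :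
    ∀ᶠ y in 𝓝 p, canSec p y = localEq p true y • genSec p y := by
  filter_upwards [eventually_nhdsWithin_iff.mp (eventually_localEq_ne_zero p)] with y hy
  by_cases h : y = p
  · subst h
    rw [canSec_self, localEq_self, zero_smul]
  · rw [canSec, genSec, pointSec_of_ne _ _ h, pointSec_of_ne _ _ h]
    exact (mul_inv_cancel₀ (hy h)).symm

/-- On a compact Riemann surface of positive genus, `H⁰(C, 𝒪(p))` is spanned by the canonical
section. -/
theorem exists_eq_smul_canSec [T2Space C] [CompactSpace C] [ConnectedSpace C] (hg : 1 ≤ genus C)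
    {p : C} {u : ∀ y, PointBundle p y} (hu : ∀ x, HolSecAt ℂ u x) :
    ∃ c : ℂ, ∀ y, u y = c • canSec p y := by
  have hp := holSecAt_iff.mp (hu p)
  obtain ⟨c, hc⟩ := exists_eq_const_of_simple_pole hg (p := p) (f := fun y => fibVal (u y))
    (fun x hx => (holSecAt_pointBundle_of_ne hx).mp (hu x)) hp (by
      filter_upwards [self_mem_nhdsWithin,
        nhdsWithin_le_nhds ((chartAt ℂ p).open_source.mem_nhds (mem_chart_source ℂ p))] with y h1 h2
      exact coordMap_pointBundle_self_of_ne h1 h2 _)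
  have hne : ∀ y, y ≠ p → u y = c • canSec p y := fun y hy => by
    rw [← hc y hy, smul_canSec hy]
  refine ⟨c, fun y => ?_⟩
  by_cases hy : y = p
  · subst hy
    refine sub_eq_zero.mp (HolSecAt.eq_zero_of_eventually (F := ℂ) (V := PointBundle y)
      (u := fun z => u z - c • canSec y z)
      ((hu y).sub (HolSecAt.const_smul c (holSecAt_canSec y y))) ?_)
    filter_upwards [self_mem_nhdsWithin] with z hz
    rw [hne z hz, sub_self]
  · exact hne y hy

end PointSections

/-! ### Endomorphisms of a nontrivial extension -/

section Divide

variable {C : Type*} [TopologicalSpace C] [ChartedSpace ℂ C] [IsManifold 𝓘(ℂ) ω C]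
  {F : Type*} [NormedAddCommGroup F] [NormedSpace ℂ F] [CompleteSpace F]
  {V : C → Type*} [∀ x, AddCommGroup (V x)] [∀ x, Module ℂ (V x)]
  [TopologicalSpace (TotalSpace F V)] [∀ x, TopologicalSpace (V x)] [FiberBundle F V]
  [VectorBundle ℂ F V]

/-- A holomorphic section vanishing at `p` is divisible by a local coordinate at `p`. -/
theorem HolSecAt.exists_eq_localEq_smul {w : ∀ y, V y} {p : C} (hw : HolSecAt F w p)
    (h0 : w p = 0) : ∃ k : ∀ y, V y, HolSecAt F k p ∧ ∀ᶠ y in 𝓝 p, w y = localEq p true y • k y := by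
  have hs := mem_chart_source ℂ p
  set g : C → F := fun y => coordMap F V p y (w y) with hg
  have hgp : g p = 0 := by rw [hg]; simp [h0]
  have ha : AnalyticAt ℂ (g ∘ (chartAt ℂ p).symm) (chartAt ℂ p p) := by
    have h1 : ContMDiffAt 𝓘(ℂ) 𝓘(ℂ, F) ω g ((chartAt ℂ p).symm (chartAt ℂ p p)) := by
      rw [(chartAt ℂ p).left_inv hs]
      exact holSecAt_iff.mp hw
    exact (h1.comp _ (contMDiffAt_symm (chart_mem_atlas ℂ p)
      (mem_chart_target ℂ p))).contDiffAt.analyticAt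
  have h1 : ((1 : ℕ) : ℕ∞) ≤ analyticOrderAt (g ∘ (chartAt ℂ p).symm) (chartAt ℂ p p) := by
    rw [Nat.cast_one, Order.one_le_iff_ne_zero, ne_eq, ha.analyticOrderAt_eq_zero]
    simp [hgp]
  obtain ⟨k, hk, hgk⟩ := (natCast_le_analyticOrderAt ha).mp h1
  have hk' : ContMDiffAt 𝓘(ℂ) 𝓘(ℂ, F) ω (k ∘ chartAt ℂ p) p :=
    hk.contDiffAt.contMDiffAt.comp p (contMDiffAt_chart (chart_mem_atlas ℂ p) hs)
  refine ⟨fun y => constSec F V p (k (chartAt ℂ p y)) y, ?_, ?_⟩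
  · rw [holSecAt_iff]
    refine hk'.congr_of_eventuallyEq ?_
    filter_upwards [eventually_mem_baseSet (F := F) (V := V) p] with y hy
    exact coordMap_constSec hy _
  · filter_upwards [((chartAt ℂ p).continuousAt hs).eventually hgk,
      (chartAt ℂ p).open_source.mem_nhds hs, eventually_mem_baseSet (F := F) (V := V) p]
      with y h2 h3 h4
    refine coordMap_injective h4 ?_
    rw [map_smul, coordMap_constSec h4]
    simpa [(chartAt ℂ p).left_inv h3, localEq_true] using h2

end Divide

section Extension

variable {C : Type*} [TopologicalSpace C] [T2Space C] [ChartedSpace ℂ C] [IsManifold 𝓘(ℂ) ω C]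
  {F : Type*} [NormedAddCommGroup F] [NormedSpace ℂ F]
  {V : C → Type*} [∀ x, AddCommGroup (V x)] [∀ x, Module ℂ (V x)]
  [TopologicalSpace (TotalSpace F V)] [∀ x, TopologicalSpace (V x)] [FiberBundle F V]
  [VectorBundle ℂ F V]

/-- The image in `V` of the constant section `1` of `𝒪`. -/
def unitSec (ι : HolHom ℂ (Bundle.Trivial C ℂ) F V) (y : C) : V y := ι.toFun y (1 : ℂ)

variable {p : C} {ι : HolHom ℂ (Bundle.Trivial C ℂ) F V} {q : HolHom F V ℂ (PointBundle p)}

theorem holSecAt_unitSec (x : C) : HolSecAt F (unitSec ι) x :=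
  HolSecAt.map (V := Bundle.Trivial C ℂ) (u := fun _ => (1 : ℂ))
    (holSecAt_trivial.mpr contMDiffAt_const) ι

theorem apply_eq_smul_unitSec (y : C) (a : Bundle.Trivial C ℂ y) :
    ∃ c : ℂ, ι.toFun y a = c • unitSec ι y := by
  refine ⟨(show ℂ from a), ?_⟩
  rw [unitSec, ← map_smul]
  congr 1
  exact (mul_one (show ℂ from a)).symm

theorem unitSec_ne_zero (hι : ∀ x, Function.Injective (ι.toFun x)) (y : C) :
    unitSec ι y ≠ 0 := fun h =>
  one_ne_zero (α := ℂ) (hι y (h.trans (map_zero _).symm))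

theorem apply_unitSec (hexact : ∀ x, LinearMap.range (ι.toFun x) = LinearMap.ker (q.toFun x))
    (y : C) : q.toFun y (unitSec ι y) = 0 := by
  have : unitSec ι y ∈ LinearMap.ker (q.toFun y) := hexact y ▸ LinearMap.mem_range_self _ _
  exact this

theorem exists_eq_smul_unitSec
    (hexact : ∀ x, LinearMap.range (ι.toFun x) = LinearMap.ker (q.toFun x)) {y : C} {v : V y}
    (hv : q.toFun y v = 0) : ∃ c : ℂ, v = c • unitSec ι y := by
  have : v ∈ LinearMap.range (ι.toFun y) := by rw [hexact]; exact hv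
  obtain ⟨a, rfl⟩ := this
  exact apply_eq_smul_unitSec y a

/-- A section of `V` in the kernel of `q` is a holomorphic multiple of the unit section. -/
theorem exists_holomorphic_smul_unitSec (hι : ∀ x, Function.Injective (ι.toFun x))
    (hexact : ∀ x, LinearMap.range (ι.toFun x) = LinearMap.ker (q.toFun x)) {w : ∀ y, V y}
    (hw : ∀ x, HolSecAt F w x) (hqw : ∀ y, q.toFun y (w y) = 0) :
    ∃ h : C → ℂ, (∀ x, ContMDiffAt 𝓘(ℂ) 𝓘(ℂ) ω h x) ∧ ∀ y, w y = h y • unitSec ι y := by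
  choose h hh using fun y => exists_eq_smul_unitSec hexact (hqw y)
  exact ⟨h, fun x => contMDiffAt_of_smul (hw x) (holSecAt_unitSec x) (unitSec_ne_zero hι x)
    (Eventually.of_forall hh), hh⟩

/-- Such a section is a holomorphic, hence constant, multiple of the nowhere vanishing unit section,
and the constant is read off at `p`. -/
theorem eq_zero_of_apply_eq_zero_of_vanish [CompactSpace C] [ConnectedSpace C]
    (hι : ∀ x, Function.Injective (ι.toFun x))
    (hexact : ∀ x, LinearMap.range (ι.toFun x) = LinearMap.ker (q.toFun x)) {w : ∀ y, V y}
    (hw : ∀ x, HolSecAt F w x) (hqw : ∀ y, q.toFun y (w y) = 0) (hp : w p = 0) (y : C) :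
    w y = 0 := by
  obtain ⟨h, hh, hwh⟩ := exists_holomorphic_smul_unitSec hι hexact hw hqw
  obtain ⟨c, hc⟩ := exists_eq_const hh
  have hc0 : c = 0 := by
    have h1 := hwh p
    rw [hp, hc, eq_comm, smul_eq_zero] at h1
    exact h1.resolve_right (unitSec_ne_zero hι p)
  rw [hwh, hc, hc0, zero_smul]

/-- If the canonical section of `𝒪(p)` lifts to a section of `V` vanishing at `p`, then the
extension splits. -/
theorem exists_splitting_of_lift [CompleteSpace F] {w : ∀ y, V y} (hw : ∀ x, HolSecAt F w x)
    (hqw : ∀ y, q.toFun y (w y) = canSec p y) (hp : w p = 0) :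
    ∃ s : HolHom ℂ (PointBundle p) F V, ∀ x, q.toFun x ∘ₗ s.toFun x = LinearMap.id := by
  classical
  obtain ⟨k, hk, hwk⟩ := (hw p).exists_eq_localEq_smul hp
  -- Off `p`, `q w = canSec` reads `ζ q(k) = ζ genSec`. Cancel `ζ` and pass to the limit at `p`.
  have hqk : q.toFun p (k p) = genSec p p := by
    refine sub_eq_zero.mp (HolSecAt.eq_zero_of_eventually (F := ℂ) (V := PointBundle p)
      (u := fun z => q.toFun z (k z) - genSec p z) ((hk.map q).sub (holSecAt_genSec p)) ?_)
    filter_upwards [nhdsWithin_le_nhds hwk, nhdsWithin_le_nhds (canSec_eq_smul_genSec p),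
      eventually_localEq_ne_zero p] with y h1 h2 h3
    have h4 := hqw y
    rw [h1, h2, map_smul] at h4
    exact sub_eq_zero.mpr (smul_right_injective _ h3 h4)
  have hgen : ∀ v : PointBundle p p, fibVal v • genSec p p = v := fun v => by
    rw [genSec, pointSec_self]
    exact mul_one (fibVal v)
  -- The splitting sends `canSec` to `w` off `p`; near `p` this is the map sending `genSec` to `k =
  -- w / ζ`, which is holomorphic across `p`.
  set T : ∀ y, PointBundle p y →ₗ[ℂ] V y := fun y =>
    (LinearMap.toSpanSingleton ℂ (V y) (if h : y = p then h ▸ k p else w y)) ∘ₗ fibVal with hT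
  have hTp : ∀ v, T p v = fibVal v • k p := fun v => by simp [hT]
  have hTne : ∀ y, y ≠ p → ∀ v, T y v = fibVal v • w y := fun y hy v => by simp [hT, hy]
  refine ⟨HolHom.ofLine T fun x => ?_, fun x => LinearMap.ext fun v => ?_⟩
  · by_cases hx : x = p
    · subst hx
      refine ⟨genSec x, holSecAt_genSec x, genSec_self_ne_zero x, hk.congr ?_⟩
      filter_upwards [hwk, eventually_nhdsWithin_iff.mp (eventually_localEq_ne_zero x)] with y h1 h2
      by_cases hy : y = x
      · subst hy
        rw [hTp, genSec, pointSec_self]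
        exact one_smul ℂ _
      · rw [hTne y hy, h1, smul_smul, genSec, pointSec_of_ne _ _ hy]
        change ((localEq x true y)⁻¹ * localEq x true y) • k y = k y
        rw [inv_mul_cancel₀ (h2 hy), one_smul]
    · refine ⟨canSec p, holSecAt_canSec p x, canSec_ne_zero hx, (hw x).congr ?_⟩
      filter_upwards [isOpen_ne.mem_nhds hx] with y hy
      rw [hTne y hy, canSec, pointSec_of_ne _ _ hy]
      exact one_smul ℂ _
  · change q.toFun x (T x v) = v
    by_cases hx : x = p
    · subst hx
      rw [hTp, map_smul, hqk, hgen]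
    · rw [hTne x hx, map_smul, hqw, smul_canSec hx]

/-- If an endomorphism killing `𝒪` induces a nonzero multiple of the identity of `𝒪(p)`, then the
extension splits. -/
theorem exists_splitting_of_endomorphism
    (hexact : ∀ x, LinearMap.range (ι.toFun x) = LinearMap.ker (q.toFun x))
    (hq : ∀ x, Function.Surjective (q.toFun x)) {φ : ∀ y, V y →ₗ[ℂ] V y}
    (hφ : ∀ (u : ∀ y, V y) x, HolSecAt F u x → HolSecAt F (fun y => φ y (u y)) x)
    (hφι : ∀ y, φ y (unitSec ι y) = 0) {b : ℂ} (hb : b ≠ 0)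
    (hqφ : ∀ y v, q.toFun y (φ y v) = b • q.toFun y v) :
    ∃ s : HolHom ℂ (PointBundle p) F V, ∀ x, q.toFun x ∘ₗ s.toFun x = LinearMap.id := by
  -- The pointwise right inverse `r` of `q` need not even be continuous. Since `φ` kills `ker q`, `φ
  -- ∘ r` does not depend on the choice and may be computed with any holomorphic lift.
  choose r hr using fun y => (q.toFun y).exists_rightInverse_of_surjective
    (LinearMap.range_eq_top.mpr (hq y))
  have hr' : ∀ y v, q.toFun y (r y v) = v := fun y v => LinearMap.congr_fun (hr y) v
  have hT : ∀ y v, φ y (r y (q.toFun y v)) = φ y v := by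
    intro y v
    obtain ⟨c, hc⟩ := exists_eq_smul_unitSec hexact (v := r y (q.toFun y v) - v)
      (by rw [map_sub, hr', sub_self])
    rw [← sub_eq_zero, ← map_sub, hc, map_smul, hφι, smul_zero]
  refine ⟨HolHom.ofLine (fun y => b⁻¹ • (φ y ∘ₗ r y)) fun x => ?_,
    fun x => LinearMap.ext fun v => ?_⟩
  · obtain ⟨v, hv⟩ := hq x (show PointBundle p x from (1 : ℂ))
    have hv0 : q.toFun x v ≠ 0 := by
      rw [hv]
      exact one_ne_zero (α := ℂ)
    have hu := holSecAt_constSec (V := V) x (coordMap F V x x v)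
    refine ⟨fun y => q.toFun y (constSec F V x (coordMap F V x x v) y), hu.map q, ?_, ?_⟩
    · change q.toFun x (constSec F V x (coordMap F V x x v) x) ≠ 0
      rwa [constSec_coordMap (FiberBundle.mem_baseSet_trivializationAt' x)]
    · refine (HolSecAt.const_smul b⁻¹ (hφ _ x hu)).congr (Eventually.of_forall fun y => ?_)
      rw [LinearMap.smul_apply, LinearMap.comp_apply, hT]
  · change q.toFun x ((b⁻¹ • (φ x ∘ₗ r x)) v) = v
    rw [LinearMap.smul_apply, LinearMap.comp_apply, map_smul, hqφ, hr', smul_smul,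
      inv_mul_cancel₀ hb, one_smul]

/-- A nontrivial extension of `𝒪(p)` by `𝒪` on a curve of positive genus is simple. -/
theorem exists_eq_smul_id [CompleteSpace F] [CompactSpace C] [ConnectedSpace C] (hg : 1 ≤ genus C)
    (hι : ∀ x, Function.Injective (ι.toFun x))
    (hexact : ∀ x, LinearMap.range (ι.toFun x) = LinearMap.ker (q.toFun x))
    (hq : ∀ x, Function.Surjective (q.toFun x))
    (hnontrivial : ¬ ∃ s : HolHom ℂ (PointBundle p) F V,
      ∀ x, q.toFun x ∘ₗ s.toFun x = LinearMap.id) {φ : ∀ y, V y →ₗ[ℂ] V y}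
    (hφ : ∀ (u : ∀ y, V y) x, HolSecAt F u x → HolSecAt F (fun y => φ y (u y)) x) :
    ∃ μ : ℂ, ∀ y v, φ y v = μ • v := by
  have hφe : ∀ x, HolSecAt F (fun y => φ y (unitSec ι y)) x := fun x => hφ _ x (holSecAt_unitSec x)
  -- `q(φ e)` is a multiple of the canonical section, which vanishes at `p`. So `φ` preserves the
  -- line `𝒪` at `p`; the scalar `μ` by which it acts there is the one to subtract.
  obtain ⟨c, hc⟩ := exists_eq_smul_canSec hg fun x => (hφe x).map q
  obtain ⟨μ, hμ⟩ := exists_eq_smul_unitSec hexact (v := φ p (unitSec ι p))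
    (by rw [hc, canSec_self, smul_zero])
  set φ' : ∀ y, V y →ₗ[ℂ] V y := fun y => φ y - μ • LinearMap.id with hφ'def
  have hφ'a : ∀ y v, φ' y v = φ y v - μ • v := fun y v => rfl
  have hφ' : ∀ (u : ∀ y, V y) x, HolSecAt F u x → HolSecAt F (fun y => φ' y (u y)) x :=
    fun u x hu => (hφ u x hu).sub (HolSecAt.const_smul μ hu)
  have hw : ∀ x, HolSecAt F (fun y => φ' y (unitSec ι y)) x := fun x =>
    hφ' _ x (holSecAt_unitSec x)
  have hwp : φ' p (unitSec ι p) = 0 := by rw [hφ'a, hμ, sub_self]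
  have hqw : ∀ y, q.toFun y (φ' y (unitSec ι y)) = c • canSec p y := fun y => by
    rw [hφ'a, map_sub, map_smul, apply_unitSec hexact, smul_zero, sub_zero, hc]
  have hc0 : c = 0 := by
    by_contra hc0
    refine hnontrivial (exists_splitting_of_lift (w := fun y => c⁻¹ • φ' y (unitSec ι y))
      (fun x => HolSecAt.const_smul c⁻¹ (hw x)) (fun y => ?_) (by rw [hwp, smul_zero]))
    rw [map_smul, hqw, smul_smul, inv_mul_cancel₀ hc0, one_smul]
  have hφι : ∀ y, φ' y (unitSec ι y) = 0 := fun y =>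
    eq_zero_of_apply_eq_zero_of_vanish hι hexact hw
      (fun y => by rw [hqw, hc0, zero_smul]) hwp y
  choose r hr using fun y => (q.toFun y).exists_rightInverse_of_surjective
    (LinearMap.range_eq_top.mpr (hq y))
  have hr' : ∀ y v, q.toFun y (r y v) = v := fun y v => LinearMap.congr_fun (hr y) v
  have hT : ∀ y v v', q.toFun y v = q.toFun y v' → φ' y v = φ' y v' := by
    intro y v v' h
    obtain ⟨c, hc⟩ := exists_eq_smul_unitSec hexact (v := v - v') (by rw [map_sub, h, sub_self])
    rw [← sub_eq_zero, ← map_sub, hc, map_smul, hφι, smul_zero]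
  set one : ∀ y, PointBundle p y := fun y => (1 : ℂ)
  have hone : ∀ y (v : PointBundle p y), v = fibVal v • one y := fun y v =>
    (mul_one (fibVal v)).symm
  -- As `φ'` kills `𝒪`, it induces an endomorphism of the line bundle `𝒪(p)`, which is
  -- multiplication by a global holomorphic function `b`.
  set b : C → ℂ := fun y => fibVal (q.toFun y (φ' y (r y (one y)))) with hb
  have hqφ : ∀ y v, q.toFun y (φ' y v) = b y • q.toFun y v := by
    intro y v
    rw [hT y v (fibVal (q.toFun y v) • r y (one y)) (by rw [map_smul, hr', ← hone]), map_smul,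
      map_smul, hone y (q.toFun y (φ' y (r y (one y)))), smul_smul, mul_comm, ← smul_smul, ← hone]
  have hbhol : ∀ x, ContMDiffAt 𝓘(ℂ) 𝓘(ℂ) ω b x := by
    intro x
    obtain ⟨v, hv⟩ := hq x (one x)
    have hu := holSecAt_constSec (V := V) x (coordMap F V x x v)
    refine contMDiffAt_of_smul ((hφ' _ x hu).map q) (hu.map q) ?_ (Eventually.of_forall fun y =>
      hqφ y _)
    rw [constSec_coordMap (FiberBundle.mem_baseSet_trivializationAt' x), hv]
    exact one_ne_zero (α := ℂ)
  obtain ⟨b₀, hb₀⟩ := exists_eq_const hbhol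
  have hb00 : b₀ = 0 := by
    by_contra hne
    exact hnontrivial (exists_splitting_of_endomorphism hexact hq hφ' hφι hne
      fun y v => by rw [hqφ, hb₀])
  -- Now `φ'` factors as `V → 𝒪(p) → 𝒪 → V`. The canonical section goes to a section of `𝒪`
  -- vanishing at `p`, hence to 0; it spans the fibres off `p`, so `φ' = 0` there.
  have hcan : ∀ y, φ' y (r y (canSec p y)) = 0 := by
    refine eq_zero_of_apply_eq_zero_of_vanish hι hexact (fun x => ?_)
      (fun y => by rw [hqφ, hb₀, hb00, zero_smul]) (by rw [canSec_self, map_zero, map_zero])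
    obtain ⟨u, hu, hqu⟩ := q.exists_lift (x := x) (fun h => by
      obtain ⟨v, hv⟩ := hq x (one x)
      rw [h, LinearMap.zero_apply] at hv
      exact one_ne_zero (α := ℂ) hv.symm) (holSecAt_canSec p x)
    refine (hφ' u x hu).congr ?_
    filter_upwards [hqu] with y hy
    exact hT _ _ _ (by rw [hr', hy])
  have hne : ∀ y, y ≠ p → ∀ v, φ' y v = 0 := by
    intro y hy v
    rw [hT y v (fibVal (q.toFun y v) • r y (canSec p y)) (by
      rw [map_smul, hr', smul_canSec hy]), map_smul, hcan, smul_zero]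
  refine ⟨μ, fun y v => sub_eq_zero.mp ?_⟩
  rw [← hφ'a]
  by_cases hy : y = p
  · subst hy
    have hu := holSecAt_constSec (V := V) y (coordMap F V y y v)
    have h := (hφ' _ y hu).eq_zero_of_eventually (by
      filter_upwards [self_mem_nhdsWithin] with z hz
      exact hne z hz _)
    rwa [constSec_coordMap (FiberBundle.mem_baseSet_trivializationAt' y)] at h
  · exact hne y hy v

end Extension

/-! ### The degree -/

section Degree

variable {C : Type*} [TopologicalSpace C] [ChartedSpace ℂ C]
  {F : Type*} [NormedAddCommGroup F] [NormedSpace ℂ F] [FiniteDimensional ℂ F]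
  {V : C → Type*} [∀ x, AddCommGroup (V x)] [∀ x, Module ℂ (V x)]
  [TopologicalSpace (TotalSpace F V)] [∀ x, TopologicalSpace (V x)] [FiberBundle F V]
  [VectorBundle ℂ F V]

theorem detCoord_ιMulti (x y : C) (v : Fin (Module.finrank ℂ F) → V y) :
    detCoord F V x y (exteriorPower.ιMulti ℂ _ v) =
      (Module.finBasis ℂ F).det fun i => coordMap F V x y (v i) := by
  rw [detCoord, exteriorPower.alternatingMapLinearEquiv_apply_ιMulti]
  rfl

/-- Changing the trivialization multiplies `detCoord` by the determinant of the transition map, so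
quotients of sections of `det V` are functions on `C`. -/
theorem exists_detCoord_eq_mul {x x' y : C} (hy : y ∈ (trivializationAt F V x).baseSet)
    (hy' : y ∈ (trivializationAt F V x').baseSet) :
    ∃ d : ℂ, d ≠ 0 ∧ ∀ σ, detCoord F V x' y σ = d * detCoord F V x y σ := by
  set G : F ≃ₗ[ℂ] F := ((trivializationAt F V x).linearEquivAt ℂ y hy).symm.trans
    ((trivializationAt F V x').linearEquivAt ℂ y hy')
  have hG : ∀ v, G (coordMap F V x y v) = coordMap F V x' y v := by
    intro v
    have h1 : coordMap F V x y v = (trivializationAt F V x).linearEquivAt ℂ y hy v := by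
      rw [coordMap, Trivialization.coe_linearMapAt_of_mem _ hy]; rfl
    have h2 : coordMap F V x' y v = (trivializationAt F V x').linearEquivAt ℂ y hy' v := by
      rw [coordMap, Trivialization.coe_linearMapAt_of_mem _ hy']; rfl
    rw [h1, h2]
    exact congrArg ((trivializationAt F V x').linearEquivAt ℂ y hy')
      (((trivializationAt F V x).linearEquivAt ℂ y hy).symm_apply_apply v)
  refine ⟨LinearMap.det (G : F →ₗ[ℂ] F), G.isUnit_det'.ne_zero, fun σ => ?_⟩
  have : detCoord F V x' y = LinearMap.det (G : F →ₗ[ℂ] F) • detCoord F V x y := by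
    refine exteriorPower.linearMap_ext (AlternatingMap.ext fun v => ?_)
    simp only [LinearMap.compAlternatingMap_apply, LinearMap.smul_apply, detCoord_ιMulti]
    rw [smul_eq_mul, ← Module.Basis.det_comp]
    congr 1
    funext i
    exact (hG (v i)).symm
  rw [this, LinearMap.smul_apply, smul_eq_mul]

theorem sectionOrder_eq (σ : ∀ y, DetFiber F V y) (x : C) :
    sectionOrder F σ x = ordAt (fun y => detCoord F V x y (σ y)) x := rfl

theorem IsRationalSection.merAt {σ : ∀ y, DetFiber F V y} (hσ : IsRationalSection F σ) (x : C) :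
    MerAt (fun y => detCoord F V x y (σ y)) x := hσ.meromorphic x

variable [IsManifold 𝓘(ℂ) ω C] [T2Space C] [CompactSpace C] [ConnectedSpace C]

/-- No finiteness of `g` is required: if its support is infinite then so is that of `h`, and both
sums take the default value 0. -/
theorem finsum_eq_of_sub_eq_zero {f g h : C → ℤ} (hf : f.support.Finite)
    (h0 : ∑ᶠ x, f x = 0) (hfg : ∀ x, h x = f x + g x) : ∑ᶠ x, h x = ∑ᶠ x, g x := by
  by_cases hg : g.support.Finite
  · rw [finsum_congr hfg, finsum_add_distrib hf hg, h0, zero_add]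
  · have hh : ¬ h.support.Finite := fun hh => hg ((hf.union hh).subset fun x hx => by
      by_contra hn
      simp only [mem_union, Function.mem_support, not_or, not_not] at hn
      have := hfg x
      rw [hn.1, hn.2, zero_add] at this
      exact hx this.symm)
    rw [finsum_of_infinite_support hg, finsum_of_infinite_support hh]

/-- The quotient of the two sections is a global meromorphic function, whose orders sum to zero. -/
theorem divisorDegree_eq {σ σ' : ∀ y, DetFiber F V y} (hσ : IsRationalSection F σ)
    (hσ' : IsRationalSection F σ') : divisorDegree F σ = divisorDegree F σ' := by
  set f : C → ℂ := fun y => detCoord F V y y (σ y) / detCoord F V y y (σ' y) with hf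
  have hloc : ∀ x, ∀ᶠ y in 𝓝 x, detCoord F V x y (σ y) / detCoord F V x y (σ' y) = f y := by
    intro x
    filter_upwards [eventually_mem_baseSet (F := F) (V := V) x] with y hy
    obtain ⟨d, hd, h⟩ := exists_detCoord_eq_mul hy
      (FiberBundle.mem_baseSet_trivializationAt' (F := F) (E := V) y)
    rw [hf]
    simp only
    rw [h, h, mul_div_mul_left _ _ hd]
  have hmer : ∀ x, MerAt f x := fun x =>
    ((hσ.merAt x).div (hσ'.merAt x)).congr ((hloc x).filter_mono nhdsWithin_le_nhds)
  have hord : ∀ x, ordAt f x + sectionOrder F σ' x = sectionOrder F σ x := fun x => by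
    rw [← ordAt_congr ((hloc x).filter_mono nhdsWithin_le_nhds)]
    exact ordAt_div (hσ.merAt x) (hσ'.merAt x) (hσ'.order_ne_top x)
  have hne : ∀ x, ordAt f x ≠ ⊤ := fun x h => by
    have := hord x
    rw [h, top_add] at this
    exact hσ.order_ne_top x this.symm
  refine finsum_eq_of_sub_eq_zero (finite_ordAt_ne_zero hmer hne) (finsum_ordAt_eq_zero hmer hne)
    fun x => ?_
  rw [← hord x, WithTop.untop₀_add (hne x) (hσ'.order_ne_top x)]

theorem degree_eq_divisorDegree {σ : ∀ y, DetFiber F V y} (hσ : IsRationalSection F σ) :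
    degree F V = divisorDegree F σ := by
  have h : ∃ σ : ∀ y, DetFiber F V y, IsRationalSection F σ := ⟨σ, hσ⟩
  rw [degree, dif_pos h]
  exact divisorDegree_eq h.choose_spec hσ

end Degree

/-! ### Determinants in the chosen basis of the model fibre -/

section DetFormula

/-- `Module.finBasis` is an arbitrary basis, so its determinant is the standard one only up to a
nonzero factor, which does not affect orders. -/
theorem exists_finBasis_det_eq_two : ∃ κ : ℂ, κ ≠ 0 ∧ ∀ v w : Fin 2 → ℂ,
    (Module.finBasis ℂ (Fin 2 → ℂ)).det (fun i => if i.val = 0 then v else w) =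
      κ * (v 0 * w 1 - v 1 * w 0) := by
  have hfr : Module.finrank ℂ (Fin 2 → ℂ) = 2 := by simp
  set b := (Module.finBasis ℂ (Fin 2 → ℂ)).reindex (finCongr hfr)
  refine ⟨b.det (Pi.basisFun ℂ (Fin 2)), (b.isUnit_det _).ne_zero, fun v w => ?_⟩
  have h1 : (Module.finBasis ℂ (Fin 2 → ℂ)).det (fun i => if i.val = 0 then v else w) =
      b.det ![v, w] := by
    rw [Module.Basis.det_reindex]
    congr 1
    funext i
    obtain ⟨i, hi⟩ := i
    have hi2 : i < 2 := hfr ▸ hi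
    interval_cases i <;> rfl
  have h2 := DFunLike.congr_fun (AlternatingMap.eq_smul_basis_det (Pi.basisFun ℂ (Fin 2)) b.det)
    ![v, w]
  rw [h1, h2, AlternatingMap.smul_apply, smul_eq_mul, Pi.basisFun_det_apply, Matrix.det_fin_two]
  congr 1

theorem exists_finBasis_det_eq_one : ∃ κ : ℂ, κ ≠ 0 ∧ ∀ v : Fin 1 → ℂ,
    (Module.finBasis ℂ (Fin 1 → ℂ)).det (fun _ => v) = κ * v 0 := by
  have hfr : Module.finrank ℂ (Fin 1 → ℂ) = 1 := by simp
  set b := (Module.finBasis ℂ (Fin 1 → ℂ)).reindex (finCongr hfr)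
  refine ⟨b.det (Pi.basisFun ℂ (Fin 1)), (b.isUnit_det _).ne_zero, fun v => ?_⟩
  have h1 : (Module.finBasis ℂ (Fin 1 → ℂ)).det (fun _ => v) = b.det (fun _ => v) := by
    rw [Module.Basis.det_reindex]
    rfl
  have h2 := DFunLike.congr_fun (AlternatingMap.eq_smul_basis_det (Pi.basisFun ℂ (Fin 1)) b.det)
    (fun _ => v)
  rw [h1, h2, AlternatingMap.smul_apply, smul_eq_mul, Pi.basisFun_det_apply, Matrix.det_fin_one]
  rfl

end DetFormula

/-! ### Stability of the extension -/

section Stability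

variable {C : Type*} [TopologicalSpace C] [T2Space C] [CompactSpace C] [ConnectedSpace C]
  [ChartedSpace ℂ C] [IsManifold 𝓘(ℂ) ω C]

/-- A frame of `𝒪(p)` near `x`. -/
def frameSec (p x : C) : ∀ y, PointBundle p y :=
  open Classical in if x = p then genSec p else canSec p

theorem holSecAt_frameSec (p x : C) : HolSecAt ℂ (frameSec p x) x := by
  by_cases hx : x = p
  · subst hx; simpa [frameSec] using holSecAt_genSec x
  · simpa [frameSec, hx] using holSecAt_canSec p x

theorem frameSec_ne_zero (p x : C) : frameSec p x x ≠ 0 := by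
  by_cases hx : x = p
  · subst hx; simpa [frameSec] using genSec_self_ne_zero x
  · simpa [frameSec, hx] using canSec_ne_zero hx

/-- The function `fibVal (frameSec p x)` and its order. -/
theorem fibVal_frameSec (p x : C) : MerAt (fun y => fibVal (frameSec p x y)) x ∧
    ordAt (fun y => fibVal (frameSec p x y)) x =
      ((open Classical in if x = p then (-1 : ℤ) else 0 : ℤ) : WithTop ℤ) := by
  by_cases hx : x = p
  · subst hx
    have h : (fun y => (localEq x true y)⁻¹) =ᶠ[𝓝[≠] x] fun y => fibVal (frameSec x x y) := by
      filter_upwards [self_mem_nhdsWithin] with y hy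
      simp only [frameSec, if_true]
      rw [genSec, pointSec_of_ne _ _ hy]
      rfl
    refine ⟨(contMDiffAt_localEq (mem_chart_source ℂ x)).merAt.inv.congr h, ?_⟩
    rw [← ordAt_congr h, ordAt_inv, ordAt_localEq]
    simp only [if_true]
    rfl
  · have h : (fun _ => (1 : ℂ)) =ᶠ[𝓝[≠] x] fun y => fibVal (frameSec p x y) := by
      filter_upwards [nhdsWithin_le_nhds (isOpen_ne.mem_nhds hx)] with y hy
      simp only [frameSec, hx, if_false]
      rw [canSec, pointSec_of_ne _ _ hy]
      rfl
    refine ⟨(merAt_const 1 x).congr h, ?_⟩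
    rw [← ordAt_congr h, ordAt_const one_ne_zero]
    simp [hx]

theorem exists_canSec_eq_smul_frameSec (p x : C) : ∃ a : C → ℂ, ContMDiffAt 𝓘(ℂ) 𝓘(ℂ) ω a x ∧
    (∀ᶠ y in 𝓝 x, canSec p y = a y • frameSec p x y) ∧
    ordAt a x = ((open Classical in if x = p then (1 : ℤ) else 0 : ℤ) : WithTop ℤ) := by
  by_cases hx : x = p
  · subst hx
    refine ⟨localEq x true, contMDiffAt_localEq (mem_chart_source ℂ x), ?_, ?_⟩
    · simpa [frameSec] using canSec_eq_smul_genSec x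
    · rw [ordAt_localEq]
      simp
  · refine ⟨fun _ => 1, contMDiffAt_const, ?_, ?_⟩
    · simp [frameSec, hx]
    · rw [ordAt_const one_ne_zero]
      simp [hx]

section DegreeV

variable {V : C → Type*} [∀ x, AddCommGroup (V x)] [∀ x, Module ℂ (V x)]
  [TopologicalSpace (TotalSpace (Fin 2 → ℂ) V)] [∀ x, TopologicalSpace (V x)]
  [FiberBundle (Fin 2 → ℂ) V] [VectorBundle ℂ (Fin 2 → ℂ) V]

/-- An extension of `𝒪(p)` by `𝒪` has degree one. -/
theorem degree_extension {p : C} {ι : HolHom ℂ (Bundle.Trivial C ℂ) (Fin 2 → ℂ) V}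
    {q : HolHom (Fin 2 → ℂ) V ℂ (PointBundle p)}
    (hι : ∀ x, Function.Injective (ι.toFun x))
    (hexact : ∀ x, LinearMap.range (ι.toFun x) = LinearMap.ker (q.toFun x))
    (hq : ∀ x, Function.Surjective (q.toFun x)) : degree (Fin 2 → ℂ) V = 1 := by
  classical
  obtain ⟨κ, hκ, hdet⟩ := exists_finBasis_det_eq_two
  choose r hr using fun y => (q.toFun y).exists_rightInverse_of_surjective
    (LinearMap.range_eq_top.mpr (hq y))
  have hr' : ∀ y v, q.toFun y (r y v) = v := fun y v => LinearMap.congr_fun (hr y) v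
  -- The section `e ∧ s` of `det V`, where `s` lifts `canSec`. The lift is only pointwise, but
  -- changing it by a multiple of `e` does not change the wedge.
  set σ : ∀ y, DetFiber (Fin 2 → ℂ) V y := fun y => exteriorPower.ιMulti ℂ _
    (fun i => if i.val = 0 then unitSec ι y else r y (canSec p y)) with hσ
  set c : ∀ x y : C, V y → Fin 2 → ℂ := fun x y v => coordMap (Fin 2 → ℂ) V x y v
  have hcoord : ∀ x y, detCoord (Fin 2 → ℂ) V x y (σ y) =
      κ * (c x y (unitSec ι y) 0 * c x y (r y (canSec p y)) 1 -
        c x y (unitSec ι y) 1 * c x y (r y (canSec p y)) 0) := by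
    intro x y
    rw [hσ, detCoord_ιMulti, ← hdet]
    congr 1
    funext i
    split_ifs <;> rfl
  have key : ∀ x, MerAt (fun y => detCoord (Fin 2 → ℂ) V x y (σ y)) x ∧
      ordAt (fun y => detCoord (Fin 2 → ℂ) V x y (σ y)) x =
        ((if x = p then (1 : ℤ) else 0 : ℤ) : WithTop ℤ) := by
    intro x
    obtain ⟨a, ha, hca, horda⟩ := exists_canSec_eq_smul_frameSec p x
    obtain ⟨u, hu, hqu⟩ := q.exists_lift (x := x) (fun h => by
      obtain ⟨v, hv⟩ := hq x (frameSec p x x)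
      rw [h, LinearMap.zero_apply] at hv
      exact frameSec_ne_zero p x hv.symm) (holSecAt_frameSec p x)
    -- The same determinant with a holomorphic lift `u` of a frame of `𝒪(p)` in place of `s`. It is
    -- nonzero at `x` because `q e = 0` while `q u ≠ 0`. As `canSec = a • frame`, the section `σ`
    -- has the order of `a`: 1 at `p` and 0 elsewhere.
    set D : C → ℂ := fun y => κ * (c x y (unitSec ι y) 0 * c x y (u y) 1 -
        c x y (unitSec ι y) 1 * c x y (u y) 0) with hDdef
    have h1 := contMDiffAt_pi_space.mp (holSecAt_iff.mp (holSecAt_unitSec (ι := ι) x))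
    have h2 := contMDiffAt_pi_space.mp (holSecAt_iff.mp hu)
    have hD : ContMDiffAt 𝓘(ℂ) 𝓘(ℂ) ω D x :=
      contMDiffAt_const.mul (((h1 0).mul (h2 1)).sub ((h1 1).mul (h2 0)))
    have hD0 : D x ≠ 0 := by
      intro h0
      have h3 := (mul_eq_zero.mp h0).resolve_left hκ
      have hqx : q.toFun x (u x) = frameSec p x x := hqu.self_of_nhds
      have hv : c x x (unitSec ι x) ≠ 0 := fun h =>
        unitSec_ne_zero hι x (coordMap_self_injective (F := Fin 2 → ℂ) x (by rw [map_zero]; exact h))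
      -- A vanishing 2×2 determinant with nonzero first vector makes the second vector proportional
      -- to it.
      have : ∃ t : ℂ, c x x (u x) = t • c x x (unitSec ι x) := by
        by_cases h4 : c x x (unitSec ι x) 0 = 0
        · have h5 : c x x (unitSec ι x) 1 ≠ 0 := fun h5 => hv (by
            ext i; fin_cases i
            · exact h4
            · exact h5)
          refine ⟨c x x (u x) 1 / c x x (unitSec ι x) 1, ?_⟩
          rw [h4, zero_mul, zero_sub, neg_eq_zero, mul_eq_zero, or_iff_right h5] at h3
          ext i; fin_cases i
          · simp [h3, h4]
          · simp [h5]
        · refine ⟨c x x (u x) 0 / c x x (unitSec ι x) 0, ?_⟩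
          ext i; fin_cases i
          · simp [h4]
          · simp only [Fin.mk_one, Pi.smul_apply, smul_eq_mul]
            field_simp
            linear_combination h3
      obtain ⟨t, ht⟩ := this
      have h6 : u x = t • unitSec ι x :=
        coordMap_self_injective (F := Fin 2 → ℂ) x (by rw [map_smul]; exact ht)
      rw [h6, map_smul, apply_unitSec hexact, smul_zero] at hqx
      exact frameSec_ne_zero p x hqx.symm
    have hev : (fun y => a y * D y) =ᶠ[𝓝[≠] x] fun y => detCoord (Fin 2 → ℂ) V x y (σ y) := by
      filter_upwards [nhdsWithin_le_nhds hca, nhdsWithin_le_nhds hqu] with y h3 h4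
      obtain ⟨t, ht⟩ := exists_eq_smul_unitSec hexact (v := r y (canSec p y) - a y • u y)
        (by rw [map_sub, hr', map_smul, h4, h3, sub_self])
      have h5 : r y (canSec p y) = a y • u y + t • unitSec ι y := by
        rw [← ht]; abel
      rw [hcoord, h5]
      have h6 : ∀ i, c x y (a y • u y + t • unitSec ι y) i =
          a y * c x y (u y) i + t * c x y (unitSec ι y) i := fun i => by
        simp only [c, map_add, map_smul]
        rfl
      rw [h6, h6, hDdef]
      ring
    refine ⟨(ha.merAt.mul hD.merAt).congr hev, ?_⟩
    rw [← ordAt_congr hev, ordAt_mul ha.merAt hD.merAt, horda, hD.ordAt_eq_zero_iff.mpr hD0,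
      add_zero]
  have hrat : IsRationalSection (Fin 2 → ℂ) σ := ⟨fun x => (key x).1, fun x => by
    rw [sectionOrder_eq, (key x).2]
    exact WithTop.coe_ne_top⟩
  rw [degree_eq_divisorDegree hrat, divisorDegree]
  have : ∀ x, (sectionOrder (Fin 2 → ℂ) σ x).untop₀ = if x = p then (1 : ℤ) else 0 := fun x => by
    rw [sectionOrder_eq, (key x).2, WithTop.untop₀_coe]
  rw [finsum_congr this, finsum_eq_single _ p (fun x hx => if_neg hx), if_pos rfl]

end DegreeV

end Stability

/-! ### Line sub-bundles of the extension -/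

section LineFrames

variable {C : Type*} [TopologicalSpace C] [ChartedSpace ℂ C]
  {L : C → Type*} [∀ x, AddCommGroup (L x)] [∀ x, Module ℂ (L x)]
  [TopologicalSpace (TotalSpace (Fin 1 → ℂ) L)] [∀ x, TopologicalSpace (L x)]
  [FiberBundle (Fin 1 → ℂ) L] [VectorBundle ℂ (Fin 1 → ℂ) L]

variable (L) in
/-- The local frame at `x` of a bundle of rank one. -/
def lineFrame (x y : C) : L y := constSec (Fin 1 → ℂ) L x (fun _ => 1) y

/-- The coefficient with respect to the local frame at `x`. -/
def lineCoef (x y : C) (v : L y) : ℂ := coordMap (Fin 1 → ℂ) L x y v 0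

theorem eq_lineCoef_smul {x y : C} (hy : y ∈ (trivializationAt (Fin 1 → ℂ) L x).baseSet)
    (v : L y) : v = lineCoef x y v • lineFrame L x y := by
  refine coordMap_injective hy ?_
  rw [map_smul, lineFrame, coordMap_constSec hy]
  ext i
  rw [Subsingleton.elim i 0]
  simp [lineCoef]

theorem lineFrame_ne_zero {x y : C} (hy : y ∈ (trivializationAt (Fin 1 → ℂ) L x).baseSet) :
    lineFrame L x y ≠ 0 := by
  intro h
  have h1 := coordMap_constSec (F := Fin 1 → ℂ) (V := L) hy (fun _ => 1)
  rw [← lineFrame, h, map_zero] at h1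
  exact zero_ne_one (congrFun h1 0)

variable [IsManifold 𝓘(ℂ) ω C]

/-- A rational section of `det L`, for `L` of rank one, is a meromorphic section of `L`. -/
theorem IsRationalSection.exists_section {σ : ∀ y, DetFiber (Fin 1 → ℂ) L y}
    (hσ : IsRationalSection (Fin 1 → ℂ) σ) : ∃ l : ∀ y, L y, ∀ x,
      MerAt (fun y => lineCoef x y (l y)) x ∧
      ordAt (fun y => lineCoef x y (l y)) x = sectionOrder (Fin 1 → ℂ) σ x := by
  obtain ⟨κ, hκ, hdet⟩ := exists_finBasis_det_eq_one
  -- In rank one `det L` is `L` up to the factor `κ`. Each value is defined in the trivialization at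
  -- its own point; `hl` shows that the formula persists in every other trivialization.
  set l : ∀ y, L y := fun y =>
    constSec (Fin 1 → ℂ) L y (fun _ => κ⁻¹ * detCoord (Fin 1 → ℂ) L y y (σ y)) y
  have hl : ∀ x y, y ∈ (trivializationAt (Fin 1 → ℂ) L x).baseSet →
      lineCoef x y (l y) = κ⁻¹ * detCoord (Fin 1 → ℂ) L x y (σ y) := by
    intro x y hy
    have hyy := FiberBundle.mem_baseSet_trivializationAt' (F := Fin 1 → ℂ) (E := L) y
    set τ : DetFiber (Fin 1 → ℂ) L y := exteriorPower.ιMulti ℂ _ (fun _ => l y) with hτ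
    have h1 : ∀ x', detCoord (Fin 1 → ℂ) L x' y τ = κ * lineCoef x' y (l y) := fun x' => by
      rw [hτ, detCoord_ιMulti]
      exact hdet _
    have h2 : detCoord (Fin 1 → ℂ) L y y τ = detCoord (Fin 1 → ℂ) L y y (σ y) := by
      rw [h1, lineCoef, coordMap_constSec hyy, mul_inv_cancel_left₀ hκ]
    obtain ⟨d, -, hd⟩ := exists_detCoord_eq_mul hyy hy
    rw [hd, ← h2, ← hd, h1, inv_mul_cancel_left₀ hκ]
  refine ⟨l, fun x => ?_⟩
  have hev : (fun y => κ⁻¹ * detCoord (Fin 1 → ℂ) L x y (σ y)) =ᶠ[𝓝[≠] x]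
      fun y => lineCoef x y (l y) := by
    filter_upwards [nhdsWithin_le_nhds (eventually_mem_baseSet (F := Fin 1 → ℂ) (V := L) x)]
      with y hy
    exact (hl x y hy).symm
  refine ⟨((merAt_const _ x).mul (hσ.merAt x)).congr hev, ?_⟩
  rw [← ordAt_congr hev, ordAt_mul (merAt_const _ x) (hσ.merAt x), ordAt_const (inv_ne_zero hκ),
    zero_add, sectionOrder_eq]

end LineFrames

/-! ### Degrees of line sub-bundles of the extension -/

section Stability

variable {C : Type*} [TopologicalSpace C] [T2Space C] [CompactSpace C] [ConnectedSpace C]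
  [ChartedSpace ℂ C] [IsManifold 𝓘(ℂ) ω C]
  {F : Type*} [NormedAddCommGroup F] [NormedSpace ℂ F]
  {V : C → Type*} [∀ x, AddCommGroup (V x)] [∀ x, Module ℂ (V x)]
  [TopologicalSpace (TotalSpace F V)] [∀ x, TopologicalSpace (V x)] [FiberBundle F V]
  [VectorBundle ℂ F V]
  {p : C} {ι : HolHom ℂ (Bundle.Trivial C ℂ) F V} {q : HolHom F V ℂ (PointBundle p)}
  {L : C → Type*} [∀ x, AddCommGroup (L x)] [∀ x, Module ℂ (L x)]
  [TopologicalSpace (TotalSpace (Fin 1 → ℂ) L)] [∀ x, TopologicalSpace (L x)]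
  [FiberBundle (Fin 1 → ℂ) L] [VectorBundle ℂ (Fin 1 → ℂ) L]
  {j : HolHom (Fin 1 → ℂ) L F V}

theorem holSecAt_lineFrame (x : C) : HolSecAt (Fin 1 → ℂ) (lineFrame L x) x :=
  holSecAt_constSec x _

/-- A line sub-bundle contained in the trivial sub-bundle has degree zero. -/
theorem divisorDegree_eq_zero_of_comp_eq_zero
    (hι : ∀ x, Function.Injective (ι.toFun x))
    (hexact : ∀ x, LinearMap.range (ι.toFun x) = LinearMap.ker (q.toFun x))
    (hj : ∀ x, Function.Injective (j.toFun x))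
    (hqj : ∀ y v, q.toFun y (j.toFun y v) = 0) {σ : ∀ y, DetFiber (Fin 1 → ℂ) L y}
    (hσ : IsRationalSection (Fin 1 → ℂ) σ) : divisorDegree (Fin 1 → ℂ) σ = 0 := by
  obtain ⟨l, hl⟩ := hσ.exists_section
  choose f hf using fun y => exists_eq_smul_unitSec hexact (hqj y (l y))
  have key : ∀ x, MerAt f x ∧ ordAt f x = sectionOrder (Fin 1 → ℂ) σ x := by
    intro x
    -- `j` maps the local frame of `L` to `h e` with `h x ≠ 0`, by fibrewise injectivity. So `f`,
    -- defined by `j l = f e`, has the same order at `x` as `σ`.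
    choose h hh using fun y => exists_eq_smul_unitSec hexact (hqj y (lineFrame L x y))
    have hhol : ContMDiffAt 𝓘(ℂ) 𝓘(ℂ) ω h x := contMDiffAt_of_smul ((holSecAt_lineFrame x).map j)
      (holSecAt_unitSec x) (unitSec_ne_zero hι x) (Eventually.of_forall hh)
    have h0 : h x ≠ 0 := by
      intro h0
      have h1 := hh x
      rw [h0, zero_smul, ← map_zero (j.toFun x)] at h1
      exact lineFrame_ne_zero (FiberBundle.mem_baseSet_trivializationAt' x) (hj x h1)
    have hev : (fun y => lineCoef x y (l y) * h y) =ᶠ[𝓝[≠] x] f := by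
      filter_upwards [nhdsWithin_le_nhds (eventually_mem_baseSet (F := Fin 1 → ℂ) (V := L) x)]
        with y hy
      refine smul_left_injective ℂ (unitSec_ne_zero hι y) ?_
      change (lineCoef x y (l y) * h y) • unitSec ι y = f y • unitSec ι y
      rw [← hf, mul_smul, ← hh, ← map_smul, ← eq_lineCoef_smul hy]
    refine ⟨((hl x).1.mul hhol.merAt).congr hev, ?_⟩
    rw [← ordAt_congr hev, ordAt_mul (hl x).1 hhol.merAt, (hl x).2,
      hhol.ordAt_eq_zero_iff.mpr h0, add_zero]
  have h0 := finsum_ordAt_eq_zero (f := f) (fun x => (key x).1)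
    (fun x => (key x).2 ▸ hσ.order_ne_top x)
  rw [divisorDegree, ← h0]
  exact finsum_congr fun x => by rw [(key x).2]

/-- A line sub-bundle mapped isomorphically to `𝒪(p)` splits the extension. -/
theorem exists_splitting_of_comp_ne_zero
    (h : ∀ x, q.toFun x (j.toFun x (lineFrame L x x)) ≠ 0) :
    ∃ s : HolHom ℂ (PointBundle p) F V, ∀ x, q.toFun x ∘ₗ s.toFun x = LinearMap.id := by
  set c : C → ℂ := fun y => fibVal (q.toFun y (j.toFun y (lineFrame L y y))) with hc
  have hc0 : ∀ y, c y ≠ 0 := h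
  -- `T` is `j` composed with the fibrewise inverse of `q ∘ j`. It does not depend on the frames of
  -- `L`, and it maps the frame `q (j (lineFrame L x))` of `𝒪(p)` to the holomorphic section `j
  -- (lineFrame L x)`.
  set T : ∀ y, PointBundle p y →ₗ[ℂ] V y := fun y =>
    (LinearMap.toSpanSingleton ℂ (V y) ((c y)⁻¹ • j.toFun y (lineFrame L y y))) ∘ₗ fibVal with hT
  have hTa : ∀ y v, T y v = fibVal v • (c y)⁻¹ • j.toFun y (lineFrame L y y) := fun y v => rfl
  refine ⟨HolHom.ofLine T fun x => ⟨fun y => q.toFun y (j.toFun y (lineFrame L x y)),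
    ((holSecAt_lineFrame x).map j).map q, h x, ((holSecAt_lineFrame x).map j).congr
      (Eventually.of_forall fun y => ?_)⟩, fun x => LinearMap.ext fun v => ?_⟩
  · have h1 := eq_lineCoef_smul (FiberBundle.mem_baseSet_trivializationAt' (F := Fin 1 → ℂ) y)
      (lineFrame L x y)
    have h2 : fibVal (q.toFun y (j.toFun y (lineFrame L x y))) =
        lineCoef y y (lineFrame L x y) * c y := by
      conv_lhs => rw [h1, map_smul, map_smul, map_smul, smul_eq_mul]
    beta_reduce
    rw [hTa, h2, smul_smul, mul_assoc, mul_inv_cancel₀ (hc0 y), mul_one, ← map_smul, ← h1]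
  · change q.toFun x (T x v) = v
    rw [hTa, map_smul, map_smul]
    change fibVal v * ((c x)⁻¹ * c x) = v
    rw [inv_mul_cancel₀ (hc0 x), mul_one]
    rfl

/-- In a nontrivial extension of `𝒪(p)` by `𝒪` every line sub-bundle has degree at most zero. -/
theorem divisorDegree_le_zero
    (hι : ∀ x, Function.Injective (ι.toFun x))
    (hexact : ∀ x, LinearMap.range (ι.toFun x) = LinearMap.ker (q.toFun x))
    (hnontrivial : ¬ ∃ s : HolHom ℂ (PointBundle p) F V,
      ∀ x, q.toFun x ∘ₗ s.toFun x = LinearMap.id)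
    (hj : ∀ x, Function.Injective (j.toFun x)) {σ : ∀ y, DetFiber (Fin 1 → ℂ) L y}
    (hσ : IsRationalSection (Fin 1 → ℂ) σ) : divisorDegree (Fin 1 → ℂ) σ ≤ 0 := by
  classical
  by_cases hqj : ∀ y v, q.toFun y (j.toFun y v) = 0
  · exact (divisorDegree_eq_zero_of_comp_eq_zero hι hexact hj hqj hσ).le
  push Not at hqj
  obtain ⟨y₀, v₀, hv₀⟩ := hqj
  by_contra! hpos
  obtain ⟨l, hl⟩ := hσ.exists_section
  -- `a x` expresses `q ∘ j` in local frames at `x`; its order at `x` is the order of vanishing of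
  -- `q ∘ j` there.
  choose a ha hqa using fun x => exists_smul_eq_of_line
    (((holSecAt_lineFrame (L := L) x).map j).map q) (holSecAt_frameSec p x) (frameSec_ne_zero p x)
  -- As a meromorphic function, `q (j l)` has divisor `div σ + div (q ∘ j) - p`.
  set f : C → ℂ := fun y => fibVal (q.toFun y (j.toFun y (l y))) with hf
  have key : ∀ x, MerAt f x ∧ ordAt f x = sectionOrder (Fin 1 → ℂ) σ x + (ordAt (a x) x +
      ((if x = p then (-1 : ℤ) else 0 : ℤ) : WithTop ℤ)) := by
    intro x
    obtain ⟨h1, h2⟩ := fibVal_frameSec p x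
    have hev : (fun y => lineCoef x y (l y) * (a x y * fibVal (frameSec p x y))) =ᶠ[𝓝[≠] x] f := by
      filter_upwards [nhdsWithin_le_nhds (eventually_mem_baseSet (F := Fin 1 → ℂ) (V := L) x),
        nhdsWithin_le_nhds (hqa x)] with y hy hy'
      rw [hf]
      simp only
      conv_rhs => rw [eq_lineCoef_smul hy (l y), map_smul, map_smul, hy', map_smul, map_smul]
      rfl
    refine ⟨((hl x).1.mul ((ha x).merAt.mul h1)).congr hev, ?_⟩
    rw [← ordAt_congr hev, ordAt_mul (hl x).1 ((ha x).merAt.mul h1), (hl x).2,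
      ordAt_mul (ha x).merAt h1, h2]
  have hzero : ∀ x, a x x = 0 ↔ q.toFun x (j.toFun x (lineFrame L x x)) = 0 := fun x => by
    rw [(hqa x).self_of_nhds, smul_eq_zero, or_iff_left (frameSec_ne_zero p x)]
  have hy₀ : a y₀ y₀ ≠ 0 := fun h0 => hv₀ (by
    rw [eq_lineCoef_smul (FiberBundle.mem_baseSet_trivializationAt' y₀) v₀, map_smul, map_smul,
      (hzero y₀).mp h0, smul_zero])
  have hftop : ∀ x, ordAt f x ≠ ⊤ := ordAt_ne_top_of_exists (fun x => (key x).1) (x₀ := y₀) (by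
    rw [(key y₀).2, (ha y₀).ordAt_eq_zero_iff.mpr hy₀, zero_add]
    exact WithTop.add_ne_top.mpr ⟨hσ.order_ne_top y₀, WithTop.coe_ne_top⟩)
  have hatop : ∀ x, ordAt (a x) x ≠ ⊤ := fun x h => hftop x (by
    rw [(key x).2, h, top_add, add_top])
  set n : C → ℤ := fun x => (ordAt (a x) x).untop₀ with hn
  set s : C → ℤ := fun x => (sectionOrder (Fin 1 → ℂ) σ x).untop₀ with hs
  have hn0 : ∀ x, 0 ≤ n x := fun x => by
    have := (ha x).ordAt_nonneg
    rwa [← WithTop.coe_untop₀_of_ne_top (hatop x), ← WithTop.coe_zero, WithTop.coe_le_coe] at this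
  have hsum : ∀ x, (ordAt f x).untop₀ = s x + (n x + if x = p then (-1 : ℤ) else 0) := fun x => by
    rw [(key x).2, WithTop.untop₀_add (hσ.order_ne_top x)
      (WithTop.add_ne_top.mpr ⟨hatop x, WithTop.coe_ne_top⟩),
      WithTop.untop₀_add (hatop x) WithTop.coe_ne_top, WithTop.untop₀_coe]
  have hffin := finite_ordAt_ne_zero (fun x => (key x).1) hftop
  -- An infinite support would make the `finsum` zero, against the assumed positive degree.
  have hsfin : s.support.Finite := by
    by_contra h
    rw [divisorDegree, finsum_of_infinite_support h] at hpos
    exact lt_irrefl _ hpos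
  have hδfin : (Function.support fun x => if x = p then (-1 : ℤ) else 0).Finite :=
    (finite_singleton p).subset fun x hx => by
      by_contra h
      exact hx (if_neg h)
  have hnfin : n.support.Finite := ((hffin.union hsfin).union hδfin).subset fun x hx => by
    by_contra h
    simp only [mem_union, Function.mem_support, not_or, not_not] at h
    have := hsum x
    rw [h.1.1, h.1.2, h.2] at this
    exact hx (by linarith)
  have hδsum : ∑ᶠ x, (if x = p then (-1 : ℤ) else 0) = -1 := by
    rw [finsum_eq_single _ p (fun x hx => if_neg hx), if_pos rfl]
  have htot := finsum_ordAt_eq_zero (fun x => (key x).1) hftop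
  rw [finsum_congr hsum, finsum_add_distrib hsfin ((hnfin.union hδfin).subset
    (Function.support_add _ _)), finsum_add_distrib hnfin hδfin, hδsum] at htot
  have hpos' : 0 < ∑ᶠ x, s x := hpos
  -- The total is `0 = ∑ s + ∑ n - 1` with `∑ s ≥ 1` and `n ≥ 0`. So every `n x` is 0 and `q ∘ j`
  -- vanishes nowhere.
  refine hnontrivial (exists_splitting_of_comp_ne_zero (j := j) fun x h0 => ?_)
  have h1 : n x ≤ ∑ᶠ x, n x := single_le_finsum x hnfin hn0
  have h2 : n x = 0 := le_antisymm (by linarith) (hn0 x)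
  have h3 : ordAt (a x) x = 0 := by
    rw [← WithTop.coe_untop₀_of_ne_top (hatop x)]
    exact congrArg _ h2
  exact (ha x).ordAt_eq_zero_iff.mp h3 ((hzero x).mpr h0)

end Stability

/-! ### The slope inequality -/

section Stable

universe u w

variable {C : Type u} [TopologicalSpace C] [T2Space C] [CompactSpace C] [ConnectedSpace C]
  [ChartedSpace ℂ C] [IsManifold 𝓘(ℂ) ω C]
  {V : C → Type w} [∀ x, AddCommGroup (V x)] [∀ x, Module ℂ (V x)]
  [TopologicalSpace (TotalSpace (Fin 2 → ℂ) V)] [∀ x, TopologicalSpace (V x)]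
  [FiberBundle (Fin 2 → ℂ) V] [VectorBundle ℂ (Fin 2 → ℂ) V]
  {p : C} {ι : HolHom ℂ (Bundle.Trivial C ℂ) (Fin 2 → ℂ) V}
  {q : HolHom (Fin 2 → ℂ) V ℂ (PointBundle p)}

theorem isStable_of_nontrivial_extension
    (hι : ∀ x, Function.Injective (ι.toFun x))
    (hexact : ∀ x, LinearMap.range (ι.toFun x) = LinearMap.ker (q.toFun x))
    (hq : ∀ x, Function.Surjective (q.toFun x))
    (hnontrivial : ¬ ∃ s : HolHom ℂ (PointBundle p) (Fin 2 → ℂ) V,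
      ∀ x, q.toFun x ∘ₗ s.toFun x = LinearMap.id) : IsStable (Fin 2 → ℂ) V := by
  intro k hk hk2 L _ _ _ _ _ _ _ j hj
  rw [Module.finrank_fin_fun] at hk2
  obtain rfl : k = 1 := by omega
  -- If `L` had no rational section its degree would be 0 by convention, so existence of such a
  -- section is not needed.
  have hdeg : degree (Fin 1 → ℂ) L ≤ 0 := by
    by_cases h : ∃ σ : ∀ y, DetFiber (Fin 1 → ℂ) L y, IsRationalSection (Fin 1 → ℂ) σ
    · obtain ⟨σ, hσ⟩ := h
      rw [degree_eq_divisorDegree hσ]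
      exact divisorDegree_le_zero hι hexact hnontrivial hj hσ
    · rw [degree, dif_neg h]
  rw [slope, slope, degree_extension hι hexact hq, Module.finrank_fin_fun, Module.finrank_fin_fun]
  have : ((degree (Fin 1 → ℂ) L : ℤ) : ℚ) ≤ 0 := by exact_mod_cast hdeg
  norm_num
  linarith

end Stable

/-! ### Vector fields in charts -/

section Fields

variable {E : Type*} [NormedAddCommGroup E] [NormedSpace ℂ E]
  {M : Type*} [TopologicalSpace M] [ChartedSpace E M]

/-- The derivative of a map to the model space as a linear endomorphism of the model space. -/
def chartDeriv (f : M → E) (s : M) : E →L[ℂ] E := mfderiv 𝓘(ℂ, E) 𝓘(ℂ, E) f s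

theorem chartDeriv_comp {f : M → E} {τ : E → E} {s : M} (hτ : DifferentiableAt ℂ τ (f s))
    (hf : MDifferentiableAt 𝓘(ℂ, E) 𝓘(ℂ, E) f s) :
    chartDeriv (τ ∘ f) s = (fderiv ℂ τ (f s)).comp (chartDeriv f s) := by
  have h := mfderiv_comp s hτ.mdifferentiableAt hf
  rw [mfderiv_eq_fderiv] at h
  exact h

theorem chartDeriv_congr {f g : M → E} {s : M} (h : f =ᶠ[𝓝 s] g) :
    chartDeriv f s = chartDeriv g s := h.mfderiv_eq

variable [IsManifold 𝓘(ℂ, E) ω M]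

theorem mdifferentiableAt_of_mem_atlas {ψ : OpenPartialHomeomorph M E} (hψ : ψ ∈ atlas E M)
    {s : M} (hs : s ∈ ψ.source) : MDifferentiableAt 𝓘(ℂ, E) 𝓘(ℂ, E) ψ s :=
  ((contMDiffOn_of_mem_maximalAtlas
      (IsManifold.subset_maximalAtlas (n := ω) (I := 𝓘(ℂ, E)) hψ)).contMDiffAt
      (ψ.open_source.mem_nhds hs)).mdifferentiableAt (by simp)

theorem mdifferentiableAt_symm_of_mem_atlas {ψ : OpenPartialHomeomorph M E} (hψ : ψ ∈ atlas E M)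
    {a : E} (ha : a ∈ ψ.target) : MDifferentiableAt 𝓘(ℂ, E) 𝓘(ℂ, E) ψ.symm a :=
  ((contMDiffOn_symm_of_mem_maximalAtlas
      (IsManifold.subset_maximalAtlas (n := ω) (I := 𝓘(ℂ, E)) hψ)).contMDiffAt
      (ψ.open_target.mem_nhds ha)).mdifferentiableAt (by simp)

theorem chartDeriv_injective {ψ : OpenPartialHomeomorph M E} (hψ : ψ ∈ atlas E M)
    {s : M} (hs : s ∈ ψ.source) : Function.Injective (chartDeriv ψ s) := by
  have h1 := mfderiv_comp s (mdifferentiableAt_symm_of_mem_atlas hψ (ψ.map_source hs))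
    (mdifferentiableAt_of_mem_atlas hψ hs)
  have h2 : ψ.symm ∘ ψ =ᶠ[𝓝 s] id := by
    filter_upwards [ψ.open_source.mem_nhds hs] with w hw
    exact ψ.left_inv hw
  rw [h2.mfderiv_eq, mfderiv_id] at h1
  intro v w hvw
  have h3 : ∀ v : TangentSpace 𝓘(ℂ, E) s, v = (mfderiv 𝓘(ℂ, E) 𝓘(ℂ, E) ψ.symm (ψ s))
      (mfderiv 𝓘(ℂ, E) 𝓘(ℂ, E) ψ s v) := fun v => DFunLike.congr_fun h1 v
  exact (h3 v).trans ((congrArg _ hvw).trans (h3 w).symm)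

/-- The value of a vector field as a vector of the model space. -/
def fieldVal (ξ : ContMDiffSection 𝓘(ℂ, E) E ω (fun s : M => TangentSpace 𝓘(ℂ, E) s)) (s : M) : E :=
  ξ s

/-- A vector field in a chart. -/
def fieldCoord (ξ : ContMDiffSection 𝓘(ℂ, E) E ω (fun s : M => TangentSpace 𝓘(ℂ, E) s))
    (ψ : OpenPartialHomeomorph M E) (a : E) : E :=
  chartDeriv ψ (ψ.symm a) (fieldVal ξ (ψ.symm a))

variable (ξ : ContMDiffSection 𝓘(ℂ, E) E ω (fun s : M => TangentSpace 𝓘(ℂ, E) s))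

theorem fieldCoord_eq_zero_iff {ψ : OpenPartialHomeomorph M E} (hψ : ψ ∈ atlas E M) {a : E}
    (ha : a ∈ ψ.target) : fieldCoord ξ ψ a = 0 ↔ ξ (ψ.symm a) = 0 := by
  rw [fieldCoord, map_eq_zero_iff _ (chartDeriv_injective hψ (ψ.map_target ha))]
  rfl

theorem fieldCoord_transition {ψ ψ' : OpenPartialHomeomorph M E} (hψ : ψ ∈ atlas E M)
    {a : E} (ha : a ∈ ψ.target) (ha' : ψ.symm a ∈ ψ'.source)
    {τ : E → E} (hτ : τ =ᶠ[𝓝 a] ψ' ∘ ψ.symm) (hd : DifferentiableAt ℂ τ a) :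
    fieldCoord ξ ψ' (τ a) = fderiv ℂ τ a (fieldCoord ξ ψ a) := by
  have hs : ψ.symm a ∈ ψ.source := ψ.map_target ha
  have h1 : (ψ' : M → E) =ᶠ[𝓝 (ψ.symm a)] τ ∘ ψ := by
    have h2 : ∀ᶠ s in 𝓝 (ψ.symm a), τ (ψ s) = ψ' (ψ.symm (ψ s)) := by
      have h3 := ψ.continuousAt hs
      rw [ContinuousAt, ψ.right_inv ha] at h3
      exact h3.eventually hτ
    filter_upwards [h2, ψ.open_source.mem_nhds hs] with s h3 h4
    rw [Function.comp_apply, h3, ψ.left_inv h4]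
  have h5 : ψ'.symm (τ a) = ψ.symm a := by
    rw [hτ.self_of_nhds, Function.comp_apply, ψ'.left_inv ha']
  rw [fieldCoord, h5, chartDeriv_congr h1, chartDeriv_comp (by rwa [ψ.right_inv ha])
    (mdifferentiableAt_of_mem_atlas hψ hs), ψ.right_inv ha]
  rfl

theorem contDiffOn_fieldCoord {ψ : OpenPartialHomeomorph M E} (hψ : ψ ∈ atlas E M) :
    ContDiffOn ℂ ω (fieldCoord ξ ψ) ψ.target := by
  have h1 : ContMDiffOn 𝓘(ℂ, E) 𝓘(ℂ, E) ω ψ ψ.source :=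
    contMDiffOn_of_mem_maximalAtlas
      (IsManifold.subset_maximalAtlas (n := ω) (I := 𝓘(ℂ, E)) hψ)
  have h2 := h1.contMDiffOn_tangentMapWithin (m := ω) (by simp) ψ.open_source.uniqueMDiffOn
  have h3 : ContMDiffOn 𝓘(ℂ, E) 𝓘(ℂ, E) ω ψ.symm ψ.target :=
    contMDiffOn_symm_of_mem_maximalAtlas
      (IsManifold.subset_maximalAtlas (n := ω) (I := 𝓘(ℂ, E)) hψ)
  have h4 := (h2.comp ξ.contMDiff.contMDiffOn (fun s hs => hs)).comp h3
    (fun a ha => ψ.map_target ha)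
  intro a ha
  have h5 := h4 a ha
  rw [Bundle.contMDiffWithinAt_totalSpace] at h5
  refine h5.2.contDiffWithinAt.congr_of_mem (fun b hb => ?_) ha
  have h6 := mfderivWithin_of_isOpen (I := 𝓘(ℂ, E)) (I' := 𝓘(ℂ, E)) (f := ψ) ψ.open_source
    (ψ.map_target hb)
  simp only [Function.comp_apply, tangentMapWithin, h6]
  exact (congrArg Prod.snd (trivializationAt_model_space_apply (I := 𝓘(ℂ, E)) (H := E)
    (⟨ψ (ψ.symm b), mfderiv 𝓘(ℂ, E) 𝓘(ℂ, E) ψ (ψ.symm b) (ξ (ψ.symm b))⟩ :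
      TangentBundle 𝓘(ℂ, E) E) _)).symm

end Fields

/-! ### Entire functions and quadratic polynomials -/

section Entire

/-- Liouville on `ℙ¹`: continuity of `g` at 0 gives `f` a limit at infinity, so the entire function
`f` is constant. -/
theorem eq_of_eq_comp_inv {f g : ℂ → ℂ} (hf : Differentiable ℂ f) (hg : Continuous g)
    (h : ∀ t, t ≠ 0 → f t = g t⁻¹) (t : ℂ) : f t = g 0 := by
  have h1 : Tendsto f (cocompact ℂ) (𝓝 (g 0)) := by
    rw [← Metric.cobounded_eq_cocompact]
    refine ((hg.tendsto 0).comp tendsto_inv₀_cobounded).congr' ?_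
    filter_upwards [Bornology.eventually_ne_cobounded 0] with t ht
    exact (h t ht).symm
  exact congrFun (hf.eq_const_of_tendsto_cocompact h1) t

theorem differentiable_dslope {f : ℂ → ℂ} (hf : Differentiable ℂ f) (c : ℂ) :
    Differentiable ℂ (dslope f c) := by
  have h := (Complex.differentiableOn_dslope (f := f) (s := univ) (c := c) univ_mem).mpr
    hf.differentiableOn
  exact differentiableOn_univ.mp h

theorem eq_add_mul_dslope (f : ℂ → ℂ) (t : ℂ) : f t = f 0 + t * dslope f 0 t := by
  have := sub_smul_dslope f 0 t
  rw [smul_eq_mul, sub_zero] at this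
  rw [this]; ring

/-- A vector field on the projective line is quadratic in the affine coordinate. -/
theorem exists_quadratic {f g : ℂ → ℂ} (hf : Differentiable ℂ f) (hg : Continuous g)
    (h : ∀ t, t ≠ 0 → f t = -t ^ 2 * g t⁻¹) :
    ∃ a b c : ℂ, ∀ t, f t = a + b * t + c * t ^ 2 := by
  set f₁ := dslope f 0
  have h1 : ∀ t, f t = f 0 + t * (f₁ 0 + t * dslope f₁ 0 t) := fun t => by
    rw [← eq_add_mul_dslope f₁, ← eq_add_mul_dslope f]
  -- In `f = f 0 + f₁ 0 t + t² h(t)` the remainder `h` is entire and, by the hypothesis, equals `-g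
  -- u - f 0 u² - f₁ 0 u` with `u = t⁻¹`. So it is the constant `-g 0`.
  have h2 := eq_of_eq_comp_inv (f := dslope f₁ 0) (g := fun u => -g u - f 0 * u ^ 2 - f₁ 0 * u)
    (differentiable_dslope (differentiable_dslope hf 0) 0) (by fun_prop) (fun t ht => by
      have h3 := h1 t
      rw [h t ht] at h3
      generalize g t⁻¹ = y at h3 ⊢
      field_simp
      linear_combination -h3)
  refine ⟨f 0, f₁ 0, -g 0, fun t => ?_⟩
  rw [h1 t, h2 t]
  ring

/-- At most one `t` is excluded, and continuity restores it; then evaluate at 0, 1 and -1. -/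
theorem eq_zero_of_quadratic_eq_zero {a b c α β : ℂ} (hαβ : ¬ (α = 0 ∧ β = 0))
    (h : ∀ t, α + β * t ≠ 0 → a + b * t + c * t ^ 2 = 0) : a = 0 ∧ b = 0 ∧ c = 0 := by
  obtain ⟨t₀, ht₀⟩ : ∃ t₀, ∀ t, t ≠ t₀ → α + β * t ≠ 0 := by
    by_cases hβ : β = 0
    · exact ⟨0, fun t _ => by simpa [hβ] using hαβ⟩
    · refine ⟨-α / β, fun t ht h0 => ht ?_⟩
      field_simp
      linear_combination h0
  have key : (fun t : ℂ => a + b * t + c * t ^ 2) = fun _ => 0 :=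
    Continuous.ext_on (dense_compl_singleton t₀) (by fun_prop) continuous_const
      fun t ht => h t (ht₀ t ht)
  have h0 : a + b * 0 + c * 0 ^ 2 = 0 := congrFun key 0
  have h1 : a + b * 1 + c * 1 ^ 2 = 0 := congrFun key 1
  have h2 : a + b * (-1) + c * (-1) ^ 2 = 0 := congrFun key (-1)
  have ha : a = 0 := by linear_combination h0
  exact ⟨ha, by linear_combination (h1 - h2) / 2, by linear_combination (h1 + h2) / 2 - ha⟩

end Entire

/-! ### Quadratic vector fields on `ℙ¹` as traceless 2×2 matrices -/

/-- The traceless endomorphism `N` of `ℂ²` with `v ∧ N v = a v₀² + b v₀ v₁ + c v₁²`. -/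
def quadEnd (a b c : ℂ) : (Fin 2 → ℂ) →ₗ[ℂ] (Fin 2 → ℂ) :=
  Matrix.toLin' !![-b / 2, -c; a, b / 2]

theorem quadEnd_apply_zero (a b c : ℂ) (w : Fin 2 → ℂ) :
    quadEnd a b c w 0 = -b / 2 * w 0 - c * w 1 := by
  simp [quadEnd, Matrix.mulVec, dotProduct, Fin.sum_univ_two]
  ring

theorem quadEnd_apply_one (a b c : ℂ) (w : Fin 2 → ℂ) :
    quadEnd a b c w 1 = a * w 0 + b / 2 * w 1 := by
  simp [quadEnd, Matrix.mulVec, dotProduct, Fin.sum_univ_two]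

/-- A scalar matrix of trace zero vanishes: the diagonal entries `-b / 2` and `b / 2` are both `μ`.
-/
theorem eq_zero_of_quadEnd_eq_smul {a b c μ : ℂ} (h : ∀ w, quadEnd a b c w = μ • w) :
    a = 0 ∧ b = 0 ∧ c = 0 := by
  have h1 := congrFun (h ![1, 0]) 0
  have h2 := congrFun (h ![1, 0]) 1
  have h3 := congrFun (h ![0, 1]) 0
  have h4 := congrFun (h ![0, 1]) 1
  simp [quadEnd_apply_zero, quadEnd_apply_one] at h1 h2 h3 h4
  refine ⟨h2, ?_, h3⟩
  linear_combination h4 - h1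

/-- Equivariance of `quadEnd` under changes of coordinates. -/
theorem quadEnd_comp {a b c a' b' c' g₀₀ g₀₁ g₁₀ g₁₁ : ℂ} (hd : g₀₀ * g₁₁ - g₀₁ * g₁₀ ≠ 0)
    (h : ∀ t, g₀₀ + g₀₁ * t ≠ 0 →
      a' * (g₀₀ + g₀₁ * t) ^ 2 + b' * ((g₀₀ + g₀₁ * t) * (g₁₀ + g₁₁ * t)) +
        c' * (g₁₀ + g₁₁ * t) ^ 2 = (g₀₀ * g₁₁ - g₀₁ * g₁₀) * (a + b * t + c * t ^ 2))
    {G : (Fin 2 → ℂ) → (Fin 2 → ℂ)} (hG₀ : ∀ w, G w 0 = g₀₀ * w 0 + g₀₁ * w 1)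
    (hG₁ : ∀ w, G w 1 = g₁₀ * w 0 + g₁₁ * w 1) (w : Fin 2 → ℂ) :
    quadEnd a' b' c' (G w) = G (quadEnd a b c w) := by
  set d := g₀₀ * g₁₁ - g₀₁ * g₁₀ with hddef
  -- Compare coefficients of `t` in `Gv ∧ N'Gv = det G · (v ∧ Nv)`. The resulting identities contain
  -- `d = det G`, so `N'G = GN` is checked after multiplying by `d`.
  obtain ⟨h0, h1, h2⟩ := eq_zero_of_quadratic_eq_zero
    (a := a' * g₀₀ ^ 2 + b' * (g₀₀ * g₁₀) + c' * g₁₀ ^ 2 - d * a)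
    (b := 2 * a' * g₀₀ * g₀₁ + b' * (g₀₀ * g₁₁ + g₀₁ * g₁₀) + 2 * c' * g₁₀ * g₁₁ - d * b)
    (c := a' * g₀₁ ^ 2 + b' * (g₀₁ * g₁₁) + c' * g₁₁ ^ 2 - d * c) (α := g₀₀) (β := g₀₁)
    (fun h0 => hd (by rw [hddef, h0.1, h0.2]; ring)) (fun t ht => by
      linear_combination h t ht)
  ext i
  refine mul_left_cancel₀ hd ?_
  fin_cases i
  · simp only [Fin.zero_eta, quadEnd_apply_zero, quadEnd_apply_one, hG₀, hG₁]
    rw [hddef] at h0 h1 h2 ⊢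
    linear_combination g₀₁ * w 0 * h0 + (g₀₁ * w 1 - g₀₀ * w 0) / 2 * h1 - g₀₀ * w 1 * h2
  · simp only [Fin.mk_one, quadEnd_apply_zero, quadEnd_apply_one, hG₀, hG₁]
    rw [hddef] at h0 h1 h2 ⊢
    linear_combination g₁₁ * w 0 * h0 + (g₁₁ * w 1 - g₁₀ * w 0) / 2 * h1 - g₁₀ * w 1 * h2

/-! ### Vector fields on the ruled surface -/

section SurfaceFields

universe u w

variable {C : Type u} [TopologicalSpace C]
  {V : C → Type w} [∀ x, AddCommGroup (V x)] [∀ x, Module ℂ (V x)]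
  [TopologicalSpace (TotalSpace (Fin 2 → ℂ) V)] [∀ x, TopologicalSpace (V x)]
  [FiberBundle (Fin 2 → ℂ) V] [VectorBundle ℂ (Fin 2 → ℂ) V]
  [ChartedSpace ℂ C] [IsManifold 𝓘(ℂ) ω C] [ContMDiffVectorBundle ω (Fin 2 → ℂ) V 𝓘(ℂ)]

/-- The chart `projChart e φ i` as an open partial homeomorphism. -/
def surfChart (e : Trivialization (Fin 2 → ℂ) (π (Fin 2 → ℂ) V)) [MemTrivializationAtlas e]
    {φ : OpenPartialHomeomorph C ℂ} (hφ : φ ∈ atlas ℂ C) (i : Fin 2) :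
    OpenPartialHomeomorph (ProjBundle V) (ℂ × ℂ) :=
  (projCore V).openPartialHomeomorph (projChart e φ i) ⟨e, inferInstance, φ, hφ, i, rfl⟩

variable {e e' : Trivialization (Fin 2 → ℂ) (π (Fin 2 → ℂ) V)} [MemTrivializationAtlas e]
  [MemTrivializationAtlas e'] {φ φ' : OpenPartialHomeomorph C ℂ} (hφ : φ ∈ atlas ℂ C)
  (hφ' : φ' ∈ atlas ℂ C) (i i' : Fin 2)

theorem surfChart_mem_atlas : surfChart e hφ i ∈ atlas (ℂ × ℂ) (ProjBundle V) := by
  change _ ∈ ⋃ (e : PartialEquiv (ProjBundle V) (ℂ × ℂ)) (he : e ∈ (projCore V).atlas),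
    {(projCore V).openPartialHomeomorph e he}
  simp only [mem_iUnion]
  exact ⟨_, _, rfl⟩

theorem mem_surfChart_target {y : C} (hy : y ∈ φ.source) (hye : y ∈ e.baseSet) (t : ℂ) :
    (φ y, t) ∈ (surfChart e hφ i).target :=
  ⟨φ.map_source hy, by simpa [φ.left_inv hy] using hye⟩

variable (ξ : HolomorphicVectorField V)

theorem fieldCoord_projTrans {a : ℂ × ℂ}
    (ha : a ∈ ((projChart e φ i).symm.trans (projChart e' φ' i')).source) :
    DifferentiableAt ℂ (projTrans e e' φ φ' i i') a ∧
      fieldCoord ξ (surfChart e' hφ' i') (projTrans e e' φ φ' i i' a) =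
        fderiv ℂ (projTrans e e' φ φ' i i') a (fieldCoord ξ (surfChart e hφ i) a) := by
  have hn := (isOpen_projChart_trans_source e e' (φ' := φ') hφ i i').mem_nhds ha
  have heq : projTrans e e' φ φ' i i' =ᶠ[𝓝 a] surfChart e' hφ' i' ∘ (surfChart e hφ i).symm := by
    filter_upwards [hn] with b hb
    exact (projChart_trans_eqOn e e' φ φ' i i' hb).symm
  have hd : DifferentiableAt ℂ (projTrans e e' φ φ' i i') a :=
    (((contDiffOn_projTrans e e' hφ hφ' i i').contDiffAt hn).differentiableAt
      (by simp)).congr_of_eventuallyEq heq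
  exact ⟨hd, fieldCoord_transition ξ (surfChart_mem_atlas hφ i) ha.1 ha.2 heq hd⟩

variable {y : C}

/-- The transition law of the components of a vector field. -/
theorem fieldCoord_surfChart (hy : y ∈ φ.source) (hy' : y ∈ φ'.source) (hye : y ∈ e.baseSet)
    (hye' : y ∈ e'.baseSet) {t : ℂ} (ht : e.coordChangeL ℂ e' y (affVec i t) i' ≠ 0) :
    (fieldCoord ξ (surfChart e' hφ' i')
      (φ' y, affCoord i' (e.coordChangeL ℂ e' y (affVec i t)))).1 =
        deriv (φ' ∘ φ.symm) (φ y) * (fieldCoord ξ (surfChart e hφ i) (φ y, t)).1 ∧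
    ((fieldCoord ξ (surfChart e hφ i) (φ y, t)).1 = 0 →
      (fieldCoord ξ (surfChart e' hφ' i')
        (φ' y, affCoord i' (e.coordChangeL ℂ e' y (affVec i t)))).2 =
        deriv (fun t => affCoord i' (e.coordChangeL ℂ e' y (affVec i t))) t *
          (fieldCoord ξ (surfChart e hφ i) (φ y, t)).2) := by
  have ha : (φ y, t) ∈ ((projChart e φ i).symm.trans (projChart e' φ' i')).source := by
    rw [projChart_trans_source]
    simpa [φ.left_inv hy, φ.map_source hy] using ⟨⟨⟨hye, hye'⟩, hy'⟩, ht⟩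
  obtain ⟨hd, h⟩ := fieldCoord_projTrans hφ hφ' i i' ξ ha
  set τ := projTrans e e' φ φ' i i' with hτ
  have hτa : ∀ s, τ (φ y, s) = (φ' y, affCoord i' (e.coordChangeL ℂ e' y (affVec i s))) :=
    fun s => by
      simp only [hτ, projTrans, φ.left_inv hy]
      rfl
  rw [hτa] at h
  set X := fieldCoord ξ (surfChart e hφ i) (φ y, t) with hX
  constructor
  · have h1 : HasFDerivAt (fun a => (τ a).1)
        ((ContinuousLinearMap.fst ℂ ℂ ℂ).comp (fderiv ℂ τ (φ y, t))) (φ y, t) :=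
      (ContinuousLinearMap.fst ℂ ℂ ℂ).hasFDerivAt.comp _ hd.hasFDerivAt
    have h2 : HasDerivAt (φ' ∘ φ.symm) (deriv (φ' ∘ φ.symm) (φ y)) (φ y) :=
      (transition_analyticAt hφ hφ' (φ.map_source hy)
        (by rwa [φ.left_inv hy])).differentiableAt.hasDerivAt
    have h3 := h2.hasFDerivAt.comp (φ y, t) (hasFDerivAt_fst (𝕜 := ℂ) (p := (φ y, t)))
    have h4 := congrArg (fun D => D X) (h1.unique h3)
    rw [h]
    simpa [mul_comm] using h4
  -- When the base component is zero, the image under the transition map is its derivative along the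
  -- line `s ↦ (φ y, s)`. In general a mixed derivative would also contribute.
  · intro hX0
    have h1 : HasDerivAt (fun s => (φ y, s)) ((0 : ℂ), (1 : ℂ)) t :=
      (hasDerivAt_const t (φ y)).prodMk (hasDerivAt_id t)
    have h2 := hd.hasFDerivAt.comp_hasDerivAt t h1
    have h3 := (ContinuousLinearMap.snd ℂ ℂ ℂ).hasFDerivAt.comp_hasDerivAt t h2
    have h4 : (ContinuousLinearMap.snd ℂ ℂ ℂ) ∘ τ ∘ (fun s => (φ y, s)) =
        fun s => affCoord i' (e.coordChangeL ℂ e' y (affVec i s)) := by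
      funext s
      simp only [Function.comp_apply, hτa]
      rfl
    rw [h4] at h3
    rw [h3.deriv, h]
    have h5 : X = X.2 • ((0 : ℂ), (1 : ℂ)) := by
      ext <;> simp [hX0]
    conv_lhs => rw [h5, map_smul]
    simp [mul_comm]

theorem differentiable_fieldCoord (hy : y ∈ φ.source) (hye : y ∈ e.baseSet) :
    Differentiable ℂ fun t => fieldCoord ξ (surfChart e hφ i) (φ y, t) := fun t => by
  have h1 := ((contDiffOn_fieldCoord ξ (surfChart_mem_atlas hφ i)).contDiffAt
    ((surfChart e hφ i).open_target.mem_nhds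
      (mem_surfChart_target hφ i hy hye t))).differentiableAt (by simp)
  exact h1.comp t ((differentiableAt_const _).prodMk differentiableAt_id)

theorem contMDiffAt_fieldCoord (hy : y ∈ φ.source) (hye : y ∈ e.baseSet) (t : ℂ) :
    ContMDiffAt 𝓘(ℂ) 𝓘(ℂ, ℂ × ℂ) ω (fun x => fieldCoord ξ (surfChart e hφ i) (φ x, t)) y := by
  have h1 := ((contDiffOn_fieldCoord ξ (surfChart_mem_atlas hφ i)).contDiffAt
    ((surfChart e hφ i).open_target.mem_nhds (mem_surfChart_target hφ i hy hye t)))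
  have h2 : ContMDiffAt 𝓘(ℂ) 𝓘(ℂ, ℂ × ℂ) ω (fun x => (φ x, t)) y :=
    (contMDiffAt_chart hφ hy).prodMk_space contMDiffAt_const
  exact h1.contMDiffAt.comp y h2

theorem coordChangeL_self_apply (hye : y ∈ e.baseSet) (v : Fin 2 → ℂ) :
    e.coordChangeL ℂ e y v = v := by
  rw [← frame_frame_symm e e ⟨hye, hye⟩, LinearEquiv.apply_symm_apply]

theorem affCoord_affVec (t : ℂ) : affCoord (1 - i) (affVec i t) = t⁻¹ := by
  fin_cases i <;> simp [affCoord, affVec]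

/-- The two affine coordinates on the fibres. -/
theorem fieldCoord_inv (hy : y ∈ φ.source) (hye : y ∈ e.baseSet) {t : ℂ} (ht : t ≠ 0) :
    (fieldCoord ξ (surfChart e hφ (1 - i)) (φ y, t⁻¹)).1 =
        (fieldCoord ξ (surfChart e hφ i) (φ y, t)).1 ∧
    ((fieldCoord ξ (surfChart e hφ i) (φ y, t)).1 = 0 →
      (fieldCoord ξ (surfChart e hφ (1 - i)) (φ y, t⁻¹)).2 =
        -(t ^ 2)⁻¹ * (fieldCoord ξ (surfChart e hφ i) (φ y, t)).2) := by
  have h := fieldCoord_surfChart hφ hφ i (1 - i) ξ hy hy hye hye (t := t) (by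
    rw [coordChangeL_self_apply hye, affVec_other]; exact ht)
  simp only [coordChangeL_self_apply hye, affCoord_affVec] at h
  have h1 : deriv (φ ∘ φ.symm) (φ y) = 1 := by
    have : φ ∘ φ.symm =ᶠ[𝓝 (φ y)] id := by
      filter_upwards [φ.open_target.mem_nhds (φ.map_source hy)] with w hw
      exact φ.right_inv hw
    rw [this.deriv_eq, deriv_id]
  rw [h1, one_mul, deriv_inv] at h
  exact h

/-- The base component has the same value in both affine coordinates of a fibre, so it is a
holomorphic function on `ℙ¹`, hence constant. -/
theorem fieldCoord_fst_eq (hy : y ∈ φ.source) (hye : y ∈ e.baseSet) (t : ℂ) :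
    (fieldCoord ξ (surfChart e hφ i) (φ y, t)).1 =
      (fieldCoord ξ (surfChart e hφ (1 - i)) (φ y, 0)).1 :=
  eq_of_eq_comp_inv (f := fun t => (fieldCoord ξ (surfChart e hφ i) (φ y, t)).1)
    (g := fun t => (fieldCoord ξ (surfChart e hφ (1 - i)) (φ y, t)).1)
    (differentiable_fieldCoord hφ i ξ hy hye).fst
    (differentiable_fieldCoord hφ (1 - i) ξ hy hye).continuous.fst
    (fun _ ht => (fieldCoord_inv hφ i ξ hy hye ht).1.symm) t

variable (e) in
/-- The component of a vector field along the base. -/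
def baseComp (y : C) : ℂ := (fieldCoord ξ (surfChart e hφ 0) (φ y, 0)).1

theorem fieldCoord_fst (hy : y ∈ φ.source) (hye : y ∈ e.baseSet) (t : ℂ) :
    (fieldCoord ξ (surfChart e hφ i) (φ y, t)).1 = baseComp e hφ ξ y := by
  fin_cases i
  · exact (fieldCoord_fst_eq hφ 0 ξ hy hye t).trans (fieldCoord_fst_eq hφ 0 ξ hy hye 0).symm
  · exact fieldCoord_fst_eq hφ 1 ξ hy hye t

/-- The base component transforms as a vector field on `C`, and the trivialization of `V` does not
enter. -/
theorem baseComp_transition (hy : y ∈ φ.source) (hy' : y ∈ φ'.source) (hye : y ∈ e.baseSet)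
    (hye' : y ∈ e'.baseSet) :
    baseComp e' hφ' ξ y = deriv (φ' ∘ φ.symm) (φ y) * baseComp e hφ ξ y := by
  have hne : e.coordChangeL ℂ e' y (affVec 0 0) ≠ 0 := by
    rw [Ne, ContinuousLinearEquiv.map_eq_zero_iff]
    exact affVec_ne_zero 0 0
  obtain ⟨i', hi'⟩ := Function.ne_iff.mp hne
  have h := (fieldCoord_surfChart hφ hφ' 0 i' ξ hy hy' hye hye' hi').1
  rwa [fieldCoord_fst hφ' i' ξ hy' hye', fieldCoord_fst hφ 0 ξ hy hye] at h

end SurfaceFields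

/-! ### A field with a zero is vertical -/

section VanishingBase

universe u w

variable {C : Type u} [TopologicalSpace C]
  {V : C → Type w} [∀ x, AddCommGroup (V x)] [∀ x, Module ℂ (V x)]
  [TopologicalSpace (TotalSpace (Fin 2 → ℂ) V)] [∀ x, TopologicalSpace (V x)]
  [FiberBundle (Fin 2 → ℂ) V] [VectorBundle ℂ (Fin 2 → ℂ) V]
  [ChartedSpace ℂ C] [IsManifold 𝓘(ℂ) ω C] [ContMDiffVectorBundle ω (Fin 2 → ℂ) V 𝓘(ℂ)]

/-- The chart of `ℙ(V)` given by the preferred trivialization and chart at `x`. -/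
abbrev surfChartAt (V : C → Type w) [∀ x, AddCommGroup (V x)] [∀ x, Module ℂ (V x)]
    [TopologicalSpace (TotalSpace (Fin 2 → ℂ) V)] [∀ x, TopologicalSpace (V x)]
    [FiberBundle (Fin 2 → ℂ) V] [VectorBundle ℂ (Fin 2 → ℂ) V]
    [ContMDiffVectorBundle ω (Fin 2 → ℂ) V 𝓘(ℂ)] (x : C) (i : Fin 2) :
    OpenPartialHomeomorph (ProjBundle V) (ℂ × ℂ) :=
  surfChart (trivializationAt (Fin 2 → ℂ) V x) (chart_mem_atlas ℂ x) i

/-- The component along the base, in the preferred coordinates at `x`. -/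
abbrev baseCompAt (ξ : HolomorphicVectorField V) (x y : C) : ℂ :=
  baseComp (trivializationAt (Fin 2 → ℂ) V x) (chart_mem_atlas ℂ x) ξ y

theorem exists_surfChartAt_symm_eq (s : ProjBundle V) : ∃ i t,
    (surfChartAt V s.base i).symm (chartAt ℂ s.base s.base, t) = s := by
  obtain ⟨i, hi⟩ := Function.ne_iff.mp
    (homCoord_ne_zero (trivializationAt (Fin 2 → ℂ) V s.base) s)
  exact ⟨i, _, (surfChartAt V s.base i).left_inv (x := s)
    ⟨mem_chart_source ℂ s.base, FiberBundle.mem_baseSet_trivializationAt' s.base, hi⟩⟩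

theorem eventually_mem_chart_and_baseSet (x : C) :
    ∀ᶠ y in 𝓝 x, y ∈ (chartAt ℂ x).source ∧ y ∈ (trivializationAt (Fin 2 → ℂ) V x).baseSet := by
  filter_upwards [(chartAt ℂ x).open_source.mem_nhds (mem_chart_source ℂ x),
    eventually_mem_baseSet (F := Fin 2 → ℂ) (V := V) x] with y h1 h2
  exact ⟨h1, h2⟩

theorem contMDiffAt_baseCompAt (ξ : HolomorphicVectorField V) (x : C) :
    ContMDiffAt 𝓘(ℂ) 𝓘(ℂ) ω (baseCompAt ξ x) x :=
  (ContinuousLinearMap.fst ℂ ℂ ℂ).contMDiff.contMDiffAt.comp x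
    (contMDiffAt_fieldCoord (chart_mem_atlas ℂ x) 0 ξ (mem_chart_source ℂ x)
      (FiberBundle.mem_baseSet_trivializationAt' x) 0)

/-- On a ruled surface over a curve of positive genus, a holomorphic vector field with a zero is
vertical. -/
theorem baseCompAt_eq_zero [T2Space C] [CompactSpace C] [ConnectedSpace C] (hg : 1 ≤ genus C)
    {ξ : HolomorphicVectorField V} {s : ProjBundle V} (hs : ξ s = 0) (x : C) :
    baseCompAt ξ x x = 0 := by
  have hg' : Module.finrank ℂ (HolomorphicOneForm C) ≠ 0 := by
    rw [genus] at hg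
    omega
  have := Module.nontrivial_of_finrank_pos (Nat.pos_of_ne_zero hg')
  obtain ⟨η, hη⟩ := exists_ne (0 : HolomorphicOneForm C)
  -- The pairing of `η` with the vector field induced on `C`. The chain rule factors of the two
  -- terms cancel, so it is a global holomorphic function and hence constant; the zero of `ξ` makes
  -- it 0.
  set u : C → ℂ := fun y => formCoef η (chartAt ℂ y) y * baseCompAt ξ y y with hu
  have huloc : ∀ x, (fun y => formCoef η (chartAt ℂ x) y * baseCompAt ξ x y) =ᶠ[𝓝 x] u := by
    intro x
    filter_upwards [eventually_mem_chart_and_baseSet (V := V) x] with y hy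
    have hyy := mem_chart_source ℂ y
    rw [hu]
    simp only
    rw [formCoef_eq η (chart_mem_atlas ℂ y) (chart_mem_atlas ℂ x) hyy hy.1, baseCompAt,
      baseComp_transition (chart_mem_atlas ℂ y) (chart_mem_atlas ℂ x) ξ hyy hy.1
        (FiberBundle.mem_baseSet_trivializationAt' y) hy.2]
    ring
  have huhol : ∀ x, ContMDiffAt 𝓘(ℂ) 𝓘(ℂ) ω u x := fun x =>
    ((contMDiffAt_of_analyticAt (chart_mem_atlas ℂ x) (mem_chart_source ℂ x)
      (analyticAt_formCoef η (chart_mem_atlas ℂ x) (mem_chart_target ℂ x))).mul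
      (contMDiffAt_baseCompAt ξ x)).congr_of_eventuallyEq (huloc x).symm
  obtain ⟨c, hc⟩ := exists_eq_const huhol
  have hc0 : c = 0 := by
    obtain ⟨i, t, hit⟩ := exists_surfChartAt_symm_eq s
    have hss := mem_chart_source ℂ s.base
    have hse := FiberBundle.mem_baseSet_trivializationAt' (F := Fin 2 → ℂ) (E := V) s.base
    have h1 := (fieldCoord_eq_zero_iff ξ (surfChart_mem_atlas (chart_mem_atlas ℂ s.base) i)
      (mem_surfChart_target (chart_mem_atlas ℂ s.base) i hss hse t)).mpr (by
        change ξ ((surfChartAt V s.base i).symm (chartAt ℂ s.base s.base, t)) = 0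
        rw [hit]
        exact hs)
    have h2 := fieldCoord_fst (chart_mem_atlas ℂ s.base) i ξ hss hse t
    rw [h1] at h2
    rw [← hc s.base, hu]
    simp only
    rw [baseCompAt, ← h2]
    simp
  have hev : ∀ᶠ y in 𝓝[≠] x, baseCompAt ξ x y = 0 := by
    filter_upwards [eventually_ne_zero_of_form_ne_zero hη x, nhdsWithin_le_nhds (huloc x),
      nhdsWithin_le_nhds (eventually_mem_chart_and_baseSet (V := V) x)] with y h1 h2 h3
    rw [hc, hc0] at h2
    refine (mul_eq_zero.mp h2).resolve_left fun h => h1 ?_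
    exact eq_zero_of_formCoef_eq_zero η (chart_mem_atlas ℂ x) h3.1 h
  have h1 := (contMDiffAt_baseCompAt ξ x).continuousAt.tendsto.mono_left
    (nhdsWithin_le_nhds (s := {x}ᶜ))
  exact tendsto_nhds_unique h1 (tendsto_const_nhds.congr' (hev.mono fun y hy => hy.symm))

end VanishingBase

/-! ### Vertical fields as traceless endomorphisms of `V` -/

section Vertical

universe u w

variable {C : Type u} [TopologicalSpace C]
  {V : C → Type w} [∀ x, AddCommGroup (V x)] [∀ x, Module ℂ (V x)]
  [TopologicalSpace (TotalSpace (Fin 2 → ℂ) V)] [∀ x, TopologicalSpace (V x)]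
  [FiberBundle (Fin 2 → ℂ) V] [VectorBundle ℂ (Fin 2 → ℂ) V]
  [ChartedSpace ℂ C] [IsManifold 𝓘(ℂ) ω C] [ContMDiffVectorBundle ω (Fin 2 → ℂ) V 𝓘(ℂ)]
  {e e' : Trivialization (Fin 2 → ℂ) (π (Fin 2 → ℂ) V)} [MemTrivializationAtlas e]
  [MemTrivializationAtlas e'] {φ φ' : OpenPartialHomeomorph C ℂ} (hφ : φ ∈ atlas ℂ C)
  (hφ' : φ' ∈ atlas ℂ C) {ξ : HolomorphicVectorField V}

variable (e ξ) in
/-- The vertical component of a vector field. -/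
def vertComp (y : C) (t : ℂ) : ℂ := (fieldCoord ξ (surfChart e hφ 0) (φ y, t)).2

variable (e ξ) in
/-- The endomorphism of `ℂ²` corresponding to a vertical vector field on a fibre. -/
def vertEnd (y : C) : (Fin 2 → ℂ) →ₗ[ℂ] (Fin 2 → ℂ) :=
  quadEnd (vertComp e hφ ξ y 0) ((vertComp e hφ ξ y 1 - vertComp e hφ ξ y (-1)) / 2)
    ((vertComp e hφ ξ y 1 + vertComp e hφ ξ y (-1)) / 2 - vertComp e hφ ξ y 0)

variable {y : C}

theorem fieldCoord_fst_eq_zero (h0 : ∀ x, baseCompAt ξ x x = 0) (hy : y ∈ φ.source)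
    (hye : y ∈ e.baseSet) (i : Fin 2) (t : ℂ) :
    (fieldCoord ξ (surfChart e hφ i) (φ y, t)).1 = 0 := by
  rw [fieldCoord_fst hφ i ξ hy hye, baseComp_transition (chart_mem_atlas ℂ y) hφ ξ
    (mem_chart_source ℂ y) hy (FiberBundle.mem_baseSet_trivializationAt' y) hye]
  exact mul_eq_zero_of_right _ (h0 y)

theorem fieldCoord_one_snd (h0 : ∀ x, baseCompAt ξ x x = 0) (hy : y ∈ φ.source)
    (hye : y ∈ e.baseSet) {t : ℂ} (ht : t ≠ 0) :
    (fieldCoord ξ (surfChart e hφ 1) (φ y, t⁻¹)).2 = -(t ^ 2)⁻¹ * vertComp e hφ ξ y t :=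
  (fieldCoord_inv hφ 0 ξ hy hye ht).2 (fieldCoord_fst_eq_zero hφ h0 hy hye 0 t)

/-- The component is quadratic in `t`, because a field on `ℙ¹` transforms by `-t²` under inversion.
Interpolation at 0, 1 and -1 makes the coefficients visibly holomorphic in `y`. -/
theorem vertComp_eq (h0 : ∀ x, baseCompAt ξ x x = 0) (hy : y ∈ φ.source)
    (hye : y ∈ e.baseSet) (t : ℂ) :
    vertComp e hφ ξ y t = vertComp e hφ ξ y 0 +
      (vertComp e hφ ξ y 1 - vertComp e hφ ξ y (-1)) / 2 * t +
      ((vertComp e hφ ξ y 1 + vertComp e hφ ξ y (-1)) / 2 - vertComp e hφ ξ y 0) * t ^ 2 := by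
  obtain ⟨a, b, c, h⟩ := exists_quadratic (f := vertComp e hφ ξ y)
    (g := fun t => (fieldCoord ξ (surfChart e hφ 1) (φ y, t)).2)
    (differentiable_fieldCoord hφ 0 ξ hy hye).snd
    (differentiable_fieldCoord hφ 1 ξ hy hye).continuous.snd (fun t ht => by
      rw [fieldCoord_one_snd hφ h0 hy hye ht]
      field_simp)
  rw [h t, h 0, h 1, h (-1)]
  ring

/-- On a fibre the transition is the Möbius map `t ↦ (g₁₀ + g₁₁ t) / (g₀₀ + g₀₁ t)`, with derivative
`det G / (g₀₀ + g₀₁ t)²`. Clearing denominators in the transformation law of the field gives the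
hypothesis of `quadEnd_comp`. -/
theorem vertEnd_coordChange (h0 : ∀ x, baseCompAt ξ x x = 0) (hy : y ∈ φ.source)
    (hy' : y ∈ φ'.source) (hye : y ∈ e.baseSet) (hye' : y ∈ e'.baseSet) (w : Fin 2 → ℂ) :
    vertEnd e' hφ' ξ y (e.coordChangeL ℂ e' y w) =
      e.coordChangeL ℂ e' y (vertEnd e hφ ξ y w) := by
  set G := e.coordChangeL ℂ e' y with hG
  set g₀₀ := G ![1, 0] 0 with hg₀₀
  set g₀₁ := G ![0, 1] 0 with hg₀₁
  set g₁₀ := G ![1, 0] 1 with hg₁₀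
  set g₁₁ := G ![0, 1] 1 with hg₁₁
  have hGw : ∀ w, G w = w 0 • G ![1, 0] + w 1 • G ![0, 1] := fun w => by
    rw [← map_smul, ← map_smul, ← map_add]
    congr 1
    ext i
    fin_cases i <;> simp
  have hG₀ : ∀ w, G w 0 = g₀₀ * w 0 + g₀₁ * w 1 := fun w => by
    rw [hGw]
    simp only [Pi.add_apply, Pi.smul_apply, smul_eq_mul]
    ring
  have hG₁ : ∀ w, G w 1 = g₁₀ * w 0 + g₁₁ * w 1 := fun w => by
    rw [hGw]
    simp only [Pi.add_apply, Pi.smul_apply, smul_eq_mul]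
    ring
  have hinj : ∀ w, G w 0 = 0 → G w 1 = 0 → w = 0 := fun w h1 h2 => by
    refine (ContinuousLinearEquiv.map_eq_zero_iff G).mp ?_
    ext i
    fin_cases i
    · exact h1
    · exact h2
  -- If the determinant vanished, the columns of the adjugate matrix would lie in the kernel of `G`,
  -- so all entries would be zero.
  have hd : g₀₀ * g₁₁ - g₀₁ * g₁₀ ≠ 0 := by
    intro hd
    have h1 := hinj ![g₁₁, -g₁₀] (by rw [hG₀]; simp; linear_combination hd) (by rw [hG₁]; simp; ring)
    have h2 := hinj ![-g₀₁, g₀₀] (by rw [hG₀]; simp; ring)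
      (by rw [hG₁]; simp; linear_combination hd)
    have h3 := hinj ![1, 0] (by simpa using congrFun h2 1) (by simpa using congrFun h1 1)
    exact one_ne_zero (congrFun h3 0)
  refine quadEnd_comp hd (fun t ht => ?_) (G := G) hG₀ hG₁ w
  have haff₀ : ∀ t, G (affVec 0 t) 0 = g₀₀ + g₀₁ * t := fun t => by
    rw [hG₀]; simp [affVec]
  have haff₁ : ∀ t, G (affVec 0 t) 1 = g₁₀ + g₁₁ * t := fun t => by
    rw [hG₁]; simp [affVec]
  have h := (fieldCoord_surfChart hφ hφ' 0 0 ξ hy hy' hye hye' (t := t)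
    (by rw [← hG, haff₀]; exact ht)).2 (fieldCoord_fst_eq_zero hφ h0 hy hye 0 t)
  have haff : ∀ t, affCoord 0 (G (affVec 0 t)) = (g₁₀ + g₁₁ * t) / (g₀₀ + g₀₁ * t) := fun t => by
    rw [← haff₀, ← haff₁]
    rfl
  have hder : HasDerivAt (fun t => (g₁₀ + g₁₁ * t) / (g₀₀ + g₀₁ * t))
      ((g₁₁ * (g₀₀ + g₀₁ * t) - (g₁₀ + g₁₁ * t) * g₀₁) / (g₀₀ + g₀₁ * t) ^ 2) t := by
    have hl : ∀ α β : ℂ, HasDerivAt (fun t => α + β * t) β t := fun α β => by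
      simpa using ((hasDerivAt_id t).const_mul β).const_add α
    exact (hl _ _).div (hl _ _) ht
  simp only [← hG, haff, hder.deriv] at h
  change vertComp e' hφ' ξ y _ = _ * vertComp e hφ ξ y t at h
  rw [vertComp_eq hφ' h0 hy' hye', vertComp_eq hφ h0 hy hye t] at h
  have clear_denom : ∀ {a b c N P Q R : ℂ}, P ≠ 0 →
      a + b * (Q / P) + c * (Q / P) ^ 2 = N / P ^ 2 * R →
      a * P ^ 2 + b * (P * Q) + c * Q ^ 2 = N * R := fun hP h => by
    field_simp at h
    linear_combination h
  linear_combination clear_denom ht h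

/-- The endomorphism of `V` corresponding to a vertical vector field. -/
def bundleEnd (ξ : HolomorphicVectorField V) (y : C) : V y →ₗ[ℂ] V y :=
  (trivializationAt (Fin 2 → ℂ) V y).symmₗ ℂ y ∘ₗ
    vertEnd (trivializationAt (Fin 2 → ℂ) V y) (chart_mem_atlas ℂ y) ξ y ∘ₗ
      coordMap (Fin 2 → ℂ) V y y

theorem coordChangeL_coordMap {x : C} (hy : y ∈ (trivializationAt (Fin 2 → ℂ) V x).baseSet)
    (v : V y) : (trivializationAt (Fin 2 → ℂ) V y).coordChangeL ℂ
      (trivializationAt (Fin 2 → ℂ) V x) y (coordMap (Fin 2 → ℂ) V y y v) =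
        coordMap (Fin 2 → ℂ) V x y v := by
  have hyy := FiberBundle.mem_baseSet_trivializationAt' (F := Fin 2 → ℂ) (E := V) y
  rw [Trivialization.coordChangeL_apply _ _ ⟨hyy, hy⟩, coordMap, coordMap,
    Trivialization.coe_linearMapAt_of_mem _ hy, Trivialization.coe_linearMapAt_of_mem _ hyy,
    Trivialization.symm_apply_apply_mk _ hyy]

/-- `bundleEnd` is built from a different trivialization at each point. Equivariance lets it be read
near `x` in the single trivialization at `x`, where its entries are holomorphic. -/
theorem coordMap_bundleEnd (h0 : ∀ x, baseCompAt ξ x x = 0) {x : C}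
    (hy : y ∈ (chartAt ℂ x).source) (hye : y ∈ (trivializationAt (Fin 2 → ℂ) V x).baseSet)
    (v : V y) : coordMap (Fin 2 → ℂ) V x y (bundleEnd ξ y v) =
      vertEnd (trivializationAt (Fin 2 → ℂ) V x) (chart_mem_atlas ℂ x) ξ y
        (coordMap (Fin 2 → ℂ) V x y v) := by
  have hyy := FiberBundle.mem_baseSet_trivializationAt' (F := Fin 2 → ℂ) (E := V) y
  rw [← coordChangeL_coordMap hye, ← coordChangeL_coordMap hye,
    vertEnd_coordChange (chart_mem_atlas ℂ y) (chart_mem_atlas ℂ x) h0 (mem_chart_source ℂ y) hy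
      hyy hye]
  congr 1
  exact coordMap_constSec hyy _

theorem holSecAt_bundleEnd (h0 : ∀ x, baseCompAt ξ x x = 0) {u : ∀ y, V y} {x : C}
    (hu : HolSecAt (Fin 2 → ℂ) u x) :
    HolSecAt (Fin 2 → ℂ) (fun y => bundleEnd ξ y (u y)) x := by
  have hc : ∀ t, ContMDiffAt 𝓘(ℂ) 𝓘(ℂ) ω
      (fun y => vertComp (trivializationAt (Fin 2 → ℂ) V x) (chart_mem_atlas ℂ x) ξ y t) x :=
    fun t => (ContinuousLinearMap.snd ℂ ℂ ℂ).contMDiff.contMDiffAt.comp x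
      (contMDiffAt_fieldCoord (chart_mem_atlas ℂ x) 0 ξ (mem_chart_source ℂ x)
        (FiberBundle.mem_baseSet_trivializationAt' x) t)
  have hb := ((hc 1).sub (hc (-1))).div_const 2
  have hc' := (((hc 1).add (hc (-1))).div_const 2).sub (hc 0)
  have hu' := contMDiffAt_pi_space.mp (holSecAt_iff.mp hu)
  refine holSecAt_iff.mpr (ContMDiffAt.congr_of_eventuallyEq
    (f := fun y => vertEnd (trivializationAt (Fin 2 → ℂ) V x) (chart_mem_atlas ℂ x) ξ y
      (coordMap (Fin 2 → ℂ) V x y (u y))) (contMDiffAt_pi_space.mpr fun i => ?_) ?_)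
  · fin_cases i
    · simp only [Fin.zero_eta, vertEnd, quadEnd_apply_zero]
      exact ((hb.neg.div_const 2).mul (hu' 0)).sub (hc'.mul (hu' 1))
    · simp only [Fin.mk_one, vertEnd, quadEnd_apply_one]
      exact ((hc 0).mul (hu' 0)).add ((hb.div_const 2).mul (hu' 1))
  · filter_upwards [eventually_mem_chart_and_baseSet (V := V) x] with y hy
    exact coordMap_bundleEnd h0 hy.1 hy.2 _

/-- A vertical vector field whose associated endomorphism is scalar vanishes. -/
theorem eq_zero_of_bundleEnd_eq_smul (h0 : ∀ x, baseCompAt ξ x x = 0) {μ : ℂ}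
    (hμ : ∀ y v, bundleEnd ξ y v = μ • v) : ξ = 0 := by
  refine ContMDiffSection.ext fun s => ?_
  obtain ⟨i, t, hit⟩ := exists_surfChartAt_symm_eq s
  set y := s.base
  have hy := mem_chart_source ℂ y
  have hye := FiberBundle.mem_baseSet_trivializationAt' (F := Fin 2 → ℂ) (E := V) y
  have hcoef := eq_zero_of_quadEnd_eq_smul (μ := μ) (fun w => by
    have h1 := coordMap_bundleEnd h0 hy hye (constSec (Fin 2 → ℂ) V y w y)
    rw [hμ, map_smul, coordMap_constSec hye] at h1
    exact h1.symm)
  have hv : ∀ t, vertComp (trivializationAt (Fin 2 → ℂ) V y) (chart_mem_atlas ℂ y) ξ y t = 0 :=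
    fun t => by
      rw [vertComp_eq (chart_mem_atlas ℂ y) h0 hy hye t]
      linear_combination hcoef.1 + t * hcoef.2.1 + t ^ 2 * hcoef.2.2
  -- The second affine chart adds only the point at infinity of the fibre, where the field vanishes
  -- by continuity.
  have h1 : ∀ t, (fieldCoord ξ (surfChartAt V y 1) (chartAt ℂ y y, t)).2 = 0 := by
    have hcont := (differentiable_fieldCoord (chart_mem_atlas ℂ y) 1 ξ hy hye).continuous.snd
    refine congrFun (Continuous.ext_on (dense_compl_singleton (0 : ℂ)) hcont continuous_const
      fun t ht => ?_)
    have h2 := fieldCoord_one_snd (chart_mem_atlas ℂ y) h0 hy hye (inv_ne_zero ht)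
    rw [inv_inv, hv, mul_zero] at h2
    exact h2
  have h2 : fieldCoord ξ (surfChartAt V y i) (chartAt ℂ y y, t) = 0 := by
    refine Prod.ext (fieldCoord_fst_eq_zero (chart_mem_atlas ℂ y) h0 hy hye i t) ?_
    fin_cases i
    · exact hv t
    · exact h1 t
  have h3 := (fieldCoord_eq_zero_iff ξ (surfChart_mem_atlas (chart_mem_atlas ℂ y) i)
    (mem_surfChart_target (chart_mem_atlas ℂ y) i hy hye t)).mp h2
  rw [hit] at h3
  exact h3

end Vertical

end RuledSurface

end

open RuledSurface in
theorem mainTheorem10 {C : Type*} [TopologicalSpace C] [T2Space C] [CompactSpace C]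
    [ConnectedSpace C] [ChartedSpace ℂ C] [IsManifold 𝓘(ℂ) ω C]
    (hg : 1 ≤ genus C) (p : C)
    (V : C → Type*) [∀ x, AddCommGroup (V x)] [∀ x, Module ℂ (V x)]
    [TopologicalSpace (TotalSpace (Fin 2 → ℂ) V)] [∀ x, TopologicalSpace (V x)]
    [FiberBundle (Fin 2 → ℂ) V] [VectorBundle ℂ (Fin 2 → ℂ) V]
    [ContMDiffVectorBundle ω (Fin 2 → ℂ) V 𝓘(ℂ)]
    (ι : HolHom ℂ (Bundle.Trivial C ℂ) (Fin 2 → ℂ) V)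
    (q : HolHom (Fin 2 → ℂ) V ℂ (PointBundle p))
    (hι : ∀ x, Function.Injective (ι.toFun x))
    (hexact : ∀ x, LinearMap.range (ι.toFun x) = LinearMap.ker (q.toFun x))
    (hq : ∀ x, Function.Surjective (q.toFun x))
    (hnontrivial : ¬ ∃ s : HolHom ℂ (PointBundle p) (Fin 2 → ℂ) V,
      ∀ x, q.toFun x ∘ₗ s.toFun x = LinearMap.id) :
    IsStable (Fin 2 → ℂ) V ∧
      ∀ ξ : HolomorphicVectorField V, (∃ s : ProjBundle V, ξ s = 0) → ξ = 0 := by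
  refine ⟨isStable_of_nontrivial_extension hι hexact hq hnontrivial, fun ξ ⟨s, hs⟩ => ?_⟩
  have h0 := baseCompAt_eq_zero hg hs
  obtain ⟨μ, hμ⟩ := exists_eq_smul_id hg hι hexact hq hnontrivial
    (φ := bundleEnd ξ) fun _ _ hu => holSecAt_bundleEnd h0 hu
  exact eq_zero_of_bundleEnd_eq_smul h0 hμ
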